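/- Let $\Omega\subset\mathbb{R}^2$ be a bounded Lipschitz domain (open, connected, and near each boundary point lying above the graph of a Lipschitz function in suitable orthonormal coordinates), let $K\subset\Omega$ be a Lebesgue measurable set of positive measure, let $t>1$, $\lambda>0$ and $f\in L^t(K)$. Let $\mathbb{R}^{2\times2}_{sym,+}$ be the set of real symmetric positive definite $2\times2$ matrices and let $C^0(\overline\Omega,\mathbb{R}^{2\times2}_{sym,+})$ carry the topology of uniform convergence. For $R>0$ put $B_R^K:=\{w\in W^{1,2}(\Omega):\|w\|_{L^t(K)}\le R\}$. Suppose that $$\mathbf D:\ W^{1,2}(\Omega)\to C^0(\overline\Omega,\mathbb{R}^{2\times2}_{sym,+})$$ is continuous and that for every $R>0$ the set $\mathbf D(B_R^K)$ is precompact in $C^0(\overline\Omega,\mathbb{R}^{2\times2}_{sym,+})$, i.e. its closure in this space (of positive definite tensor fields) is compact. Then there exists $u\in W^{1,2}(\Omega)$ which is a weak solution of $$\operatorname{div}\big[\mathbf D(u)\nabla u\big]=\lambda\,\chi_K\,t\,|u-f|^{t-2}(u-f)\ \text{ in }\Omega,\qquad \mathbf D(u)\nabla u\cdot\mathcal N=0\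 \text{ on }\partial\Omega,$$ where $\chi_K$ is the characteristic function of $K$, $\mathcal N$ is the outward unit normal, and the term $|u-f|^{t-2}(u-f)$ is read as $0$ where $u=f$. That is, for every $\varphi\in W^{1,2}(\Omega)$ the two integrands below are integrable and $$\int_\Omega \mathbf D(u)\nabla u\cdot\nabla\varphi\,dx+\lambda\int_K t\,|u-f|^{t-2}(u-f)\,\varphi\,dx=0 .$$ -/

import Mathlib

open MeasureTheory Set
open scoped ENNReal NNReal ContDiff Matrix

noncomputable section

/-- The Euclidean plane. -/
abbrev Plane : Type := EuclideanSpace ℝ (Fin 2)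

/-- Bounded Lipschitz domain in the plane: a nonempty, open, connected and bounded set which, near
each boundary point, is the part of the plane lying above the graph of a Lipschitz function with
respect to some orthonormal system of coordinates. -/
structure IsBoundedLipschitzDomain (Ω : Set Plane) : Prop where
  isOpen : IsOpen Ω
  isConnected : IsConnected Ω
  isBounded : Bornology.IsBounded Ω
  boundary : ∀ p ∈ frontier Ω, ∃ r > (0 : ℝ), ∃ e : Plane ≃ₗᵢ[ℝ] Plane, ∃ L : ℝ≥0, ∃ γ : ℝ → ℝ,
    LipschitzWith L γ ∧
      Ω ∩ Metric.ball p r = {x | γ (e x 0) < e x 1} ∩ Metric.ball p r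

/-- `g` is the weak (distributional) gradient of `u` in `Ω`. -/
def HasWeakGradient (Ω : Set Plane) (u : Plane → ℝ) (g : Plane → Plane) : Prop :=
  ∀ φ : Plane → ℝ, ContDiff ℝ ∞ φ → HasCompactSupport φ → tsupport φ ⊆ Ω → ∀ i : Fin 2,
    ∫ x in Ω, u x * fderiv ℝ φ x (EuclideanSpace.single i 1) = - ∫ x in Ω, g x i * φ x

/-- The Hilbert space `L²(Ω) × L²(Ω; ℝ²)`, with norm `(‖u‖² + ‖g‖²)^(1/2)`. -/
abbrev L2Pair (Ω : Set Plane) : Type :=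
  WithLp 2 (Lp ℝ 2 (volume.restrict Ω) × Lp Plane 2 (volume.restrict Ω))

/-- A test function and its partial derivatives are square integrable. -/
theorem memLp_test (Ω : Set Plane) {φ : Plane → ℝ} (hφ : ContDiff ℝ ∞ φ)
    (hc : HasCompactSupport φ) :
    MemLp φ 2 (volume.restrict Ω) ∧
      ∀ v : Plane, MemLp (fun x => fderiv ℝ φ x v) 2 (volume.restrict Ω) := by
  refine ⟨hφ.continuous.memLp_of_hasCompactSupport hc, fun v => ?_⟩
  have h1 : Continuous (fun x => fderiv ℝ φ x v) :=
    (hφ.continuous_fderiv (by simp)).clm_apply continuous_const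
  exact h1.memLp_of_hasCompactSupport (hc.fderiv_apply (𝕜 := ℝ) v)

/-- A component of a square integrable vector field is square integrable. -/
theorem memLp_component {Ω : Set Plane} (g : Lp Plane 2 (volume.restrict Ω)) (i : Fin 2) :
    MemLp (fun x => g x i) 2 (volume.restrict Ω) :=
  (EuclideanSpace.proj (𝕜 := ℝ) i : Plane →L[ℝ] ℝ).comp_memLp' (Lp.memLp g)

/-- The Sobolev space `W^{1,2}(Ω)`, with norm `(‖u‖² + ‖∇u‖²)^(1/2)` in `L²`: an element is a
function `u ∈ L²(Ω)` that has a weak gradient in `L²(Ω; ℝ²)`, stored with that (unique) gradient. -/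
def W12 (Ω : Set Plane) : Submodule ℝ (L2Pair Ω) where
  carrier := {p | HasWeakGradient Ω p.fst p.snd}
  zero_mem' := by
    intro φ _ _ _ i
    have h1 : ∀ᵐ x ∂(volume.restrict Ω), ((0 : L2Pair Ω).fst : Plane → ℝ) x = 0 :=
      Lp.coeFn_zero _ _ _
    have h2 : ∀ᵐ x ∂(volume.restrict Ω), ((0 : L2Pair Ω).snd : Plane → Plane) x = 0 :=
      Lp.coeFn_zero _ _ _
    rw [integral_eq_zero_of_ae, integral_eq_zero_of_ae, neg_zero]
    · filter_upwards [h2] with x hx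
      rw [hx]
      simp
    · filter_upwards [h1] with x hx
      rw [hx]
      simp
  add_mem' := by
    intro a b ha hb φ hφ hc hs i
    obtain ⟨m1, m2⟩ := memLp_test Ω hφ hc
    have h1 : ∀ᵐ x ∂(volume.restrict Ω), ((a + b).fst : Plane → ℝ) x = a.fst x + b.fst x :=
      Lp.coeFn_add a.fst b.fst
    have h2 : ∀ᵐ x ∂(volume.restrict Ω), ((a + b).snd : Plane → Plane) x = a.snd x + b.snd x :=
      Lp.coeFn_add a.snd b.snd
    have e1 : ∫ x in Ω, ((a + b).fst : Plane → ℝ) x * fderiv ℝ φ x (EuclideanSpace.single i 1)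
        = ∫ x in Ω, (a.fst x * fderiv ℝ φ x (EuclideanSpace.single i 1)
          + b.fst x * fderiv ℝ φ x (EuclideanSpace.single i 1)) := by
      apply integral_congr_ae
      filter_upwards [h1] with x hx
      rw [hx, add_mul]
    have e2 : ∫ x in Ω, ((a + b).snd : Plane → Plane) x i * φ x
        = ∫ x in Ω, (a.snd x i * φ x + b.snd x i * φ x) := by
      apply integral_congr_ae
      filter_upwards [h2] with x hx
      rw [hx, PiLp.add_apply, add_mul]
    have i1 (p : L2Pair Ω) : Integrable
        (fun x => p.fst x * fderiv ℝ φ x (EuclideanSpace.single i 1)) (volume.restrict Ω) :=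
      (Lp.memLp p.fst).integrable_mul (m2 _)
    have i2 (p : L2Pair Ω) : Integrable (fun x => p.snd x i * φ x) (volume.restrict Ω) :=
      (memLp_component p.snd i).integrable_mul m1
    rw [e1, e2, integral_add (i1 a) (i1 b), integral_add (i2 a) (i2 b), ha φ hφ hc hs i,
      hb φ hφ hc hs i]
    ring
  smul_mem' := by
    intro c a ha φ hφ hc hs i
    have h1 : ∀ᵐ x ∂(volume.restrict Ω), ((c • a).fst : Plane → ℝ) x = c * a.fst x :=
      Lp.coeFn_smul c a.fst
    have h2 : ∀ᵐ x ∂(volume.restrict Ω), ((c • a).snd : Plane → Plane) x = c • a.snd x :=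
      Lp.coeFn_smul c a.snd
    have e1 : ∫ x in Ω, ((c • a).fst : Plane → ℝ) x * fderiv ℝ φ x (EuclideanSpace.single i 1)
        = ∫ x in Ω, c * (a.fst x * fderiv ℝ φ x (EuclideanSpace.single i 1)) := by
      apply integral_congr_ae
      filter_upwards [h1] with x hx
      rw [hx, mul_assoc]
    have e2 : ∫ x in Ω, ((c • a).snd : Plane → Plane) x i * φ x
        = ∫ x in Ω, c * (a.snd x i * φ x) := by
      apply integral_congr_ae
      filter_upwards [h2] with x hx
      rw [hx, PiLp.smul_apply, smul_eq_mul, mul_assoc]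
    rw [e1, e2, integral_const_mul, integral_const_mul, ha φ hφ hc hs i]
    ring

/-- The function underlying an element of `W^{1,2}(Ω)`. -/
def W12fn {Ω : Set Plane} (u : W12 Ω) : Plane → ℝ := (u : L2Pair Ω).fst

/-- The weak gradient of an element of `W^{1,2}(Ω)`. -/
def W12grad {Ω : Set Plane} (u : W12 Ω) : Plane → Plane := (u : L2Pair Ω).snd

/-- The data ball `{w ∈ W^{1,2}(Ω) : ‖w‖_{L^t(K)} ≤ R}`. -/
def dataBall (Ω K : Set Plane) (t R : ℝ) : Set (W12 Ω) :=
  {w | eLpNorm (W12fn w) (ENNReal.ofReal t) (volume.restrict K) ≤ ENNReal.ofReal R}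

/-- Real symmetric positive definite `2 × 2` matrices. -/
abbrev SPD : Type := {A : Matrix (Fin 2) (Fin 2) ℝ // A.PosDef}

open Classical in
/-- The values of a tensor field on the closure of `Ω`, extended by `0` to the plane. -/
def tensorAt {Ω : Set Plane} (A : C(closure Ω, SPD)) (x : Plane) : Matrix (Fin 2) (Fin 2) ℝ :=
  if h : x ∈ closure Ω then (A ⟨x, h⟩).1 else 0

/-- `u` is a weak solution of `div (D(u) ∇u) = lam χ_K t |u - f|^(t-2) (u - f)` in `Ω` with the
natural boundary condition `D(u) ∇u ⬝ N = 0` on the boundary: both integrals in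
`∫_Ω D(u) ∇u ⬝ ∇φ + lam ∫_K t |u - f|^(t-2) (u - f) φ = 0` exist and the identity holds for all
`φ ∈ W^{1,2}(Ω)`, with no condition on the boundary values of `φ`. -/
def IsWeakNeumannSolution (Ω K : Set Plane) (t lam : ℝ) (f : Plane → ℝ)
    (D : W12 Ω → C(closure Ω, SPD)) (u : W12 Ω) : Prop :=
  ∀ φ : W12 Ω,
    IntegrableOn (fun x => (tensorAt (D u) x *ᵥ (W12grad u x).ofLp) ⬝ᵥ (W12grad φ x).ofLp) Ω ∧
    IntegrableOn (fun x => t * |W12fn u x - f x| ^ (t - 2) * (W12fn u x - f x) * W12fn φ x) K ∧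
    (∫ x in Ω, (tensorAt (D u) x *ᵥ (W12grad u x).ofLp) ⬝ᵥ (W12grad φ x).ofLp)
      + lam * ∫ x in K, t * |W12fn u x - f x| ^ (t - 2) * (W12fn u x - f x) * W12fn φ x = 0

end

/-! Freeze the tensor field. For a fixed `A` the equation is the Euler–Lagrange equation of the
energy `½ ∫ A ∇u ⬝ ∇u + lam ‖u - f‖^t`, the norm being that of `L^t(K)`. This energy has a unique
minimiser `S A`, and every fixed point of `S ∘ D` solves the problem (`eulerLagrange`). Comparison
with the competitor `0` gives `‖S A‖ ≤ 2 ‖f‖` in `L^t(K)`, with no ellipticity constant involved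
(`norm_le_of_energy_le_zero`). So `S ∘ D` maps a data ball, which is convex but need not be bounded
in `W^{1,2}`, into the image under `S` of the compact closure of `D(ball)`. Once `S` is continuous,
this image is compact and Schauder's theorem in the form `exists_fixedPoint_of_compact_range`
applies. Compactness thus comes from `D` alone, and each tensor field may keep its own ellipticity
constant.

Existence, uniqueness and continuity of `S` need only strong convergence
(`exists_wellPosed_minimizer`, `exists_continuous_minimizer`). The parallelogram identity makes the
gradients of a minimising sequence Cauchy; by Poincaré's inequality only additive constants remain
free, and these are bounded because `K` has positive measure. Hence almost minimisers are close to
the minimiser, and the minimiser for a nearby tensor field is an almost minimiser for `A`.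

Two tools are proved on the way. The Sobolev–Poincaré inequality with any finite exponent
(`IsBoundedLipschitzDomain.sobolevPoincare`) yields both Poincaré's inequality and the embedding in
`L^t(K)`: it is proved for smooth functions on star-shaped sets by integrating the gradient along
segments, carried over by mollification and Fatou's lemma, and glued over a finite cover by
connectedness. Schauder's theorem is reduced to Brouwer's on a simplex, and Brouwer's follows from
Scarf's combinatorial lemma, a parity argument. -/

namespace Scarf

/-! ### Scarf's lemma -/

variable {T I α : Type*} [LinearOrder α]

/-- Scarf's dominance: no element of `T` exceeds the minimum of `σ` in all the orders in `C`. -/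
def Dominant (r : I → T → α) (σ : Finset T) (C : Finset I) : Prop :=
  ∀ y, ∃ i ∈ C, ∀ x ∈ σ, r i y ≤ r i x

theorem Dominant.mono {r : I → T → α} {σ τ : Finset T} {C D : Finset I} (h : Dominant r σ C)
    (hτ : τ ⊆ σ) (hD : C ⊆ D) : Dominant r τ D := fun y => by
  obtain ⟨i, hi, h⟩ := h y
  exact ⟨i, hD hi, fun x hx => h x (hτ hx)⟩

variable [DecidableEq T] [DecidableEq I]

/-- The two ways in which a cell `(σ, C)` can have `(τ, D)` as a facet. -/
def Incident (d ρ : Finset T × Finset I) : Prop :=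
  (∃ x ∉ d.1, ρ = (insert x d.1, d.2)) ∨ ∃ i ∈ d.2, ρ = (d.1, d.2.erase i)

/-- The cells across a facet `(τ, D)` that arise by giving up the index `a ∈ D`. -/
def Across (r : I → T → α) (τ : Finset T) (D : Finset I) (a : I) (ρ : Finset T × Finset I) :
    Prop :=
  Dominant r ρ.1 ρ.2 ∧ (ρ = (τ, D.erase a) ∨
    ∃ x ∉ τ, ρ = (insert x τ, D) ∧ ∀ i ∈ D, i ≠ a → ∃ z ∈ τ, r i z < r i x)

/-- The pivot step. Once `a` is given up, either the remaining indices are still dominant, or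
exactly one vertex can be added to restore dominance. -/
theorem existsUnique_across [Fintype T] {r : I → T → α} (hr : ∀ i, Function.Injective (r i))
    {τ : Finset T} {D : Finset I} (hdom : Dominant r τ D) {a : I} (ha : a ∈ D)
    (hs : ∀ z ∈ τ, ∃ i ∈ D, i ≠ a ∧ ∀ x ∈ τ, r i z ≤ r i x) : ∃! ρ, Across r τ D a ρ := by
  classical
  -- The points that rise above the minimum of `τ` in every order of `D` but `a`. They obstruct the
  -- dominance of `D.erase a`; if there are any, the new vertex must be the `r a`-largest.
  set M : Finset T := Finset.univ.filter fun y => ∀ i ∈ D, i ≠ a → ∃ z ∈ τ, r i z < r i y with hM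
  have memM : ∀ y, y ∈ M ↔ ∀ i ∈ D, i ≠ a → ∃ z ∈ τ, r i z < r i y := by simp [hM]
  rcases M.eq_empty_or_nonempty with h0 | hne
  · have key : ∀ y, ∃ i ∈ D, i ≠ a ∧ ∀ z ∈ τ, r i y ≤ r i z := by
      intro y
      by_contra! hcon
      have : y ∈ M := (memM y).2 hcon
      simp [h0] at this
    refine ⟨(τ, D.erase a), ⟨fun y => ?_, Or.inl rfl⟩, ?_⟩
    · obtain ⟨i, hi, hia, h⟩ := key y
      exact ⟨i, Finset.mem_erase.2 ⟨hia, hi⟩, h⟩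
    · rintro ρ ⟨-, rfl | ⟨x, hx, rfl, h⟩⟩
      · rfl
      · have : x ∈ M := (memM x).2 h
        simp [h0] at this
  · obtain ⟨x, hxM, hmax⟩ := M.exists_max_image (r a) hne
    have hx := (memM x).1 hxM
    have low : ∀ y ∈ M, ∀ z ∈ τ, r a y ≤ r a z := by
      intro y hy z hz
      obtain ⟨i, hi, h⟩ := hdom y
      by_cases hia : i = a
      · exact hia ▸ h z hz
      · obtain ⟨w, hw, hlt⟩ := (memM y).1 hy i hi hia
        exact absurd (h w hw) (not_le.2 hlt)
    have hxτ : x ∉ τ := by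
      intro hxt
      obtain ⟨i, hi, hia, h⟩ := hs x hxt
      obtain ⟨w, hw, hlt⟩ := hx i hi hia
      exact absurd (h w hw) (not_le.2 hlt)
    refine ⟨(insert x τ, D), ⟨fun y => ?_, Or.inr ⟨x, hxτ, rfl, hx⟩⟩, ?_⟩
    · by_cases hy : y ∈ M
      · refine ⟨a, ha, fun z hz => ?_⟩
        rcases Finset.mem_insert.1 hz with rfl | hz
        · exact hmax y hy
        · exact low y hy z hz
      · rw [memM] at hy
        push Not at hy
        obtain ⟨i, hi, hia, h⟩ := hy
        refine ⟨i, hi, fun z hz => ?_⟩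
        rcases Finset.mem_insert.1 hz with rfl | hz
        · obtain ⟨w, hw, hlt⟩ := hx i hi hia
          exact (h w hw).trans hlt.le
        · exact h z hz
    · rintro ρ ⟨hd, rfl | ⟨x', hx', rfl, h⟩⟩
      · obtain ⟨i, hi, h⟩ := hd x
        obtain ⟨hia, hi⟩ := Finset.mem_erase.1 hi
        obtain ⟨w, hw, hlt⟩ := hx i hi hia
        exact absurd (h w hw) (not_le.2 hlt)
      · obtain ⟨i, hi, h'⟩ := hd x
        by_cases hia : i = a
        · subst hia
          have h1 := h' x' (Finset.mem_insert_self _ _)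
          have h2 := hmax x' ((memM x').2 h)
          rw [hr i (le_antisymm h1 h2)]
        · obtain ⟨w, hw, hlt⟩ := hx i hi hia
          exact absurd (h' w (Finset.mem_insert_of_mem hw)) (not_le.2 hlt)

/-- A facet that is not a single index lies in exactly two cells. -/
theorem exists_pair_of_facet [Fintype T] {r : I → T → α} (hr : ∀ i, Function.Injective (r i))
    {τ : Finset T} {D : Finset I} (hτ : τ.Nonempty) (hdom : Dominant r τ D)
    (hcard : D.card = τ.card + 1) :
    ∃ ρ₁ ρ₂ : Finset T × Finset I, ρ₁ ≠ ρ₂ ∧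
      ∀ ρ, (Dominant r ρ.1 ρ.2 ∧ Incident (τ, D) ρ) ↔ ρ = ρ₁ ∨ ρ = ρ₂ := by
  classical
  have hmin : ∀ i, ∃ m ∈ τ, ∀ x ∈ τ, r i m ≤ r i x := fun i => τ.exists_min_image (r i) hτ
  choose m hmτ hm using hmin
  have huniq : ∀ i, ∀ z ∈ τ, (∀ x ∈ τ, r i z ≤ r i x) → m i = z := fun i z hz h =>
    hr i (le_antisymm (hm i z hz) (h _ (hmτ i)))
  -- By dominance every point of `τ` is the minimum for some index of `D`. As `D` has one index more
  -- than `τ` has points, exactly one pair `j`, `k` shares its minimum. Only these two can be given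
  -- up, and each leads to one cell.
  obtain ⟨j, hj, k, hk, hjk, hmjk⟩ : ∃ j ∈ D, ∃ k ∈ D, j ≠ k ∧ m j = m k :=
    Finset.exists_ne_map_eq_of_card_lt_of_maps_to (by omega) (fun i _ => hmτ i)
  have hsurj : ∀ z ∈ τ, ∃ i ∈ D, m i = z := by
    intro z hz
    obtain ⟨i, hi, h⟩ := hdom z
    exact ⟨i, hi, huniq i z hz h⟩
  -- giving up an index other than `j` and `k` leaves too few minima
  have hback : ∀ a ∈ D, (∀ z ∈ τ, ∃ i ∈ D.erase a, m i = z) → a = j ∨ a = k := by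
    intro a ha h
    by_contra! hcon
    have hle : τ.card ≤ ((D.erase a).erase j).card := by
      refine Finset.card_le_card_of_surjOn m fun z hz => ?_
      obtain ⟨i, hi, rfl⟩ := h z hz
      by_cases hij : i = j
      · exact ⟨k, by simp [hk, hjk.symm, hcon.2.symm], by rw [hij, hmjk]⟩
      · exact ⟨i, by simpa [hij, and_comm] using hi, rfl⟩
    rw [Finset.card_erase_of_mem (by simp [hj, hcon.1.symm]), Finset.card_erase_of_mem ha] at hle
    have : 0 < τ.card := hτ.card_pos
    omega
  have hs : ∀ a, a = j ∨ a = k → ∀ z ∈ τ, ∃ i ∈ D, i ≠ a ∧ ∀ x ∈ τ, r i z ≤ r i x := by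
    intro a ha z hz
    obtain ⟨i, hi, rfl⟩ := hsurj z hz
    by_cases hia : i = a
    · rcases ha with rfl | rfl
      · exact ⟨k, hk, hjk.symm, by rw [hia, hmjk]; exact hm k⟩
      · exact ⟨j, hj, hjk, by rw [hia, ← hmjk]; exact hm j⟩
    · exact ⟨i, hi, hia, hm i⟩
  obtain ⟨ρ₁, h₁, u₁⟩ := existsUnique_across hr hdom hj (hs j (Or.inl rfl))
  obtain ⟨ρ₂, h₂, u₂⟩ := existsUnique_across hr hdom hk (hs k (Or.inr rfl))
  refine ⟨ρ₁, ρ₂, ?_, fun ρ => ⟨?_, ?_⟩⟩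
  · rintro rfl
    obtain ⟨-, rfl | ⟨x, hx, rfl, hlt⟩⟩ := h₁
    · obtain ⟨-, h | ⟨x', hx', h, -⟩⟩ := h₂
      · have := (Prod.mk.inj h).2
        have hkm : k ∈ D.erase j := Finset.mem_erase.2 ⟨hjk.symm, hk⟩
        rw [this] at hkm
        simp at hkm
      · have := (Prod.mk.inj h).1
        exact hx' (this ▸ Finset.mem_insert_self _ _)
    · obtain ⟨-, h | ⟨x', hx', h, hlt'⟩⟩ := h₂
      · have := (Prod.mk.inj h).1
        exact hx (this ▸ Finset.mem_insert_self _ _)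
      · have hxx : x = x' := by
          have := (Prod.mk.inj h).1
          have hmem : x ∈ insert x' τ := this ▸ Finset.mem_insert_self _ _
          exact (Finset.mem_insert.1 hmem).resolve_right hx
        subst hxx
        -- A common new vertex `x` would exceed the minimum of `τ` in all orders but `j` and in all
        -- but `k`, hence in all of them, against dominance.
        obtain ⟨i, hi, hle⟩ := hdom x
        by_cases hij : i = j
        · obtain ⟨w, hw, hl⟩ := hlt' i hi (hij ▸ hjk)
          exact absurd (hle w hw) (not_le.2 hl)
        · obtain ⟨w, hw, hl⟩ := hlt i hi hij
          exact absurd (hle w hw) (not_le.2 hl)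
  · rintro ⟨hd, ⟨x, hx, rfl⟩ | ⟨a, ha, rfl⟩⟩
    -- Dominance tested on the vertex `x` itself: `a` is an order in which `x` is the minimum of the
    -- new cell, so `a` is the index given up.
    · obtain ⟨a, ha, hax⟩ := hd x
      change a ∈ D at ha
      have hall : ∀ i ∈ D, i ≠ a → ∃ z ∈ τ, r i z < r i x := by
        by_contra! hcon
        obtain ⟨b, hb, hba, hbx⟩ := hcon
        have hle : τ.card ≤ ((D.erase a).erase b).card := by
          refine Finset.card_le_card_of_surjOn m fun z hz => ?_
          obtain ⟨i, hi, h⟩ := hd z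
          have hzx : z ≠ x := fun h => hx (h ▸ hz)
          have hxz : r i z < r i x := lt_of_le_of_ne (h x (Finset.mem_insert_self _ _))
            fun h => hzx (hr i h)
          refine ⟨i, ?_, huniq i z hz fun w hw => h w (Finset.mem_insert_of_mem hw)⟩
          simp only [Finset.coe_erase, mem_sdiff, Finset.mem_coe, mem_singleton_iff]
          refine ⟨⟨hi, ?_⟩, ?_⟩
          · rintro rfl
            exact absurd (hax z (Finset.mem_insert_of_mem hz)) (not_le.2 hxz)
          · rintro rfl
            exact absurd (hbx z hz) (not_le.2 hxz)
        rw [Finset.card_erase_of_mem (by simp [hb, hba]), Finset.card_erase_of_mem ha] at hle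
        have : 0 < τ.card := hτ.card_pos
        omega
      have haa : a = j ∨ a = k := by
        refine hback a ha fun z hz => ?_
        obtain ⟨i, hi, h⟩ := hd z
        refine ⟨i, Finset.mem_erase.2 ⟨?_, hi⟩, huniq i z hz fun w hw =>
          h w (Finset.mem_insert_of_mem hw)⟩
        rintro rfl
        have h1 := h x (Finset.mem_insert_self _ _)
        have h2 := hax z (Finset.mem_insert_of_mem hz)
        exact hx (hr i (le_antisymm h2 h1) ▸ hz)
      rcases haa with rfl | rfl
      · exact Or.inl (u₁ _ ⟨hd, Or.inr ⟨x, hx, rfl, hall⟩⟩)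
      · exact Or.inr (u₂ _ ⟨hd, Or.inr ⟨x, hx, rfl, hall⟩⟩)
    · have haa : a = j ∨ a = k := by
        refine hback a ha fun z hz => ?_
        obtain ⟨i, hi, h⟩ := hd z
        exact ⟨i, hi, huniq i z hz h⟩
      rcases haa with rfl | rfl
      · exact Or.inl (u₁ _ ⟨hd, Or.inl rfl⟩)
      · exact Or.inr (u₂ _ ⟨hd, Or.inl rfl⟩)
  · have aux : ∀ a ∈ D, ∀ ρ, Across r τ D a ρ → Dominant r ρ.1 ρ.2 ∧ Incident (τ, D) ρ := by
      rintro a ha ρ ⟨hd, rfl | ⟨x, hx, rfl, -⟩⟩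
      · exact ⟨hd, Or.inr ⟨a, ha, rfl⟩⟩
      · exact ⟨hd, Or.inl ⟨x, hx, rfl⟩⟩
    rintro (rfl | rfl)
    · exact aux j hj _ h₁
    · exact aux k hk _ h₂

/-- The facet `(∅, {i})` lies in exactly one cell. -/
theorem exists_unique_of_outer_facet [Fintype T] [Nonempty T] {r : I → T → α}
    (hr : ∀ i, Function.Injective (r i)) (i : I) :
    ∃ ρ₁ : Finset T × Finset I,
      ∀ ρ, (Dominant r ρ.1 ρ.2 ∧ Incident (∅, {i}) ρ) ↔ ρ = ρ₁ := by
  obtain ⟨ρ₁, h₁, u₁⟩ := existsUnique_across hr (τ := ∅) (D := {i}) (a := i)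
    (fun y => ⟨i, by simp, by simp⟩) (by simp) (by simp)
  refine ⟨ρ₁, fun ρ => ⟨?_, ?_⟩⟩
  · rintro ⟨hd, ⟨x, hx, rfl⟩ | ⟨a, ha, rfl⟩⟩
    · exact u₁ _ ⟨hd, Or.inr ⟨x, hx, rfl, fun k hk hne => absurd (Finset.mem_singleton.1 hk) hne⟩⟩
    · obtain rfl : a = i := by simpa using ha
      exact u₁ _ ⟨hd, Or.inl rfl⟩
  · rintro rfl
    obtain ⟨hd, rfl | ⟨x, hx, rfl, -⟩⟩ := h₁
    · exact ⟨hd, Or.inr ⟨i, by simp, rfl⟩⟩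
    · exact ⟨hd, Or.inl ⟨x, hx, rfl⟩⟩

/-- A facet whose vertices carry all its indices but `i₀`. -/
def IsDoor (r : I → T → α) (c : T → I) (i₀ : I) (d : Finset T × Finset I) : Prop :=
  Dominant r d.1 d.2 ∧ d.2.card = d.1.card + 1 ∧ i₀ ∈ d.2 ∧ d.1.image c = d.2.erase i₀

/-- A full cell. -/
def IsRoom (r : I → T → α) (ρ : Finset T × Finset I) : Prop :=
  Dominant r ρ.1 ρ.2 ∧ ρ.2.card = ρ.1.card

/-- The doors of a full cell seen from inside: a facet arises by dropping a vertex or by adding an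
index, and dominance passes to it. -/
theorem isDoor_incident_iff {r : I → T → α} {c : T → I} {i₀ : I} {σ : Finset T} {C : Finset I}
    (hρ : IsRoom r (σ, C)) (d : Finset T × Finset I) :
    (IsDoor r c i₀ d ∧ Incident d (σ, C)) ↔
      (∃ x ∈ σ, d = (σ.erase x, C) ∧ i₀ ∈ C ∧ (σ.erase x).image c = C.erase i₀) ∨
      (∃ i ∉ C, d = (σ, insert i C) ∧ i₀ ∈ insert i C ∧ σ.image c = (insert i C).erase i₀) := by
  obtain ⟨hdom, hcard⟩ := hρ
  simp only at hdom hcard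
  constructor
  · rintro ⟨⟨h1, h2, h3, h4⟩, ⟨x, hx, h⟩ | ⟨i, hi, h⟩⟩
    · obtain ⟨rfl, rfl⟩ := Prod.mk.inj h
      refine Or.inl ⟨x, by simp, ?_, h3, ?_⟩
      · rw [Finset.erase_insert hx]
      · rwa [Finset.erase_insert hx]
    · obtain ⟨rfl, rfl⟩ := Prod.mk.inj h
      refine Or.inr ⟨i, by simp, ?_, ?_, ?_⟩ <;> rw [Finset.insert_erase hi]
      · exact h3
      · exact h4
  · rintro (⟨x, hx, rfl, h1, h2⟩ | ⟨i, hi, rfl, h1, h2⟩)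
    · refine ⟨⟨hdom.mono (Finset.erase_subset _ _) subset_rfl, ?_, h1, h2⟩,
        Or.inl ⟨x, by simp, by simp [Finset.insert_erase hx]⟩⟩
      have := Finset.card_pos.2 ⟨x, hx⟩
      simp only [Finset.card_erase_of_mem hx]
      omega
    · refine ⟨⟨hdom.mono subset_rfl (Finset.subset_insert _ _), ?_, h1, h2⟩,
        Or.inr ⟨i, by simp, by simp [Finset.erase_insert hi]⟩⟩
      simp only [Finset.card_insert_of_notMem hi]
      omega

/-- The vertices other than `x₀` carry each colour of `C.erase i₀` once, and the colour of `x₀`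
points to the second door. If it lies in `C`, one other vertex has the same colour and can be
dropped instead; if not, it can be added to `C` as an index. It is not `i₀`, since the cell would
then be fully coloured. -/
theorem exists_pair_of_door {r : I → T → α} {c : T → I} {i₀ : I} {σ : Finset T} {C : Finset I}
    (hρ : IsRoom r (σ, C)) (hc : σ.image c ≠ C) {x₀ : T} (hx₀ : x₀ ∈ σ) (h0 : i₀ ∈ C)
    (hd : (σ.erase x₀).image c = C.erase i₀) :
    ∃ d₁ d₂, d₁ ≠ d₂ ∧ ∀ d, (IsDoor r c i₀ d ∧ Incident d (σ, C)) ↔ d = d₁ ∨ d = d₂ := by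
  have hcard := hρ.2
  simp only at hcard
  have hinj : Set.InjOn c (σ.erase x₀ : Finset T) := Finset.card_image_iff.1 (by
    rw [hd, Finset.card_erase_of_mem h0, Finset.card_erase_of_mem hx₀, hcard])
  have hσ : σ.image c = insert (c x₀) (C.erase i₀) := by
    rw [← hd, ← Finset.image_insert, Finset.insert_erase hx₀]
  have hne : c x₀ ≠ i₀ := by
    intro h
    rw [h, Finset.insert_erase h0] at hσ
    exact hc hσ
  by_cases hxC : c x₀ ∈ C
  · have himg : σ.image c = C.erase i₀ := by
      rw [hσ, Finset.insert_eq_of_mem (Finset.mem_erase.2 ⟨hne, hxC⟩)]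
    obtain ⟨x₁, hx₁, hcx⟩ := Finset.mem_image.1
      (hd.symm ▸ Finset.mem_erase.2 ⟨hne, hxC⟩ : c x₀ ∈ (σ.erase x₀).image c)
    obtain ⟨hx10, hx₁σ⟩ := Finset.mem_erase.1 hx₁
    refine ⟨(σ.erase x₀, C), (σ.erase x₁, C), ?_, fun d => ?_⟩
    · intro h
      rw [(Prod.mk.inj h).1] at hx₁
      simp at hx₁
    rw [isDoor_incident_iff hρ]
    constructor
    · rintro (⟨x, hx, rfl, -, h⟩ | ⟨i, hi, rfl, -, h⟩)
      · by_cases hxx : x = x₀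
        · exact Or.inl (by rw [hxx])
        · by_cases hxx1 : x = x₁
          · exact Or.inr (by rw [hxx1])
          · exfalso
            have : c x ∈ (σ.erase x).image c := by
              rw [h, ← hd]
              exact Finset.mem_image_of_mem _ (Finset.mem_erase.2 ⟨hxx, hx⟩)
            obtain ⟨y, hy, hyx⟩ := Finset.mem_image.1 this
            obtain ⟨hyx', hyσ⟩ := Finset.mem_erase.1 hy
            by_cases hy0 : y = x₀
            · subst hy0
              exact hxx1 (hinj (by simp [hxx, hx]) hx₁ (hyx.symm.trans hcx.symm))
            · exact hyx' (hinj (by simp [hy0, hyσ]) (by simp [hxx, hx]) hyx)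
      · exfalso
        have h1 : i ∈ (insert i C).erase i₀ :=
          Finset.mem_erase.2 ⟨fun h => hi (h ▸ h0), Finset.mem_insert_self _ _⟩
        rw [← h, himg] at h1
        exact hi (Finset.mem_of_mem_erase h1)
    · rintro (rfl | rfl)
      · exact Or.inl ⟨x₀, hx₀, rfl, h0, hd⟩
      · refine Or.inl ⟨x₁, hx₁σ, rfl, h0, ?_⟩
        rw [← himg]
        refine (Finset.image_subset_image (Finset.erase_subset _ _)).antisymm fun i hi => ?_
        obtain ⟨x, hx, rfl⟩ := Finset.mem_image.1 hi
        by_cases hxx : x = x₁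
        · exact Finset.mem_image.2 ⟨x₀, by simp [hx₀, Ne.symm hx10], by rw [hxx, hcx]⟩
        · exact Finset.mem_image_of_mem _ (by simp [hx, hxx])
  · have hins : insert (c x₀) (C.erase i₀) = (insert (c x₀) C).erase i₀ :=
      (Finset.erase_insert_of_ne hne).symm
    have hsub : (σ.erase x₀).image c ⊆ C := hd ▸ Finset.erase_subset _ _
    refine ⟨(σ.erase x₀, C), (σ, insert (c x₀) C), ?_, fun d => ?_⟩
    · intro h
      exact hxC ((Prod.mk.inj h).2 ▸ Finset.mem_insert_self _ _)
    rw [isDoor_incident_iff hρ]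
    constructor
    · rintro (⟨x, hx, rfl, -, h⟩ | ⟨i, hi, rfl, -, h⟩)
      · by_cases hxx : x = x₀
        · exact Or.inl (by rw [hxx])
        · exfalso
          have h1 : c x₀ ∈ (σ.erase x).image c :=
            Finset.mem_image_of_mem _ (by simp [hx₀, Ne.symm hxx])
          rw [h] at h1
          exact hxC (Finset.mem_of_mem_erase h1)
      · have h1 : c x₀ ∈ (insert i C).erase i₀ := by
          rw [← h]
          exact Finset.mem_image_of_mem _ hx₀
        have h2 := (Finset.mem_insert.1 (Finset.mem_of_mem_erase h1)).resolve_right hxC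
        exact Or.inr (by rw [h2])
    · rintro (rfl | rfl)
      · exact Or.inl ⟨x₀, hx₀, rfl, h0, hd⟩
      · exact Or.inr ⟨c x₀, hxC, rfl, by simp [h0], hσ.trans hins⟩

/-- A door with an added index `i` forces a door of the other kind: `i ≠ i₀` is the colour of a
single vertex, and that vertex can be dropped. So `exists_pair_of_door` covers every cell that has a
door. -/
theorem even_card_doors {r : I → T → α} {c : T → I} {i₀ : I} {σ : Finset T} {C : Finset I}
    (hρ : IsRoom r (σ, C)) (hc : σ.image c ≠ C) :
    (∀ d, ¬ (IsDoor r c i₀ d ∧ Incident d (σ, C))) ∨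
    ∃ d₁ d₂, d₁ ≠ d₂ ∧ ∀ d, (IsDoor r c i₀ d ∧ Incident d (σ, C)) ↔ d = d₁ ∨ d = d₂ := by
  by_contra! hcon
  obtain ⟨⟨d, hd⟩, hno⟩ := hcon
  have hmain : ¬ ∃ x ∈ σ, i₀ ∈ C ∧ (σ.erase x).image c = C.erase i₀ := by
    rintro ⟨x, hx, h0, h⟩
    obtain ⟨d₁, d₂, hne, hiff⟩ := exists_pair_of_door hρ hc hx h0 h
    obtain ⟨d', hd'⟩ := hno d₁ d₂ hne
    have := hiff d'
    tauto
  have hcard := hρ.2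
  simp only at hcard
  rcases (isDoor_incident_iff hρ d).1 hd with ⟨x, hx, -, h0, h⟩ | ⟨i, hi, -, h0, h⟩
  · exact hmain ⟨x, hx, h0, h⟩
  · have hii : i ≠ i₀ := by
      rintro rfl
      rw [Finset.erase_insert hi] at h
      exact hc h
    have h0C : i₀ ∈ C := (Finset.mem_insert.1 h0).resolve_left (Ne.symm hii)
    have hinj : Set.InjOn c σ := Finset.card_image_iff.1 (by
      rw [h, Finset.card_erase_of_mem h0, Finset.card_insert_of_notMem hi]
      omega)
    have himem : i ∈ σ.image c := by
      rw [h]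
      exact Finset.mem_erase.2 ⟨hii, Finset.mem_insert_self _ _⟩
    obtain ⟨x, hx, hcx⟩ := Finset.mem_image.1 himem
    refine hmain ⟨x, hx, h0C, ?_⟩
    ext k
    constructor
    · intro hk
      obtain ⟨y, hy, rfl⟩ := Finset.mem_image.1 hk
      obtain ⟨hyx, hyσ⟩ := Finset.mem_erase.1 hy
      have h1 : c y ∈ (insert i C).erase i₀ := h ▸ Finset.mem_image_of_mem _ hyσ
      obtain ⟨h2, h3⟩ := Finset.mem_erase.1 h1
      refine Finset.mem_erase.2 ⟨h2, (Finset.mem_insert.1 h3).resolve_left fun h4 => ?_⟩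
      exact hyx (hinj hyσ hx (h4.trans hcx.symm))
    · intro hk
      obtain ⟨h2, h3⟩ := Finset.mem_erase.1 hk
      have h1 : k ∈ σ.image c := by
        rw [h]
        exact Finset.mem_erase.2 ⟨h2, Finset.mem_insert_of_mem h3⟩
      obtain ⟨y, hy, rfl⟩ := Finset.mem_image.1 h1
      refine Finset.mem_image_of_mem _ (Finset.mem_erase.2 ⟨?_, hy⟩)
      rintro rfl
      exact hi (hcx ▸ h3)

/-- **Scarf's lemma**: every colouring of `T` by `I` has a dominant set that carries exactly the
colours with respect to which it is dominant. -/
theorem exists_colorful [Fintype T] [Nonempty T] [Fintype I] [Nonempty I] {r : I → T → α}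
    (hr : ∀ i, Function.Injective (r i)) (c : T → I) :
    ∃ σ : Finset T, ∃ C : Finset I, Dominant r σ C ∧ σ.image c = C ∧ σ.Nonempty := by
  classical
  by_contra! hcon
  obtain ⟨i₀⟩ := ‹Nonempty I›
  set doors := (Finset.univ : Finset (Finset T × Finset I)).filter (IsDoor r c i₀) with hdoors
  set rooms := (Finset.univ : Finset (Finset T × Finset I)).filter (IsRoom r) with hrooms
  have hcol : ∀ ρ ∈ rooms, ρ.1.image c ≠ ρ.2 := by
    rintro ⟨σ, C⟩ hρ h
    have hρ' : IsRoom r (σ, C) := by simpa [hrooms] using hρ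
    have := hcon σ C hρ'.1 h
    subst this
    obtain ⟨y⟩ := ‹Nonempty T›
    obtain ⟨i, hi, -⟩ := hρ'.1 y
    have hC : C.card = 0 := hρ'.2
    rw [Finset.card_eq_zero.1 hC] at hi
    simp at hi
  -- Double counting of incident pairs. Without a colourful cell every room has zero or two doors,
  -- an even total; every door lies in two rooms except `(∅, {i₀})`, which lies in one, an odd
  -- total.
  have hdc := Finset.sum_card_bipartiteAbove_eq_sum_card_bipartiteBelow (s := doors) (t := rooms)
    Incident
  have hright : Even (∑ ρ ∈ rooms, (Finset.bipartiteBelow Incident doors ρ).card) := by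
    refine Finset.even_sum _ fun ρ hρ => ?_
    have hρ' : IsRoom r (ρ.1, ρ.2) := by simpa [hrooms] using hρ
    rcases even_card_doors (i₀ := i₀) hρ' (hcol ρ hρ) with h | ⟨d₁, d₂, hne, h⟩
    · have : Finset.bipartiteBelow Incident doors ρ = ∅ := by
        ext d
        simpa [Finset.bipartiteBelow, hdoors] using h d
      simp [this]
    · have : Finset.bipartiteBelow Incident doors ρ = {d₁, d₂} := by
        ext d
        simpa [Finset.bipartiteBelow, hdoors] using h d
      rw [this, Finset.card_pair hne]
      exact even_two
  have hroom : ∀ d ρ, IsDoor r c i₀ d → Dominant r ρ.1 ρ.2 → Incident d ρ → IsRoom r ρ := by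
    rintro ⟨τ, D⟩ ρ hd hdom (⟨x, hx, rfl⟩ | ⟨i, hi, rfl⟩)
    · refine ⟨hdom, ?_⟩
      have := hd.2.1
      simp only at this hx ⊢
      rw [Finset.card_insert_of_notMem hx, this]
    · refine ⟨hdom, ?_⟩
      have := hd.2.1
      simp only at this hi ⊢
      rw [Finset.card_erase_of_mem hi, this]
      omega
  have hmem : ∀ d, IsDoor r c i₀ d → ∀ ρ, ρ ∈ Finset.bipartiteAbove Incident rooms d ↔
      (Dominant r ρ.1 ρ.2 ∧ Incident d ρ) := by
    intro d hd ρ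
    simp only [Finset.bipartiteAbove, hrooms, Finset.mem_filter, Finset.mem_univ, true_and]
    exact ⟨fun h => ⟨h.1.1, h.2⟩, fun h => ⟨hroom d ρ hd h.1 h.2, h.2⟩⟩
  have houter : ((∅, {i₀}) : Finset T × Finset I) ∈ doors := by
    simp only [hdoors, Finset.mem_filter, Finset.mem_univ, true_and]
    exact ⟨fun y => ⟨i₀, by simp, by simp⟩, by simp, by simp, by simp⟩
  have hleft : Odd (∑ d ∈ doors, (Finset.bipartiteAbove Incident rooms d).card) := by
    rw [← Finset.add_sum_erase _ _ houter]
    refine Odd.add_even ?_ (Finset.even_sum _ fun d hd => ?_)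
    · obtain ⟨ρ₁, h⟩ := exists_unique_of_outer_facet hr i₀
      have : Finset.bipartiteAbove Incident rooms (∅, {i₀}) = {ρ₁} := by
        ext ρ
        rw [hmem _ (by simpa [hdoors] using houter), h, Finset.mem_singleton]
      simp [this]
    · obtain ⟨hne, hd⟩ := Finset.mem_erase.1 hd
      have hd' : IsDoor r c i₀ (d.1, d.2) := by simpa [hdoors] using hd
      have hτ : d.1.Nonempty := by
        by_contra h0
        rw [Finset.not_nonempty_iff_eq_empty] at h0
        have h1 := hd'.2.1
        simp only [h0, Finset.card_empty, zero_add] at h1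
        obtain ⟨i, hi⟩ := Finset.card_eq_one.1 h1
        have h2 := hd'.2.2.1
        simp only [hi, Finset.mem_singleton] at h2
        exact hne (Prod.ext h0 (by rw [hi, h2]))
      obtain ⟨ρ₁, ρ₂, hne, h⟩ := exists_pair_of_facet hr hτ hd'.1 hd'.2.1
      have : Finset.bipartiteAbove Incident rooms d = {ρ₁, ρ₂} := by
        ext ρ
        rw [hmem d hd', Finset.mem_insert, Finset.mem_singleton]
        exact h ρ
      rw [this, Finset.card_pair hne]
      exact even_two
  rw [hdc] at hleft
  exact (Nat.not_even_iff_odd.2 hleft) hright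

end Scarf

/-! ### The fixed point theorems of Brouwer and Schauder -/

open Filter Topology in
/-- Approximate form of Brouwer's theorem on the standard simplex. -/
theorem exists_approx_fixedPoint_stdSimplex {I : Type*} [Fintype I] [Nonempty I]
    {f : (I → ℝ) → I → ℝ} (hf : MapsTo f (stdSimplex ℝ I) (stdSimplex ℝ I)) (n : ℕ) :
    ∃ w ∈ stdSimplex ℝ I, ∀ i, ∃ z ∈ stdSimplex ℝ I,
      dist z w ≤ Fintype.card I / (n + 1 : ℝ) ∧
      z i ≤ f z i + Fintype.card I / (n + 1 : ℝ) := by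
  classical
  set N : ℕ := n + 1 with hN
  have hN0 : (0 : ℝ) < n + 1 := by positivity
  let T := {x : I → ℕ // x ∈ Finset.piAntidiag (Finset.univ : Finset I) N}
  have hT : ∀ x : T, ∑ i, x.1 i = N := fun x => (Finset.mem_piAntidiag.1 x.2).1
  have mkT : ∀ y : I → ℕ, ∑ i, y i = N → y ∈ Finset.piAntidiag (Finset.univ : Finset I) N :=
    fun y hy => Finset.mem_piAntidiag.2 ⟨hy, by simp⟩
  obtain ⟨j⟩ := ‹Nonempty I›
  have : Nonempty I := ⟨j⟩
  have : Nonempty T := ⟨⟨Pi.single j N, mkT _ (by simp)⟩⟩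
  let e := Fintype.equivFin T
  -- The coordinate orders on the grid; the enumeration `e` breaks ties, as Scarf's lemma needs
  -- injective orders.
  let r : I → T → ℕ ×ₗ Fin (Fintype.card T) := fun i x => toLex (x.1 i, e x)
  have hr : ∀ i, Function.Injective (r i) := by
    intro i x y h
    have := congrArg (fun p => (ofLex p).2) h
    exact e.injective this
  have hrle : ∀ i x y, r i x ≤ r i y → x.1 i ≤ y.1 i := by
    intro i x y h
    rcases Prod.Lex.toLex_le_toLex.1 h with h | h
    · exact h.le
    · exact h.1.le
  let p : T → I → ℝ := fun x i => x.1 i / (n + 1 : ℝ)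
  have hp : ∀ x, p x ∈ stdSimplex ℝ I := by
    intro x
    refine ⟨fun i => by positivity, ?_⟩
    have := hT x
    simp only [p, ← Finset.sum_div]
    rw [← Nat.cast_sum, this, hN]
    push_cast
    exact div_self hN0.ne'
  have hcol : ∀ x, ∃ i, p x i ≤ f (p x) i := by
    intro x
    by_contra! hcon
    have h1 := Finset.sum_lt_sum_of_nonempty (s := Finset.univ) ⟨j, Finset.mem_univ j⟩
      (fun i _ => hcon i)
    rw [(hp x).2, (hf (hp x)).2] at h1
    exact lt_irrefl _ h1
  choose c hc using hcol
  obtain ⟨σ, C, hdom, himg, hσ⟩ := Scarf.exists_colorful hr c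
  have hmin : ∀ i, ∃ m ∈ σ, ∀ x ∈ σ, m.1 i ≤ x.1 i := fun i =>
    σ.exists_min_image (fun x => x.1 i) hσ
  choose m hmσ hm using hmin
  have hC : C.Nonempty := himg ▸ hσ.image c
  -- Otherwise some grid point exceeds all minima over `C`, any surplus being placed on `i₁`,
  -- against dominance. Since coordinates add up to `N`, the minima leave little room: the
  -- coordinates in `C` stay within `card I` of their minima and those outside `C` are at most `card
  -- I`. The cell is therefore small.
  have hbig : N < ∑ i ∈ C, ((m i).1 i + 1) := by
    by_contra! hcon
    obtain ⟨i₁, hi₁⟩ := hC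
    let y : I → ℕ := fun i => (if i ∈ C then (m i).1 i + 1 else 0) +
      if i = i₁ then N - ∑ i ∈ C, ((m i).1 i + 1) else 0
    have hy : ∑ i, y i = N := by
      simp only [y, Finset.sum_add_distrib, Finset.sum_ite_mem, Finset.univ_inter,
        Finset.sum_ite_eq', Finset.mem_univ, if_true]
      rw [← Finset.sum_add_distrib]
      omega
    obtain ⟨i, hi, h⟩ := hdom ⟨y, mkT y hy⟩
    have h1 := hrle _ _ _ (h (m i) (hmσ i))
    simp only [y, if_pos hi] at h1
    omega
  rw [Finset.sum_add_distrib, Finset.sum_const, smul_eq_mul, mul_one] at hbig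
  have hCI : C.card ≤ Fintype.card I := Finset.card_le_univ C
  have hin : ∀ x ∈ σ, ∀ i ∈ C, x.1 i ≤ (m i).1 i + Fintype.card I := by
    intro x hx i hi
    have h1 : ∑ k ∈ C, x.1 k ≤ N := (Finset.sum_le_univ_sum_of_nonneg (by simp)).trans (hT x).le
    rw [← Finset.add_sum_erase _ _ hi] at h1 hbig
    have h2 : ∑ k ∈ C.erase i, (m k).1 k ≤ ∑ k ∈ C.erase i, x.1 k :=
      Finset.sum_le_sum fun k _ => hm k x hx
    omega
  have hout : ∀ x ∈ σ, ∀ i ∉ C, x.1 i ≤ Fintype.card I := by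
    intro x hx i hi
    have h1 : ∑ k ∈ insert i C, x.1 k ≤ N :=
      (Finset.sum_le_univ_sum_of_nonneg (by simp)).trans (hT x).le
    rw [Finset.sum_insert hi] at h1
    have h2 : ∑ k ∈ C, (m k).1 k ≤ ∑ k ∈ C, x.1 k := Finset.sum_le_sum fun k _ => hm k x hx
    omega
  have hdist : ∀ x ∈ σ, ∀ y ∈ σ, dist (p x) (p y) ≤ Fintype.card I / (n + 1 : ℝ) := by
    intro x hx y hy
    refine (dist_pi_le_iff (by positivity)).2 fun i => ?_
    simp only [p, Real.dist_eq, ← sub_div]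
    rw [abs_div, abs_of_pos hN0]
    gcongr
    have key : x.1 i ≤ y.1 i + Fintype.card I ∧ y.1 i ≤ x.1 i + Fintype.card I := by
      by_cases hi : i ∈ C
      · have := hin x hx i hi
        have := hin y hy i hi
        have := hm i x hx
        have := hm i y hy
        omega
      · have := hout x hx i hi
        have := hout y hy i hi
        omega
    rw [abs_le]
    constructor
    · have : (y.1 i : ℝ) ≤ x.1 i + Fintype.card I := by exact_mod_cast key.2
      linarith
    · have : (x.1 i : ℝ) ≤ y.1 i + Fintype.card I := by exact_mod_cast key.1
      linarith
  obtain ⟨x₀, hx₀⟩ := hσ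
  refine ⟨p x₀, hp x₀, fun i => ?_⟩
  by_cases hi : i ∈ C
  · obtain ⟨x, hx, rfl⟩ := Finset.mem_image.1 (himg.symm ▸ hi : i ∈ σ.image c)
    refine ⟨p x, hp x, hdist x hx x₀ hx₀, (hc x).trans ?_⟩
    have : (0 : ℝ) ≤ Fintype.card I / (n + 1 : ℝ) := by positivity
    linarith
  -- For an index outside `C` no vertex of that colour is available, but the coordinate itself is
  -- small and `f` is nonnegative.
  · refine ⟨p x₀, hp x₀, by rw [dist_self]; positivity, ?_⟩
    have h1 : p x₀ i ≤ Fintype.card I / (n + 1 : ℝ) := by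
      simp only [p]
      gcongr
      exact hout x₀ hx₀ i hi
    have h2 := (hf (hp x₀)).1 i
    linarith

open Filter Topology in
/-- **Brouwer's fixed point theorem** on the standard simplex. -/
theorem exists_fixedPoint_stdSimplex {I : Type*} [Fintype I] [Nonempty I]
    {f : (I → ℝ) → I → ℝ} (hf : MapsTo f (stdSimplex ℝ I) (stdSimplex ℝ I))
    (hcont : ContinuousOn f (stdSimplex ℝ I)) : ∃ x ∈ stdSimplex ℝ I, f x = x := by
  choose w hw z hz hzw hzf using exists_approx_fixedPoint_stdSimplex hf
  obtain ⟨x, hx, φ, hφ, hlim⟩ := (isCompact_stdSimplex ℝ I).tendsto_subseq hw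
  have hsmall : Tendsto (fun n : ℕ => (Fintype.card I : ℝ) / (φ n + 1 : ℝ)) atTop (𝓝 0) := by
    have := (tendsto_const_div_atTop_nhds_zero_nat (Fintype.card I : ℝ)).comp
      ((tendsto_add_atTop_nat 1).comp hφ.tendsto_atTop)
    simpa [Function.comp_def] using this
  have hle : ∀ i, x i ≤ f x i := by
    intro i
    have hzlim : Tendsto (fun n => z (φ n) i) atTop (𝓝 x) := by
      rw [tendsto_iff_dist_tendsto_zero] at hlim ⊢
      refine squeeze_zero (fun _ => dist_nonneg)
        (fun n => (dist_triangle _ (w (φ n)) _).trans (add_le_add (hzw (φ n) i) le_rfl)) ?_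
      simpa using hsmall.add hlim
    have hflim : Tendsto (fun n => f (z (φ n) i)) atTop (𝓝 (f x)) :=
      (hcont x hx).tendsto.comp (tendsto_nhdsWithin_iff.2
        ⟨hzlim, Eventually.of_forall fun n => hz (φ n) i⟩)
    have h1 := tendsto_pi_nhds.1 hzlim i
    have h2 := (tendsto_pi_nhds.1 hflim i).add hsmall
    simpa using le_of_tendsto_of_tendsto' h1 h2 fun n => hzf (φ n) i
  refine ⟨x, hx, ?_⟩
  -- Both points have coordinate sum `1`, so the coordinatewise inequality must be an equality.
  have hsum : ∑ i, (f x i - x i) = 0 := by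
    rw [Finset.sum_sub_distrib, (hf hx).2, hx.2, sub_self]
  funext i
  have := (Finset.sum_eq_zero_iff_of_nonneg fun i _ => sub_nonneg.2 (hle i)).1 hsum i
    (Finset.mem_univ i)
  linarith

/-- A continuous self-map of a convex set with values in a compact subset moves some point as
little as desired. -/
theorem exists_dist_le_of_compact_range {H : Type*} [NormedAddCommGroup H] [NormedSpace ℝ H]
    {B S : Set H} (hB : Convex ℝ B) (hS : IsCompact S) (hSB : S ⊆ B) (hne : B.Nonempty)
    {T : H → H} (hT : ContinuousOn T B) (hTS : MapsTo T B S) {ε : ℝ} (hε : 0 < ε) :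
    ∃ x ∈ B, dist x (T x) ≤ ε := by
  obtain ⟨b, hb⟩ := hne
  obtain ⟨s, hsS, hsfin, hcov⟩ := hS.finite_cover_balls hε
  have : Fintype s := hsfin.fintype
  have hcov' : ∀ y ∈ S, ∃ i : s, dist y i < ε := by
    intro y hy
    obtain ⟨i, hi, h⟩ := mem_iUnion₂.1 (hcov hy)
    exact ⟨⟨i, hi⟩, h⟩
  have : Nonempty s := ⟨(hcov' _ (hTS hb)).choose⟩
  -- Schauder projection: `m i` vanishes outside the `ε`-ball about the net point `i`, so the
  -- normalised weighted mean of the net is within `ε` of `y`. Below, `f` is the projected map in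
  -- barycentric coordinates, to which Brouwer's theorem applies.
  let m : s → H → ℝ := fun i y => max 0 (ε - dist y i)
  have hm0 : ∀ i y, 0 ≤ m i y := fun i y => le_max_left _ _
  have hmc : ∀ i, Continuous (m i) := fun i => by fun_prop
  have hmpos : ∀ y ∈ S, 0 < ∑ i, m i y := by
    intro y hy
    obtain ⟨i, hi⟩ := hcov' y hy
    exact Finset.sum_pos' (fun i _ => hm0 i y) ⟨i, Finset.mem_univ i,
      lt_max_of_lt_right (sub_pos.2 hi)⟩
  let q : (s → ℝ) → H := fun l => ∑ i, l i • (i : H)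
  have hqc : Continuous q := by fun_prop
  have hqB : MapsTo q (stdSimplex ℝ s) B := fun l hl =>
    hB.sum_mem (fun i _ => hl.1 i) hl.2 fun i _ => hSB (hsS i.2)
  let f : (s → ℝ) → s → ℝ := fun l i => m i (T (q l)) / ∑ k, m k (T (q l))
  have hfm : MapsTo f (stdSimplex ℝ s) (stdSimplex ℝ s) := by
    intro l hl
    have hpos := hmpos _ (hTS (hqB hl))
    refine ⟨fun i => div_nonneg (hm0 _ _) hpos.le, ?_⟩
    simp only [f, ← Finset.sum_div]
    exact div_self hpos.ne'
  have hTq : ContinuousOn (fun l => T (q l)) (stdSimplex ℝ s) :=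
    hT.comp hqc.continuousOn hqB
  have hfc : ContinuousOn f (stdSimplex ℝ s) := by
    refine continuousOn_pi.2 fun i => ContinuousOn.div ((hmc i).comp_continuousOn hTq) ?_
      fun l hl => (hmpos _ (hTS (hqB hl))).ne'
    exact continuousOn_finsetSum _ fun k _ => (hmc k).comp_continuousOn hTq
  obtain ⟨l, hl, hfix⟩ := exists_fixedPoint_stdSimplex hfm hfc
  refine ⟨q l, hqB hl, ?_⟩
  have hdiff : q l - T (q l) = ∑ i, l i • ((i : H) - T (q l)) := by
    simp only [smul_sub, Finset.sum_sub_distrib, ← Finset.sum_smul, hl.2, one_smul, q]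
  rw [dist_eq_norm, hdiff]
  calc ‖∑ i, l i • ((i : H) - T (q l))‖ ≤ ∑ i, l i * ε := by
        refine norm_sum_le_of_le _ fun i _ => ?_
        rw [norm_smul, Real.norm_of_nonneg (hl.1 i)]
        by_cases h0 : l i = 0
        · simp [h0]
        · refine mul_le_mul_of_nonneg_left ?_ (hl.1 i)
          by_contra! hcon
          apply h0
          have h1 : m i (T (q l)) = 0 := by
            refine max_eq_left ?_
            rw [dist_comm, dist_eq_norm]
            linarith
          rw [← hfix]
          simp [f, h1]
    _ = ε := by rw [← Finset.sum_mul, hl.2, one_mul]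

open Filter Topology in
/-- **Schauder's fixed point theorem**, for a map with values in a compact set. -/
theorem exists_fixedPoint_of_compact_range {H : Type*} [NormedAddCommGroup H] [NormedSpace ℝ H]
    {B S : Set H} (hB : Convex ℝ B) (hS : IsCompact S) (hSB : S ⊆ B) (hne : B.Nonempty)
    {T : H → H} (hT : ContinuousOn T B) (hTS : MapsTo T B S) : ∃ x ∈ B, T x = x := by
  have hpos : ∀ n : ℕ, (0 : ℝ) < 1 / (n + 1 : ℝ) := fun n => by positivity
  choose x hxB hx using fun n => exists_dist_le_of_compact_range hB hS hSB hne hT hTS (hpos n)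
  obtain ⟨y, hy, φ, hφ, hlim⟩ := hS.tendsto_subseq fun n => hTS (hxB n)
  have hxlim : Tendsto (fun n => x (φ n)) atTop (𝓝 y) := by
    rw [tendsto_iff_dist_tendsto_zero] at hlim ⊢
    refine squeeze_zero (fun _ => dist_nonneg)
      (fun n => (dist_triangle _ (T (x (φ n))) _).trans (add_le_add (hx (φ n)) le_rfl)) ?_
    simpa using (tendsto_one_div_add_atTop_nhds_zero_nat.comp hφ.tendsto_atTop).add hlim
  refine ⟨y, hSB hy, tendsto_nhds_unique ?_ hlim⟩
  exact (hT y (hSB hy)).tendsto.comp (tendsto_nhdsWithin_iff.2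
    ⟨hxlim, Eventually.of_forall fun n => hxB (φ n)⟩)

/-! ### Sobolev–Poincaré inequality for smooth functions on star-shaped sets -/

theorem lintegral_comp_affine {h : Plane → ℝ≥0∞} (hh : Measurable h) (a : Plane) {s : ℝ}
    (hs : s ≠ 0) :
    ∫⁻ z, h (a + s • z) = ENNReal.ofReal ((s ^ 2)⁻¹) * ∫⁻ z, h z := by
  have h1 : ∫⁻ z : Plane, h (a + s • z)
      = ∫⁻ y, h (a + y) ∂(Measure.map (s • ·) (volume : Measure Plane)) := by
    rw [lintegral_map (by fun_prop) (measurable_const_smul s)]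
  rw [h1, Measure.map_addHaar_smul _ hs, lintegral_smul_measure, lintegral_add_left_eq_self]
  have : Module.finrank ℝ Plane = 2 := by simp
  rw [this, abs_of_nonneg (by positivity), smul_eq_mul]

/-- The integral of `h` over the segments from `x` to the points of `B`, at parameter `s`. -/
noncomputable def segmentMean (h : Plane → ℝ≥0∞) (B : Set Plane) (s : ℝ) (x : Plane) : ℝ≥0∞ :=
  ∫⁻ z in B, h ((1 - s) • x + s • z)

theorem measurable_segmentMean {h : Plane → ℝ≥0∞} (hh : Measurable h) (B : Set Plane) :
    Measurable (fun q : ℝ × Plane => segmentMean h B q.1 q.2) := by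
  unfold segmentMean
  apply Measurable.lintegral_prod_right' (f := fun r : (ℝ × Plane) × Plane =>
    h ((1 - r.1.1) • r.1.2 + r.1.1 • r.2))
  fun_prop

theorem segmentMean_le {h : Plane → ℝ≥0∞} (hh : Measurable h) (B : Set Plane) {s : ℝ} (hs : 0 < s)
    (x : Plane) : segmentMean h B s x ≤ ENNReal.ofReal ((s ^ 2)⁻¹) * ∫⁻ z, h z :=
  (setLIntegral_le_lintegral _ _).trans (lintegral_comp_affine hh _ hs.ne').le

/-- The bound is uniform in `s` because one may choose the variable to substitute: `z` for `s ≥ 1 /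
2`, with Jacobian `s ^ 2`, and `x` for `s ≤ 1 / 2`, with Jacobian `(1 - s) ^ 2`. Either inverse is
at most `4`. -/
theorem lintegral_segmentMean_le {h : Plane → ℝ≥0∞} (hh : Measurable h) {S B : Set Plane}
    {s : ℝ} (hs : s ∈ Ioc (0 : ℝ) 1) :
    ∫⁻ x in S, segmentMean h B s x ≤ 4 * (volume S + volume B) * ∫⁻ z, h z := by
  have four : ∀ r : ℝ, 1 / 2 ≤ r → ENNReal.ofReal ((r ^ 2)⁻¹) ≤ 4 := by
    intro r hr
    rw [show (4 : ℝ≥0∞) = ENNReal.ofReal 4 by norm_num]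
    refine ENNReal.ofReal_le_ofReal ?_
    rw [inv_le_comm₀ (by positivity) (by norm_num)]
    nlinarith
  rcases le_total s (1 / 2) with h2 | h2
  · have hB : ∀ z, ∫⁻ x, h ((1 - s) • x + s • z) ≤ 4 * ∫⁻ z, h z := by
      intro z
      have := lintegral_comp_affine hh (s • z) (s := 1 - s) (by linarith)
      simp only [add_comm (s • z)] at this
      rw [this]
      gcongr
      exact four _ (by linarith)
    calc ∫⁻ x in S, segmentMean h B s x
        ≤ ∫⁻ x, segmentMean h B s x := setLIntegral_le_lintegral _ _
      _ = ∫⁻ z in B, ∫⁻ x, h ((1 - s) • x + s • z) := by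
          unfold segmentMean
          rw [lintegral_lintegral_swap]
          exact (by fun_prop : Measurable _).aemeasurable
      _ ≤ ∫⁻ z in B, 4 * ∫⁻ z, h z := lintegral_mono fun z => hB z
      _ = 4 * volume B * ∫⁻ z, h z := by rw [setLIntegral_const]; ring
      _ ≤ _ := by gcongr; exact le_add_self
  · calc ∫⁻ x in S, segmentMean h B s x
        ≤ ∫⁻ x in S, 4 * ∫⁻ z, h z := by
          refine lintegral_mono fun x => (segmentMean_le hh B hs.1 x).trans ?_
          gcongr
          exact four s h2
      _ = 4 * volume S * ∫⁻ z, h z := by rw [setLIntegral_const]; ring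
      _ ≤ _ := by gcongr; exact le_self_add

/-- The constant in the weighted Hölder inequality below. -/
noncomputable def rayConstant (p : ℝ) : ℝ≥0∞ :=
  (∫⁻ s in Ioc (0 : ℝ) 1, ENNReal.ofReal s ^ (-((p - 2) / (p - 1)))) ^ (p - 1)

/-- The exponent `(p - 2) / (p - 1)` is below `1`, so the weight is integrable at `0`. -/
theorem rayConstant_ne_top {p : ℝ} (hp : 2 ≤ p) : rayConstant p ≠ ⊤ := by
  refine ENNReal.rpow_ne_top_of_nonneg (by linarith) ?_
  have hint : IntegrableOn (fun s : ℝ => s ^ (-((p - 2) / (p - 1)))) (Ioc 0 1) := by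
    have := intervalIntegral.intervalIntegrable_rpow' (a := 0) (b := 1)
      (r := -((p - 2) / (p - 1))) (by
        rw [neg_lt_neg_iff, div_lt_one (by linarith)]
        linarith)
    exact (intervalIntegrable_iff_integrableOn_Ioc_of_le zero_le_one).1 this
  have h2 := hint.lintegral_lt_top
  refine ne_of_lt (lt_of_eq_of_lt ?_ h2)
  refine setLIntegral_congr_fun measurableSet_Ioc fun s hs => ?_
  exact ENNReal.ofReal_rpow_of_pos hs.1

/-- Hölder's inequality with the weight `s ^ a`, `a = (p - 2) / p`. Of the resulting power `p / 2`
of the segment mean, all but one factor is estimated by `segmentMean_le`; this costs `s ^ (-(p -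
2))`, which the weight `s ^ (a * p)` cancels exactly. -/
theorem rpow_lintegral_sqrt_segmentMean_le {p : ℝ} (hp : 2 ≤ p) {h : Plane → ℝ≥0∞}
    (hh : Measurable h) (B : Set Plane) (x : Plane) :
    (∫⁻ s in Ioc (0 : ℝ) 1, segmentMean h B s x ^ (1 / 2 : ℝ)) ^ p ≤
      rayConstant p * (∫⁻ z, h z) ^ (p / 2 - 1) * ∫⁻ s in Ioc (0 : ℝ) 1, segmentMean h B s x := by
  set I := ∫⁻ z, h z
  set H := fun s => segmentMean h B s x with hH
  have hHm : Measurable H := (measurable_segmentMean hh B).comp (by fun_prop : Measurable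
    (fun s : ℝ => (s, x)))
  have hpq : p.HolderConjugate (p / (p - 1)) := Real.HolderConjugate.conjExponent (by linarith)
  set a := (p - 2) / p with ha
  have hp0 : 0 < p := by linarith
  have hp1 : 0 < p - 1 := by linarith
  have split : ∫⁻ s in Ioc (0 : ℝ) 1, H s ^ (1 / 2 : ℝ) =
      ∫⁻ s in Ioc (0 : ℝ) 1, ((fun s => ENNReal.ofReal s ^ a * H s ^ (1 / 2 : ℝ)) *
        fun s => ENNReal.ofReal s ^ (-a)) s := by
    refine setLIntegral_congr_fun measurableSet_Ioc fun s hs => ?_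
    have h0 : ENNReal.ofReal s ≠ 0 := by simpa using hs.1
    simp only [Pi.mul_apply]
    rw [mul_right_comm, ← ENNReal.rpow_add _ _ h0 ENNReal.ofReal_ne_top]
    simp
  have holder := ENNReal.lintegral_mul_le_Lp_mul_Lq (volume.restrict (Ioc (0 : ℝ) 1)) hpq
    (f := fun s => ENNReal.ofReal s ^ a * H s ^ (1 / 2 : ℝ)) (g := fun s => ENNReal.ofReal s ^ (-a))
    (by fun_prop) (by fun_prop)
  rw [← split] at holder
  have e1 : ∫⁻ s in Ioc (0 : ℝ) 1, (ENNReal.ofReal s ^ (-a)) ^ (p / (p - 1)) =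
      ∫⁻ s in Ioc (0 : ℝ) 1, ENNReal.ofReal s ^ (-((p - 2) / (p - 1))) := by
    congr 1
    ext s
    rw [← ENNReal.rpow_mul]
    congr 1
    rw [ha]
    field_simp
  have e2 : ∫⁻ s in Ioc (0 : ℝ) 1, (ENNReal.ofReal s ^ a * H s ^ (1 / 2 : ℝ)) ^ p ≤
      I ^ (p / 2 - 1) * ∫⁻ s in Ioc (0 : ℝ) 1, H s := by
    rw [← lintegral_const_mul _ hHm]
    refine setLIntegral_mono (by fun_prop) fun s hs => ?_
    have h0 : ENNReal.ofReal s ≠ 0 := by simpa using hs.1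
    rw [ENNReal.mul_rpow_of_nonneg _ _ hp0.le, ← ENNReal.rpow_mul, ← ENNReal.rpow_mul,
      show a * p = p - 2 by rw [ha]; field_simp, show 1 / 2 * p = (p / 2 - 1) + 1 by ring,
      ENNReal.rpow_add_of_nonneg _ _ (by linarith) zero_le_one, ENNReal.rpow_one, ← mul_assoc]
    gcongr
    calc ENNReal.ofReal s ^ (p - 2) * H s ^ (p / 2 - 1)
        ≤ ENNReal.ofReal s ^ (p - 2) * (ENNReal.ofReal ((s ^ 2)⁻¹) * I) ^ (p / 2 - 1) := by
          gcongr
          · linarith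
          · exact segmentMean_le hh B hs.1 x
      _ = I ^ (p / 2 - 1) := by
          rw [ENNReal.mul_rpow_of_nonneg _ _ (by linarith), ← mul_assoc]
          have : ENNReal.ofReal ((s ^ 2)⁻¹) ^ (p / 2 - 1) = ENNReal.ofReal s ^ (-(p - 2)) := by
            rw [ENNReal.ofReal_inv_of_pos (by have := hs.1; positivity),
              ENNReal.ofReal_pow hs.1.le, ← ENNReal.rpow_natCast, ← ENNReal.rpow_neg,
              ← ENNReal.rpow_mul]
            congr 1
            push_cast
            ring
          rw [this, ← ENNReal.rpow_add _ _ h0 ENNReal.ofReal_ne_top]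
          simp
  calc (∫⁻ s in Ioc (0 : ℝ) 1, H s ^ (1 / 2 : ℝ)) ^ p
      ≤ ((I ^ (p / 2 - 1) * ∫⁻ s in Ioc (0 : ℝ) 1, H s) ^ (1 / p) *
        (∫⁻ s in Ioc (0 : ℝ) 1, ENNReal.ofReal s ^ (-((p - 2) / (p - 1)))) ^
          (1 / (p / (p - 1)))) ^ p := by
        refine ENNReal.rpow_le_rpow (holder.trans ?_) hp0.le
        rw [e1]
        gcongr
    _ = _ := by
        rw [ENNReal.mul_rpow_of_nonneg _ _ hp0.le, ← ENNReal.rpow_mul, ← ENNReal.rpow_mul,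
          one_div_mul_cancel hp0.ne', ENNReal.rpow_one,
          show 1 / (p / (p - 1)) * p = p - 1 by field_simp, rayConstant]
        ring

theorem lintegral_rpow_segmentMean_le {p : ℝ} (hp : 2 ≤ p) {h : Plane → ℝ≥0∞}
    (hh : Measurable h) (S B : Set Plane) :
    ∫⁻ x in S, (∫⁻ s in Ioc (0 : ℝ) 1, segmentMean h B s x ^ (1 / 2 : ℝ)) ^ p ≤
      rayConstant p * (4 * (volume S + volume B)) * (∫⁻ z, h z) ^ (p / 2) := by
  set I := ∫⁻ z, h z with hI
  have hm := measurable_segmentMean hh B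
  calc ∫⁻ x in S, (∫⁻ s in Ioc (0 : ℝ) 1, segmentMean h B s x ^ (1 / 2 : ℝ)) ^ p
      ≤ ∫⁻ x in S, rayConstant p * I ^ (p / 2 - 1) *
          ∫⁻ s in Ioc (0 : ℝ) 1, segmentMean h B s x :=
        lintegral_mono fun x => rpow_lintegral_sqrt_segmentMean_le hp hh B x
    _ = rayConstant p * I ^ (p / 2 - 1) *
          ∫⁻ x in S, ∫⁻ s in Ioc (0 : ℝ) 1, segmentMean h B s x := by
        rw [lintegral_const_mul]
        exact Measurable.lintegral_prod_right' (f := fun q : Plane × ℝ => segmentMean h B q.2 q.1)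
          (hm.comp measurable_swap)
    _ = rayConstant p * I ^ (p / 2 - 1) *
          ∫⁻ s in Ioc (0 : ℝ) 1, ∫⁻ x in S, segmentMean h B s x := by
        rw [lintegral_lintegral_swap]
        exact (hm.comp measurable_swap).aemeasurable
    _ ≤ rayConstant p * I ^ (p / 2 - 1) *
          ∫⁻ s in Ioc (0 : ℝ) 1, 4 * (volume S + volume B) * I := by
        refine mul_le_mul_right ?_ _
        exact setLIntegral_mono measurable_const fun s hs => lintegral_segmentMean_le hh hs
    _ = rayConstant p * (4 * (volume S + volume B)) * (I ^ (p / 2 - 1) * I ^ (1 : ℝ)) := by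
        rw [setLIntegral_const]
        simp
        ring
    _ = _ := by
        rw [← ENNReal.rpow_add_of_nonneg _ _ (by linarith) zero_le_one]
        congr 2
        ring

theorem enorm_sub_le_lintegral_segment {v : Plane → ℝ} (hv : ContDiff ℝ 1 v) (x z : Plane) :
    ‖v x - v z‖ₑ ≤ ‖z - x‖ₑ * ∫⁻ s in Ioc (0 : ℝ) 1, ‖fderiv ℝ v ((1 - s) • x + s • z)‖ₑ := by
  have hc : Continuous fun s : ℝ => fderiv ℝ v ((1 - s) • x + s • z) :=
    (hv.continuous_fderiv (by simp)).comp (by fun_prop)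
  have hd : ∀ s : ℝ, HasDerivAt (fun s : ℝ => v ((1 - s) • x + s • z))
      (fderiv ℝ v ((1 - s) • x + s • z) (z - x)) s := by
    intro s
    have h1 : HasDerivAt (fun s : ℝ => (1 - s) • x + s • z) (z - x) s := by
      have := (((hasDerivAt_id s).const_sub 1).smul_const x).add
        ((hasDerivAt_id s).smul_const z)
      simpa [neg_add_eq_sub, Pi.add_def] using this
    exact ((hv.differentiable (by simp)) _).hasFDerivAt.comp_hasDerivAt s h1
  have hftc := intervalIntegral.integral_eq_sub_of_hasDerivAt (a := 0) (b := 1)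
    (fun s _ => hd s) ((hc.clm_apply continuous_const).intervalIntegrable _ _)
  simp only [sub_self, zero_smul, one_smul, zero_add, sub_zero, add_zero] at hftc
  rw [← enorm_neg, neg_sub, ← hftc, intervalIntegral.integral_of_le zero_le_one]
  refine (enorm_integral_le_lintegral_enorm _).trans ?_
  rw [← lintegral_const_mul _ (by fun_prop)]
  refine lintegral_mono fun s => ?_
  rw [mul_comm]
  exact ContinuousLinearMap.le_opENorm _ _

/-- **Sobolev–Poincaré inequality** for smooth functions on sets that are star-shaped with respect
to a ball, with a constant that depends only on bounds for the set. -/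
theorem exists_lintegral_sub_const_le_of_starShaped {p : ℝ} (hp : 2 ≤ p) {z₀ : Plane} {r : ℝ}
    (hr : 0 < r) {d : ℝ} {V : ℝ≥0∞} (hV : V ≠ ⊤) :
    ∃ C : ℝ≥0∞, C ≠ ⊤ ∧ ∀ S : Set Plane, MeasurableSet S → volume S ≤ V →
      (∀ x ∈ S, ∀ z ∈ Metric.ball z₀ r, segment ℝ x z ⊆ S ∧ ‖z - x‖ ≤ d) →
      ∀ v : Plane → ℝ, ContDiff ℝ 1 v → ∃ c : ℝ,
        ∫⁻ x in S, ‖v x - c‖ₑ ^ p ≤ C * (∫⁻ x in S, ‖fderiv ℝ v x‖ₑ ^ 2) ^ (p / 2) := by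
  set B := Metric.ball z₀ r with hB
  have hBpos : volume B ≠ 0 := (Metric.measure_ball_pos volume z₀ hr).ne'
  have hBfin : volume B ≠ ⊤ := measure_ball_lt_top.ne
  have hp0 : 0 < p := by linarith
  refine ⟨((volume B)⁻¹ * ENNReal.ofReal d * volume B ^ (1 / 2 : ℝ)) ^ p *
    (rayConstant p * (4 * (V + volume B))), ?_, ?_⟩
  · refine ENNReal.mul_ne_top (ENNReal.rpow_ne_top_of_nonneg hp0.le ?_)
      (ENNReal.mul_ne_top (rayConstant_ne_top hp)
        (ENNReal.mul_ne_top (by norm_num) (ENNReal.add_ne_top.2 ⟨hV, hBfin⟩)))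
    exact ENNReal.mul_ne_top (ENNReal.mul_ne_top (ENNReal.inv_ne_top.2 hBpos)
      ENNReal.ofReal_ne_top) (ENNReal.rpow_ne_top_of_nonneg (by norm_num) hBfin)
  intro S hS hSV hstar v hv
  -- Segments from `S` to the ball stay in `S`, so the cut-off loses nothing along them and allows
  -- substitutions over the whole plane.
  set g : Plane → ℝ≥0∞ := S.indicator fun x => ‖fderiv ℝ v x‖ₑ with hg
  have hfm : Measurable fun x => ‖fderiv ℝ v x‖ₑ :=
    (hv.continuous_fderiv (by simp)).enorm.measurable
  have hgm : Measurable g := hfm.indicator hS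
  set h : Plane → ℝ≥0∞ := fun x => g x ^ (2 : ℝ) with hh
  have hhm : Measurable h := by fun_prop
  have hI : ∫⁻ x, h x = ∫⁻ x in S, ‖fderiv ℝ v x‖ₑ ^ 2 := by
    rw [← lintegral_indicator hS]
    congr 1
    ext x
    by_cases hx : x ∈ S <;> simp [hh, hg, hx]
  have hvint : IntegrableOn v B :=
    (hv.continuous.continuousOn.integrableOn_compact (isCompact_closedBall z₀ r)).mono_set
      Metric.ball_subset_closedBall
  -- The constant is the mean of `v` over the ball: average the segment estimate for `v x - v z`
  -- over `z ∈ B`, then apply Cauchy–Schwarz in `z` for each fixed `s`.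
  have hpt : ∀ x ∈ S, ‖v x - ⨍ z in B, v z‖ₑ ≤
      (volume B)⁻¹ * ENNReal.ofReal d * volume B ^ (1 / 2 : ℝ) *
        ∫⁻ s in Ioc (0 : ℝ) 1, segmentMean h B s x ^ (1 / 2 : ℝ) := by
    intro x hx
    have hcs : ∀ s : ℝ, ∫⁻ z in B, g ((1 - s) • x + s • z) ≤
        volume B ^ (1 / 2 : ℝ) * segmentMean h B s x ^ (1 / 2 : ℝ) := by
      intro s
      have h2 : (2 : ℝ).HolderConjugate 2 := Real.HolderConjugate.two_two
      have := ENNReal.lintegral_mul_le_Lp_mul_Lq (volume.restrict B) h2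
        (f := fun _ => 1) (g := fun z => g ((1 - s) • x + s • z)) (by fun_prop) (by fun_prop)
      simpa [segmentMean, hh] using this
    have : IsFiniteMeasure (volume.restrict B) := ⟨by simpa using measure_ball_lt_top⟩
    have havg : v x - ⨍ z in B, v z = (volume.real B)⁻¹ • ∫ z in B, (v x - v z) := by
      rw [integral_sub (integrable_const (v x)) hvint, setAverage_eq, setIntegral_const,
        smul_sub, smul_smul, inv_mul_cancel₀, one_smul]
      exact (ENNReal.toReal_pos hBpos hBfin).ne'
    have hinv : ‖(volume.real B)⁻¹‖ₑ = (volume B)⁻¹ := by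
      have hpos := ENNReal.toReal_pos hBpos hBfin
      rw [Measure.real, enorm_inv hpos.ne', Real.enorm_of_nonneg hpos.le,
        ENNReal.ofReal_toReal hBfin]
    rw [havg, enorm_smul, hinv, mul_assoc, mul_assoc]
    gcongr
    calc ‖∫ z in B, (v x - v z)‖ₑ ≤ ∫⁻ z in B, ‖v x - v z‖ₑ :=
          enorm_integral_le_lintegral_enorm _
      _ ≤ ∫⁻ z in B, ENNReal.ofReal d *
            ∫⁻ s in Ioc (0 : ℝ) 1, g ((1 - s) • x + s • z) := by
          refine setLIntegral_mono' Metric.isOpen_ball.measurableSet fun z hz => ?_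
          refine (enorm_sub_le_lintegral_segment hv x z).trans (mul_le_mul' ?_ ?_)
          · rw [← ofReal_norm]
            exact ENNReal.ofReal_le_ofReal (hstar x hx z hz).2
          · refine (setLIntegral_congr_fun measurableSet_Ioc fun s hs => ?_).le
            have hmem : (1 - s) • x + s • z ∈ S := (hstar x hx z hz).1
              ⟨1 - s, s, by linarith [hs.2], hs.1.le, by ring, rfl⟩
            simp [hg, hmem]
      _ = ENNReal.ofReal d * ∫⁻ s in Ioc (0 : ℝ) 1, ∫⁻ z in B, g ((1 - s) • x + s • z) := by
          rw [lintegral_const_mul, lintegral_lintegral_swap]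
          · exact (by fun_prop : Measurable _).aemeasurable
          · exact Measurable.lintegral_prod_right'
              (f := fun q : Plane × ℝ => g ((1 - q.2) • x + q.2 • q.1)) (by fun_prop)
      _ ≤ ENNReal.ofReal d * ∫⁻ s in Ioc (0 : ℝ) 1,
            volume B ^ (1 / 2 : ℝ) * segmentMean h B s x ^ (1 / 2 : ℝ) := by
          gcongr with s
          exact hcs s
      _ = _ := by
          rw [lintegral_const_mul' _ _ (ENNReal.rpow_ne_top_of_nonneg (by norm_num) hBfin)]
  refine ⟨⨍ z in B, v z, ?_⟩
  rw [← hI]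
  set A := (volume B)⁻¹ * ENNReal.ofReal d * volume B ^ (1 / 2 : ℝ) with hA
  calc ∫⁻ x in S, ‖v x - ⨍ z in B, v z‖ₑ ^ p
      ≤ ∫⁻ x in S, A ^ p * (∫⁻ s in Ioc (0 : ℝ) 1, segmentMean h B s x ^ (1 / 2 : ℝ)) ^ p := by
        refine setLIntegral_mono' hS fun x hx => ?_
        rw [← ENNReal.mul_rpow_of_nonneg _ _ hp0.le]
        exact ENNReal.rpow_le_rpow (hpt x hx) hp0.le
    _ = A ^ p * ∫⁻ x in S, (∫⁻ s in Ioc (0 : ℝ) 1, segmentMean h B s x ^ (1 / 2 : ℝ)) ^ p := by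
        rw [lintegral_const_mul]
        refine Measurable.pow_const (Measurable.lintegral_prod_right'
          (f := fun q : Plane × ℝ => segmentMean h B q.2 q.1 ^ (1 / 2 : ℝ)) ?_) _
        exact ((measurable_segmentMean hhm B).comp measurable_swap).pow_const _
    _ ≤ A ^ p * (rayConstant p * (4 * (V + volume B)) * (∫⁻ z, h z) ^ (p / 2)) := by
        gcongr
        refine (lintegral_rpow_segmentMean_le hp hhm S B).trans ?_
        gcongr
    _ = _ := by ring

/-! ### Mollification of functions with a weak gradient -/

section Mollification

open scoped Convolution

/-- The convolution of `u`, extended by zero outside `Ω`, with a normalised bump function. -/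
noncomputable def mollify (Ω : Set Plane) (φ : ContDiffBump (0 : Plane)) (u : Plane → ℝ) :
    Plane → ℝ :=
  φ.normed volume ⋆[ContinuousLinearMap.lsmul ℝ ℝ, volume] (Ω.indicator u)

variable {Ω : Set Plane} {u : Plane → ℝ} {g : Plane → Plane}

theorem contDiff_mollify (hΩ : MeasurableSet Ω) (hu : IntegrableOn u Ω)
    (φ : ContDiffBump (0 : Plane)) : ContDiff ℝ 1 (mollify Ω φ u) :=
  φ.hasCompactSupport_normed.contDiff_convolution_left (n := 1) _ φ.contDiff_normed
    (hu.integrable_indicator hΩ).locallyIntegrable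

theorem fderiv_mollify_apply (hΩ : MeasurableSet Ω) (hu : IntegrableOn u Ω)
    (φ : ContDiffBump (0 : Plane)) (x w : Plane) :
    fderiv ℝ (mollify Ω φ u) x w = ∫ y in Ω, u y * fderiv ℝ (φ.normed volume) (x - y) w := by
  have hui := hu.integrable_indicator hΩ
  have hd := (φ.hasCompactSupport_normed (μ := volume)).hasFDerivAt_convolution_left
    (ContinuousLinearMap.lsmul ℝ ℝ) (μ := volume) (φ.contDiff_normed (μ := volume) (n := 1))
    hui.locallyIntegrable x
  have hex : ConvolutionExistsAt (fderiv ℝ (φ.normed volume)) (Ω.indicator u) x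
      ((ContinuousLinearMap.lsmul ℝ ℝ).precompL Plane) volume :=
    ((φ.hasCompactSupport_normed (μ := volume)).fderiv ℝ).convolutionExists_left _
      ((φ.contDiff_normed (μ := volume) (n := 1)).continuous_fderiv (by simp))
      hui.locallyIntegrable x
  unfold mollify
  rw [hd.fderiv, convolution_eq_swap, ContinuousLinearMap.integral_apply hex.integrable_swap]
  rw [← integral_indicator hΩ]
  congr 1
  ext y
  by_cases hy : y ∈ Ω <;> simp [hy, mul_comm]

/-- The kernel `y ↦ ψ (x - y)` is an admissible test function because its support lies in the closed
ball about `x`. The sign in the weak gradient cancels the one from the reflection `y ↦ x - y`. -/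
theorem fderiv_mollify_eq_inner (hΩ : MeasurableSet Ω) (hu : IntegrableOn u Ω)
    (hg : IntegrableOn g Ω) (hug : HasWeakGradient Ω u g) (φ : ContDiffBump (0 : Plane))
    {x : Plane} (hx : Metric.closedBall x φ.rOut ⊆ Ω) (w : Plane) :
    fderiv ℝ (mollify Ω φ u) x w = inner ℝ (∫ y in Ω, φ.normed volume (x - y) • g y) w := by
  set ψ := φ.normed (volume : Measure Plane) with hψ
  have hψc : ContDiff ℝ ∞ ψ := φ.contDiff_normed
  have htest : ContDiff ℝ ∞ fun y => ψ (x - y) := hψc.comp (contDiff_const.sub contDiff_id)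
  have hsupp : tsupport (fun y => ψ (x - y)) ⊆ Metric.closedBall x φ.rOut := by
    refine closure_minimal (fun y hy => ?_) Metric.isClosed_closedBall
    have h1 : x - y ∈ Function.support ψ := hy
    rw [hψ, φ.support_normed_eq, mem_ball_zero_iff] at h1
    rw [Metric.mem_closedBall, dist_comm, dist_eq_norm]
    exact h1.le
  have hcs : HasCompactSupport fun y => ψ (x - y) :=
    (isCompact_closedBall x φ.rOut).of_isClosed_subset (isClosed_tsupport _) hsupp
  have hder : ∀ y w, fderiv ℝ (fun y => ψ (x - y)) y w = - fderiv ℝ ψ (x - y) w := by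
    intro y w
    have h1 : HasFDerivAt (fun y => ψ (x - y))
        ((fderiv ℝ ψ (x - y)).comp (-ContinuousLinearMap.id ℝ Plane)) y :=
      ((hψc.differentiable (by simp)) (x - y)).hasFDerivAt.comp y
        ((hasFDerivAt_id y).const_sub x)
    rw [h1.fderiv]
    simp
  have hcomp : ∀ i, fderiv ℝ (mollify Ω φ u) x (EuclideanSpace.single i 1) =
      ∫ y in Ω, g y i * ψ (x - y) := by
    intro i
    have h1 := hug _ htest hcs (hsupp.trans hx) i
    simp only [hder, mul_neg, integral_neg, neg_inj] at h1
    rw [fderiv_mollify_apply hΩ hu, h1]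
  obtain ⟨M, hM⟩ := hψc.continuous.bounded_above_of_compact_support φ.hasCompactSupport_normed
  have hint : IntegrableOn (fun y => ψ (x - y) • g y) Ω :=
    hg.bdd_smul M (hψc.continuous.comp (by fun_prop)).aestronglyMeasurable
      (Filter.Eventually.of_forall fun y => hM _)
  have hG : ∀ i, (∫ y in Ω, ψ (x - y) • g y) i = ∫ y in Ω, g y i * ψ (x - y) := by
    intro i
    have := (EuclideanSpace.proj (𝕜 := ℝ) i : Plane →L[ℝ] ℝ).integral_comp_comm hint
    refine this.symm.trans ?_
    simp [mul_comm]
  have hw : w = ∑ i, w i • EuclideanSpace.single i (1 : ℝ) := by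
    ext j
    fin_cases j <;> simp [Fin.sum_univ_two]
  conv_lhs => rw [hw]
  rw [map_sum, PiLp.inner_apply]
  refine Finset.sum_congr rfl fun i _ => ?_
  rw [map_smul, hcomp, hG]
  simp

theorem lintegral_ofReal_normed (φ : ContDiffBump (0 : Plane)) (x : Plane) :
    ∫⁻ y, ENNReal.ofReal (φ.normed volume (x - y)) = 1 := by
  rw [lintegral_sub_left_eq_self (fun y => ENNReal.ofReal (φ.normed volume y)) x,
    ← ofReal_integral_eq_lintegral_ofReal φ.integrable_normed
    (Filter.Eventually.of_forall φ.nonneg_normed), φ.integral_normed, ENNReal.ofReal_one]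

/-- Jensen's inequality for a kernel of mass at most `1`, in the form of Cauchy–Schwarz for the
splitting `k = k ^ (1 / 2) * k ^ (1 / 2)`. -/
theorem enorm_fderiv_mollify_sq_le (hΩ : MeasurableSet Ω) (hu : IntegrableOn u Ω)
    (hgm : StronglyMeasurable g) (hg : IntegrableOn g Ω) (hug : HasWeakGradient Ω u g)
    (φ : ContDiffBump (0 : Plane)) {x : Plane} (hx : Metric.closedBall x φ.rOut ⊆ Ω) :
    ‖fderiv ℝ (mollify Ω φ u) x‖ₑ ^ 2 ≤
      ∫⁻ y in Ω, ENNReal.ofReal (φ.normed volume (x - y)) * ‖g y‖ₑ ^ 2 := by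
  set k : Plane → ℝ≥0∞ := fun y => ENNReal.ofReal (φ.normed volume (x - y)) with hk
  have hkm : Measurable k :=
    ((φ.contDiff_normed (n := 1)).continuous.comp (by fun_prop)).measurable.ennreal_ofReal
  have hgm' : Measurable fun y => ‖g y‖ₑ := hgm.enorm
  have h1 : ‖fderiv ℝ (mollify Ω φ u) x‖ₑ ≤ ∫⁻ y in Ω, k y * ‖g y‖ₑ := by
    have h2 : ‖fderiv ℝ (mollify Ω φ u) x‖ ≤ ‖∫ y in Ω, φ.normed volume (x - y) • g y‖ := by
      refine ContinuousLinearMap.opNorm_le_bound _ (norm_nonneg _) fun w => ?_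
      rw [fderiv_mollify_eq_inner hΩ hu hg hug φ hx w]
      exact norm_inner_le_norm _ _
    have h3 : ‖fderiv ℝ (mollify Ω φ u) x‖ₑ ≤ ‖∫ y in Ω, φ.normed volume (x - y) • g y‖ₑ := by
      rw [← ofReal_norm, ← ofReal_norm]
      exact ENNReal.ofReal_le_ofReal h2
    refine (h3.trans (enorm_integral_le_lintegral_enorm _)).trans (le_of_eq ?_)
    congr 1
    ext y
    rw [enorm_smul, Real.enorm_of_nonneg (φ.nonneg_normed _)]
  have hone : ∫⁻ y in Ω, k y ≤ 1 :=
    (setLIntegral_le_lintegral _ _).trans (lintegral_ofReal_normed φ x).le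
  have hcs := ENNReal.lintegral_mul_le_Lp_mul_Lq (volume.restrict Ω) Real.HolderConjugate.two_two
    (f := fun y => k y ^ (1 / 2 : ℝ)) (g := fun y => k y ^ (1 / 2 : ℝ) * ‖g y‖ₑ)
    (by fun_prop) (by fun_prop)
  have e0 : ∀ a : ℝ≥0∞, a ^ (1 / 2 : ℝ) * a ^ (1 / 2 : ℝ) = a := fun a => by
    rw [← ENNReal.rpow_add_of_nonneg _ _ (by norm_num) (by norm_num)]
    norm_num
  have e1 : ∀ a : ℝ≥0∞, (a ^ (1 / 2 : ℝ)) ^ (2 : ℝ) = a := fun a => by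
    rw [← ENNReal.rpow_mul]
    norm_num
  simp only [Pi.mul_apply, ← mul_assoc, e0, ENNReal.mul_rpow_of_nonneg _ _ zero_le_two, e1,
    ENNReal.rpow_two] at hcs
  calc ‖fderiv ℝ (mollify Ω φ u) x‖ₑ ^ 2
      ≤ (1 ^ (1 / 2 : ℝ) * (∫⁻ y in Ω, k y * ‖g y‖ₑ ^ 2) ^ (1 / 2 : ℝ)) ^ 2 := by
        gcongr
        refine h1.trans (hcs.trans ?_)
        gcongr
    _ = _ := by
        rw [ENNReal.one_rpow, one_mul, ← ENNReal.rpow_two, e1]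

/-- Mollification does not increase the Dirichlet energy: after Tonelli the kernel integrates to `1`
in `x`. -/
theorem lintegral_fderiv_mollify_le (hΩ : MeasurableSet Ω) (hu : IntegrableOn u Ω)
    (hgm : StronglyMeasurable g) (hg : IntegrableOn g Ω) (hug : HasWeakGradient Ω u g)
    (φ : ContDiffBump (0 : Plane)) {S : Set Plane} (hS : MeasurableSet S)
    (hx : ∀ x ∈ S, Metric.closedBall x φ.rOut ⊆ Ω) :
    ∫⁻ x in S, ‖fderiv ℝ (mollify Ω φ u) x‖ₑ ^ 2 ≤ ∫⁻ y in Ω, ‖g y‖ₑ ^ 2 := by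
  have hψ : Continuous (φ.normed (volume : Measure Plane)) :=
    (φ.contDiff_normed (n := 1)).continuous
  have hgm' : Measurable fun y => ‖g y‖ₑ := hgm.enorm
  have hkm : Measurable fun q : Plane × Plane =>
      ENNReal.ofReal (φ.normed volume (q.1 - q.2)) * ‖g q.2‖ₑ ^ 2 :=
    (hψ.comp (by fun_prop)).measurable.ennreal_ofReal.mul
      ((hgm'.comp measurable_snd).pow_const 2)
  calc ∫⁻ x in S, ‖fderiv ℝ (mollify Ω φ u) x‖ₑ ^ 2
      ≤ ∫⁻ x in S, ∫⁻ y in Ω, ENNReal.ofReal (φ.normed volume (x - y)) * ‖g y‖ₑ ^ 2 :=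
        setLIntegral_mono' hS fun x h => enorm_fderiv_mollify_sq_le hΩ hu hgm hg hug φ (hx x h)
    _ ≤ ∫⁻ x, ∫⁻ y in Ω, ENNReal.ofReal (φ.normed volume (x - y)) * ‖g y‖ₑ ^ 2 :=
        setLIntegral_le_lintegral _ _
    _ = ∫⁻ y in Ω, ∫⁻ x, ENNReal.ofReal (φ.normed volume (x - y)) * ‖g y‖ₑ ^ 2 :=
        lintegral_lintegral_swap hkm.aemeasurable
    _ = ∫⁻ y in Ω, ‖g y‖ₑ ^ 2 := by
        congr 1
        ext y
        have hm : Measurable fun x => ENNReal.ofReal (φ.normed volume (x - y)) :=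
          (hψ.comp (by fun_prop : Continuous fun x => x - y)).measurable.ennreal_ofReal
        rw [lintegral_mul_const _ hm,
          lintegral_sub_right_eq_self (fun x => ENNReal.ofReal (φ.normed volume x)) y]
        have := lintegral_ofReal_normed φ 0
        rw [lintegral_sub_left_eq_self (fun y => ENNReal.ofReal (φ.normed volume y)) 0] at this
        rw [this, one_mul]

end Mollification

/-! ### Sobolev–Poincaré inequality for Sobolev functions on star-shaped open sets -/

open Filter Topology in
/-- Fatou's lemma modulo constants. -/
theorem exists_const_lintegral_le_of_tendsto {X : Type*} [MeasurableSpace X] {μ : Measure X}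
    (hμ : μ ≠ 0) {p : ℝ} (hp : 0 < p) {M : ℝ≥0∞} (hM : M ≠ ⊤) {S : ℕ → Set X}
    (hS : ∀ n, MeasurableSet (S n)) {v : ℕ → X → ℝ} (hv : ∀ n, AEMeasurable (v n) μ) {u : X → ℝ}
    (hlim : ∀ᵐ x ∂μ, Tendsto (fun n => v n x) atTop (𝓝 (u x)))
    (hSx : ∀ᵐ x ∂μ, ∀ᶠ n in atTop, x ∈ S n) {c : ℕ → ℝ}
    (hle : ∀ n, ∫⁻ x in S n, ‖v n x - c n‖ₑ ^ p ∂μ ≤ M) :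
    ∃ c : ℝ, ∫⁻ x, ‖u x - c‖ₑ ^ p ∂μ ≤ M := by
  set F : ℕ → X → ℝ≥0∞ := fun n => (S n).indicator fun x => ‖v n x - c n‖ₑ ^ p with hF
  have hFm : ∀ n, AEMeasurable (F n) μ := fun n =>
    (((hv n).sub_const _).enorm.pow_const p).indicator (hS n)
  have hFle : ∀ n, ∫⁻ x, F n x ∂μ ≤ M := fun n => by
    rw [lintegral_indicator (hS n)]
    exact hle n
  have fatou : ∀ φ : ℕ → ℕ, StrictMono φ → ∀ G : X → ℝ≥0∞,
      (∀ᵐ x ∂μ, Tendsto (fun n => F (φ n) x) atTop (𝓝 (G x))) → ∫⁻ x, G x ∂μ ≤ M := by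
    intro φ hφ G hG
    calc ∫⁻ x, G x ∂μ = ∫⁻ x, liminf (fun n => F (φ n) x) atTop ∂μ := by
          refine lintegral_congr_ae ?_
          filter_upwards [hG] with x hx
          exact hx.liminf_eq.symm
      _ ≤ liminf (fun n => ∫⁻ x, F (φ n) x ∂μ) atTop :=
          lintegral_liminf_le' fun n => hFm (φ n)
      _ ≤ M := liminf_le_of_le (by isBoundedDefault) fun b hb => by
          obtain ⟨n, hn⟩ := hb.exists
          exact hn.trans (hFle _)
  -- If the constants diverge, the integrands tend to `⊤` almost everywhere, and Fatou's lemma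
  -- contradicts the finite bound. Otherwise a bounded subsequence of constants converges to the
  -- required `c`.
  by_cases hc : Tendsto (fun n => ‖c n‖) atTop atTop
  · exfalso
    have htop : ∀ᵐ x ∂μ, Tendsto (fun n => F n x) atTop (𝓝 ⊤) := by
      filter_upwards [hlim, hSx] with x hx hxS
      have h1 : Tendsto (fun n => ‖v n x - c n‖) atTop atTop := by
        have h2 : Tendsto (fun n => ‖c n‖ + -‖v n x‖) atTop atTop :=
          hc.atTop_add hx.norm.neg
        refine tendsto_atTop_mono (fun n => ?_) h2
        have := norm_sub_norm_le (c n) (v n x)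
        rw [norm_sub_rev] at this
        linarith
      have h3 : Tendsto (fun n => ‖v n x - c n‖ₑ) atTop (𝓝 ⊤) := by
        simp_rw [← ofReal_norm]
        exact ENNReal.tendsto_ofReal_nhds_top.2 h1
      have h4 : Tendsto (fun n => ‖v n x - c n‖ₑ ^ p) atTop (𝓝 ⊤) := by
        have := (ENNReal.continuous_rpow_const (y := p)).continuousAt (x := ⊤) |>.tendsto.comp h3
        rwa [ENNReal.top_rpow_of_pos hp] at this
      refine h4.congr' ?_
      filter_upwards [hxS] with n hn
      simp [hF, hn]
    have := fatou id strictMono_id _ htop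
    rw [lintegral_const, ENNReal.top_mul (by simpa using hμ)] at this
    exact hM (top_le_iff.1 this)
  · have hfreq : ∃ R, ∃ᶠ n in atTop, c n ∈ Metric.closedBall (0 : ℝ) R := by
      rw [tendsto_atTop] at hc
      push Not at hc
      obtain ⟨R, hR⟩ := hc
      refine ⟨R, hR.mono fun n hn => ?_⟩
      rw [mem_closedBall_zero_iff]
      exact hn.le
    obtain ⟨R, hR⟩ := hfreq
    obtain ⟨c₀, -, φ, hφ, hlimc⟩ := tendsto_subseq_of_frequently_bounded
      Metric.isBounded_closedBall hR
    refine ⟨c₀, fatou φ hφ _ ?_⟩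
    filter_upwards [hlim, hSx] with x hx hxS
    have h1 : Tendsto (fun n => ‖v (φ n) x - c (φ n)‖ₑ ^ p) atTop (𝓝 (‖u x - c₀‖ₑ ^ p)) :=
      (ENNReal.continuous_rpow_const (y := p)).continuousAt.tendsto.comp
        ((hx.comp hφ.tendsto_atTop).sub hlimc).enorm
    refine h1.congr' ?_
    filter_upwards [hφ.tendsto_atTop.eventually hxS] with n hn
    simp [hF, hn]

open Filter Topology in
/-- Sobolev–Poincaré inequality on an open subset that is star-shaped with respect to a ball. -/
theorem exists_lintegral_sub_const_le {p : ℝ} (hp : 2 ≤ p) {Ω U : Set Plane}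
    (hΩ : MeasurableSet Ω) (hU : IsOpen U) (hUΩ : U ⊆ Ω) (hUfin : volume U ≠ ⊤)
    {z₀ : Plane} {r : ℝ} (hr : 0 < r) (hball : Metric.ball z₀ r ⊆ U) {d : ℝ}
    (hstar : ∀ x ∈ U, ∀ z ∈ Metric.ball z₀ r, segment ℝ x z ⊆ U ∧ ‖z - x‖ ≤ d) :
    ∃ C : ℝ≥0∞, C ≠ ⊤ ∧ ∀ (u : Plane → ℝ) (g : Plane → Plane), IntegrableOn u Ω →
      StronglyMeasurable g → IntegrableOn g Ω → HasWeakGradient Ω u g →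
      ∫⁻ x in Ω, ‖g x‖ₑ ^ 2 ≠ ⊤ →
      ∃ c : ℝ, ∫⁻ x in U, ‖u x - c‖ₑ ^ p ≤ C * (∫⁻ x in Ω, ‖g x‖ₑ ^ 2) ^ (p / 2) := by
  have hp0 : 0 < p := by linarith
  obtain ⟨C, hC, hmain⟩ := exists_lintegral_sub_const_le_of_starShaped hp (z₀ := z₀)
    (half_pos hr) (d := d) hUfin
  refine ⟨C, hC, fun u g hu hgm hg hug hI => ?_⟩
  have hz₀ : z₀ ∈ Metric.ball z₀ r := Metric.mem_ball_self hr
  set I := ∫⁻ x in Ω, ‖g x‖ₑ ^ 2 with hIdef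
  have hM : C * I ^ (p / 2) ≠ ⊤ :=
    ENNReal.mul_ne_top hC (ENNReal.rpow_ne_top_of_nonneg (by linarith) hI)
  -- `U` contracted towards `z₀` by the factor `ρ`. Star-shapedness leaves room of width `(1 - ρ) *
  -- (r / 2)` around it, so mollification is admissible there; for `ρ ≥ 1 / 2` it is star-shaped
  -- about the ball of radius `r / 2`, whence one constant `C` serves all `ρ`.
  set T : ℝ → Set Plane := fun ρ => (fun y => z₀ + ρ⁻¹ • (y - z₀)) ⁻¹' U with hT
  have hTo : ∀ ρ, IsOpen (T ρ) := fun ρ => hU.preimage (by fun_prop)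
  have hthick : ∀ ρ ∈ Ico (1 / 2 : ℝ) 1, ∀ y ∈ T ρ,
      Metric.closedBall y ((1 - ρ) * (r / 2)) ⊆ U := by
    intro ρ hρ y hy y' hy'
    have h1 : 0 < 1 - ρ := by linarith [hρ.2]
    have h0 : 0 < ρ := by linarith [hρ.1]
    have hz : z₀ + (1 - ρ)⁻¹ • (y' - y) ∈ Metric.ball z₀ r := by
      rw [mem_ball_iff_norm, add_sub_cancel_left, norm_smul, Real.norm_of_nonneg (by positivity),
        inv_mul_lt_iff₀ h1]
      rw [Metric.mem_closedBall, dist_eq_norm] at hy'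
      nlinarith
    refine (hstar _ hy _ hz).1 ⟨ρ, 1 - ρ, h0.le, h1.le, by ring, ?_⟩
    simp only [smul_add, smul_smul, mul_inv_cancel₀ h0.ne', mul_inv_cancel₀ h1.ne', one_smul,
      sub_smul]
    abel
  have hTU : ∀ ρ ∈ Ico (1 / 2 : ℝ) 1, T ρ ⊆ U := fun ρ hρ y hy =>
    hthick ρ hρ y hy (Metric.mem_closedBall_self
      (mul_nonneg (by linarith [hρ.2]) (by linarith)))
  have hTstar : ∀ ρ ∈ Ico (1 / 2 : ℝ) 1, ∀ x ∈ T ρ, ∀ z ∈ Metric.ball z₀ (r / 2),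
      segment ℝ x z ⊆ T ρ ∧ ‖z - x‖ ≤ d := by
    intro ρ hρ x hx z hz
    have h0 : 0 < ρ := by linarith [hρ.1]
    refine ⟨?_, (hstar x (hTU ρ hρ hx) z (Metric.ball_subset_ball (by linarith) hz)).2⟩
    rintro _ ⟨a, b, ha, hb, hab, rfl⟩
    have hz' : z₀ + ρ⁻¹ • (z - z₀) ∈ Metric.ball z₀ r := by
      rw [mem_ball_iff_norm] at hz ⊢
      rw [add_sub_cancel_left, norm_smul, Real.norm_of_nonneg (by positivity),
        inv_mul_lt_iff₀ h0]
      nlinarith [hρ.1]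
    refine (hstar _ hx _ hz').1 ⟨a, b, ha, hb, hab, ?_⟩
    obtain rfl : a = 1 - b := by linarith
    module
  -- the inequality on the shrunken sets
  have hinner : ∀ ρ ∈ Ico (1 / 2 : ℝ) 1,
      ∃ c : ℝ, ∫⁻ x in T ρ, ‖u x - c‖ₑ ^ p ≤ C * I ^ (p / 2) := by
    intro ρ hρ
    have hz₀T : z₀ ∈ T ρ := by
      simp only [hT, mem_preimage, sub_self, smul_zero, add_zero]
      exact hball hz₀
    have hε : 0 < (1 - ρ) * (r / 2) := mul_pos (by linarith [hρ.2]) (by linarith)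
    let φ : ℕ → ContDiffBump (0 : Plane) := fun k =>
      ⟨(1 - ρ) * (r / 2) / (k + 1) / 2, (1 - ρ) * (r / 2) / (k + 1), by positivity,
        half_lt_self (by positivity)⟩
    have hrOut : ∀ k, (φ k).rOut = (1 - ρ) * (r / 2) / (k + 1) := fun k => rfl
    have hrIn : ∀ k, (φ k).rIn = (1 - ρ) * (r / 2) / (k + 1) / 2 := fun k => rfl
    have hsub : ∀ k, ∀ x ∈ T ρ, Metric.closedBall x (φ k).rOut ⊆ Ω := by
      intro k x hx
      refine ((Metric.closedBall_subset_closedBall ?_).trans (hthick ρ hρ x hx)).trans hUΩ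
      rw [hrOut]
      exact div_le_self hε.le (by linarith [k.cast_nonneg (α := ℝ)])
    have hlim : ∀ᵐ x, Tendsto (fun k => mollify Ω (φ k) u x) atTop (𝓝 (Ω.indicator u x)) := by
      refine ContDiffBump.ae_convolution_tendsto_right_of_locallyIntegrable (K := 2) ?_ ?_
        (hu.integrable_indicator hΩ).locallyIntegrable
      · simp only [hrOut]
        have := (tendsto_const_div_atTop_nhds_zero_nat ((1 - ρ) * (r / 2))).comp
          (tendsto_add_atTop_nat 1)
        simpa [Function.comp_def] using this
      · refine Eventually.of_forall fun k => ?_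
        rw [hrOut, hrIn]
        linarith
    choose c hc using fun k => hmain (T ρ) (hTo ρ).measurableSet
      (measure_mono (hTU ρ hρ)) (hTstar ρ hρ) (mollify Ω (φ k) u) (contDiff_mollify hΩ hu (φ k))
    refine exists_const_lintegral_le_of_tendsto (μ := volume.restrict (T ρ)) ?_ hp0 hM
      (S := fun _ => univ) (fun _ => MeasurableSet.univ) (v := fun k => mollify Ω (φ k) u)
      (fun k => (contDiff_mollify hΩ hu (φ k)).continuous.measurable.aemeasurable) ?_
      (by simp) (c := c) fun k => ?_
    · rw [Ne, Measure.restrict_eq_zero]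
      exact ((hTo ρ).measure_pos volume ⟨z₀, hz₀T⟩).ne'
    · filter_upwards [ae_restrict_of_ae hlim, ae_restrict_mem (hTo ρ).measurableSet] with x hx hxT
      rwa [indicator_of_mem (hUΩ (hTU ρ hρ hxT))] at hx
    · rw [Measure.restrict_univ]
      refine (hc k).trans ?_
      gcongr
      exact lintegral_fderiv_mollify_le hΩ hu hgm hg hug (φ k) (hTo ρ).measurableSet (hsub k)
  -- The second limit: `u` is now fixed and the contracted sets exhaust `U`. The shift by `2` starts
  -- `ρ` at `1 / 2`.
  set ρ : ℕ → ℝ := fun n => 1 - 1 / (n + 2 : ℝ) with hρ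
  have hρI : ∀ n, ρ n ∈ Ico (1 / 2 : ℝ) 1 := by
    intro n
    have hn : (0 : ℝ) ≤ n := n.cast_nonneg
    have h1 : 0 < 1 / (n + 2 : ℝ) := by positivity
    have h2 : 1 / (n + 2 : ℝ) ≤ 1 / 2 := by
      apply one_div_le_one_div_of_le <;> linarith
    constructor <;> simp only [hρ] <;> linarith
  have hρlim : Tendsto (fun n => (ρ n)⁻¹) atTop (𝓝 1) := by
    have h1 : Tendsto (fun n : ℕ => 1 / (n + 2 : ℝ)) atTop (𝓝 0) := by
      have := (tendsto_const_div_atTop_nhds_zero_nat (1 : ℝ)).comp (tendsto_add_atTop_nat 2)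
      simpa [Function.comp_def] using this
    simpa [hρ] using (h1.const_sub 1).inv₀ (by norm_num)
  choose c hc using fun n => hinner (ρ n) (hρI n)
  have hum : AEMeasurable u (volume.restrict U) :=
    (hu.aestronglyMeasurable.aemeasurable).mono_measure (Measure.restrict_mono hUΩ le_rfl)
  refine exists_const_lintegral_le_of_tendsto (μ := volume.restrict U) ?_ hp0 hM
    (S := fun n => T (ρ n)) (fun n => (hTo _).measurableSet) (v := fun _ => u)
    (fun _ => hum) (by simp) ?_ (c := c) fun n => ?_
  · rw [Ne, Measure.restrict_eq_zero]
    exact (hU.measure_pos volume ⟨z₀, hball hz₀⟩).ne'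
  · refine (ae_restrict_iff' hU.measurableSet).2 (Eventually.of_forall fun x hx => ?_)
    have h1 : Tendsto (fun n => z₀ + (ρ n)⁻¹ • (x - z₀)) atTop (𝓝 x) := by
      simpa using (hρlim.smul_const (x - z₀)).const_add z₀
    exact h1.eventually (hU.mem_nhds hx)
  · rw [Measure.restrict_restrict (hTo _).measurableSet,
      inter_eq_self_of_subset_left (hTU _ (hρI n))]
    exact hc n

/-- The Sobolev–Poincaré inequality on the subset `U` of `Ω`, for functions on `Ω`. -/
def SobolevPoincare (Ω : Set Plane) (p : ℝ) (U : Set Plane) : Prop :=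
  ∃ C : ℝ≥0∞, C ≠ ⊤ ∧ ∀ u : W12 Ω, ∃ c : ℝ,
    eLpNorm (fun x => W12fn u x - c) (ENNReal.ofReal p) (volume.restrict U) ≤
      C * eLpNorm (W12grad u) 2 (volume.restrict Ω)

theorem memLp_W12fn {Ω : Set Plane} (u : W12 Ω) : MemLp (W12fn u) 2 (volume.restrict Ω) :=
  Lp.memLp _

theorem memLp_W12grad {Ω : Set Plane} (u : W12 Ω) : MemLp (W12grad u) 2 (volume.restrict Ω) :=
  Lp.memLp _

theorem sobolevPoincare_of_starShaped {p : ℝ} (hp : 2 ≤ p) {Ω U : Set Plane}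
    (hΩ : IsOpen Ω) (hΩb : Bornology.IsBounded Ω) (hU : IsOpen U) (hUΩ : U ⊆ Ω)
    {z₀ : Plane} {r : ℝ} (hr : 0 < r) (hball : Metric.ball z₀ r ⊆ U)
    (hstar : ∀ x ∈ U, ∀ z ∈ Metric.ball z₀ r, segment ℝ x z ⊆ U) :
    SobolevPoincare Ω p U := by
  have hp0 : 0 < p := by linarith
  have hfin : volume Ω < ⊤ := hΩb.measure_lt_top
  have : IsFiniteMeasure (volume.restrict Ω) := ⟨by simpa using hfin⟩
  obtain ⟨C, hC, h⟩ := exists_lintegral_sub_const_le hp hΩ.measurableSet hU hUΩ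
    ((measure_mono hUΩ).trans_lt hfin).ne hr hball (d := Metric.diam Ω) fun x hx z hz =>
      ⟨hstar x hx z hz, by
        rw [← dist_eq_norm]
        exact Metric.dist_le_diam_of_mem hΩb (hUΩ (hball hz)) (hUΩ hx)⟩
  refine ⟨C ^ (1 / p), ENNReal.rpow_ne_top_of_nonneg (by positivity) hC, fun u => ?_⟩
  have hI : eLpNorm (W12grad u) 2 (volume.restrict Ω) =
      (∫⁻ x in Ω, ‖W12grad u x‖ₑ ^ 2) ^ (1 / 2 : ℝ) := by
    rw [eLpNorm_eq_lintegral_rpow_enorm_toReal (by norm_num) (by norm_num)]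
    simp
  have hIfin : ∫⁻ x in Ω, ‖W12grad u x‖ₑ ^ 2 ≠ ⊤ := by
    have := (memLp_W12grad u).eLpNorm_ne_top
    rw [hI] at this
    intro htop
    rw [htop, ENNReal.top_rpow_of_pos (by norm_num)] at this
    exact this rfl
  obtain ⟨c, hc⟩ := h (W12fn u) (W12grad u) ((memLp_W12fn u).integrable (by norm_num))
    (Lp.stronglyMeasurable _) ((memLp_W12grad u).integrable (by norm_num)) u.2 hIfin
  refine ⟨c, ?_⟩
  rw [eLpNorm_eq_lintegral_rpow_enorm_toReal (by simpa using hp0) ENNReal.ofReal_ne_top,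
    ENNReal.toReal_ofReal hp0.le, hI]
  refine (ENNReal.rpow_le_rpow hc (by positivity)).trans (le_of_eq ?_)
  rw [ENNReal.mul_rpow_of_nonneg _ _ (by positivity), ← ENNReal.rpow_mul]
  congr 2
  field_simp

/-! ### Sobolev–Poincaré inequality on Lipschitz domains -/

theorem eLpNorm_restrict_union_le {X : Type*} [MeasurableSpace X] {μ : Measure X} {p : ℝ}
    (hp : 1 ≤ p) (f : X → ℝ) (U V : Set X) :
    eLpNorm f (ENNReal.ofReal p) (μ.restrict (U ∪ V)) ≤
      eLpNorm f (ENNReal.ofReal p) (μ.restrict U) +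
        eLpNorm f (ENNReal.ofReal p) (μ.restrict V) := by
  have hp0 : 0 < p := by linarith
  refine (eLpNorm_mono_measure f (Measure.restrict_union_le U V)).trans ?_
  simp only [eLpNorm_eq_lintegral_rpow_enorm_toReal (by simpa using hp0 : ENNReal.ofReal p ≠ 0)
    ENNReal.ofReal_ne_top, ENNReal.toReal_ofReal hp0.le]
  rw [lintegral_add_measure]
  exact ENNReal.rpow_add_le_add_rpow _ _ (by positivity) (by rw [div_le_one hp0]; exact hp)

/-- On the overlap both constants approximate `u`, and the overlap has positive measure, so their
difference is controlled by the gradient. Hence the constant of `U` also serves on `V`; `D` is the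
ratio of the norms of `1` on `V` and on `U ∩ V`. -/
theorem SobolevPoincare.union {Ω U V : Set Plane} {p : ℝ} (hp : 1 ≤ p)
    (hU : SobolevPoincare Ω p U) (hV : SobolevPoincare Ω p V) (hUΩ : U ⊆ Ω) (hVΩ : V ⊆ Ω)
    (hVfin : volume V ≠ ⊤) (hUV : volume (U ∩ V) ≠ 0) : SobolevPoincare Ω p (U ∪ V) := by
  obtain ⟨C₁, hC₁, h₁⟩ := hU
  obtain ⟨C₂, hC₂, h₂⟩ := hV
  have hp0 : 0 < p := by linarith
  have hq0 : ENNReal.ofReal p ≠ 0 := by simpa using hp0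
  have hq1 : 1 ≤ ENNReal.ofReal p := by simpa using hp
  set D := volume V ^ (1 / p) / volume (U ∩ V) ^ (1 / p) with hD
  have hm0 : volume (U ∩ V) ^ (1 / p) ≠ 0 := by
    simp [hUV, hp0.le]
  have hmt : volume (U ∩ V) ^ (1 / p) ≠ ⊤ := ENNReal.rpow_ne_top_of_nonneg (by positivity)
    (ne_top_of_le_ne_top hVfin (measure_mono inter_subset_right))
  have hDt : D ≠ ⊤ := ENNReal.div_ne_top (ENNReal.rpow_ne_top_of_nonneg (by positivity) hVfin) hm0
  refine ⟨C₁ + C₂ + (C₁ + C₂) * D, ENNReal.add_ne_top.2 ⟨ENNReal.add_ne_top.2 ⟨hC₁, hC₂⟩,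
    ENNReal.mul_ne_top (ENNReal.add_ne_top.2 ⟨hC₁, hC₂⟩) hDt⟩, fun u => ?_⟩
  obtain ⟨c₁, hc₁⟩ := h₁ u
  obtain ⟨c₂, hc₂⟩ := h₂ u
  set G := eLpNorm (W12grad u) 2 (volume.restrict Ω) with hG
  have hum : AEStronglyMeasurable (W12fn u) (volume.restrict Ω) :=
    (memLp_W12fn u).aestronglyMeasurable
  have hmeas : ∀ (W : Set Plane), W ⊆ Ω → ∀ c : ℝ,
      AEStronglyMeasurable (fun x => W12fn u x - c) (volume.restrict W) := fun W hW c =>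
    (hum.mono_measure (Measure.restrict_mono hW le_rfl)).sub aestronglyMeasurable_const
  have hconst : ∀ W : Set Plane, volume W ≠ 0 →
      eLpNorm (fun _ : Plane => c₂ - c₁) (ENNReal.ofReal p) (volume.restrict W) =
        ‖c₂ - c₁‖ₑ * volume W ^ (1 / p) := by
    intro W hW
    rw [eLpNorm_const _ hq0 (by rwa [Ne, Measure.restrict_eq_zero]), Measure.restrict_apply_univ,
      ENNReal.toReal_ofReal hp0.le]
  have hV0 : volume V ≠ 0 := fun h => hUV (measure_mono_null inter_subset_right h)
  have hdiff : ‖c₂ - c₁‖ₑ * volume (U ∩ V) ^ (1 / p) ≤ (C₁ + C₂) * G := by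
    rw [← hconst _ hUV]
    have : (fun _ : Plane => c₂ - c₁) =
        (fun x => W12fn u x - c₁) - (fun x => W12fn u x - c₂) := by
      ext x
      simp
    rw [this, add_mul]
    refine (eLpNorm_sub_le (hmeas _ (inter_subset_left.trans hUΩ) _)
      (hmeas _ (inter_subset_left.trans hUΩ) _) hq1).trans (add_le_add ?_ ?_)
    · exact (eLpNorm_mono_measure _ (Measure.restrict_mono inter_subset_left le_rfl)).trans hc₁
    · exact (eLpNorm_mono_measure _ (Measure.restrict_mono inter_subset_right le_rfl)).trans hc₂
  have hVc : eLpNorm (fun x => W12fn u x - c₁) (ENNReal.ofReal p) (volume.restrict V) ≤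
      C₂ * G + (C₁ + C₂) * D * G := by
    have : (fun x => W12fn u x - c₁) =
        (fun x => W12fn u x - c₂) + (fun _ : Plane => c₂ - c₁) := by
      ext x
      simp
    rw [this]
    refine (eLpNorm_add_le (hmeas _ hVΩ _) aestronglyMeasurable_const hq1).trans
      (add_le_add hc₂ ?_)
    rw [hconst _ hV0]
    calc ‖c₂ - c₁‖ₑ * volume V ^ (1 / p)
        = ‖c₂ - c₁‖ₑ * volume (U ∩ V) ^ (1 / p) * D := by
          rw [hD, mul_assoc, ENNReal.mul_div_cancel hm0 hmt]
      _ ≤ (C₁ + C₂) * G * D := by gcongr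
      _ = _ := by ring
  refine ⟨c₁, (eLpNorm_restrict_union_le hp _ U V).trans ((add_le_add hc₁ hVc).trans
    (le_of_eq ?_))⟩
  ring

theorem plane_norm_le (x : Plane) : ‖x‖ ≤ |x 0| + |x 1| := by
  rw [EuclideanSpace.norm_eq, Fin.sum_univ_two, Real.norm_eq_abs, Real.norm_eq_abs]
  refine Real.sqrt_le_iff.2 ⟨by positivity, ?_⟩
  nlinarith [abs_nonneg (x 0), abs_nonneg (x 1)]

/-- Near a boundary point a Lipschitz domain is star-shaped with respect to a ball. -/
theorem exists_starShaped_of_mem_frontier {Ω : Set Plane} (hΩ : IsBoundedLipschitzDomain Ω)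
    {q : Plane} (hq : q ∈ frontier Ω) : ∃ N : Set Plane, IsOpen N ∧ q ∈ N ∧
      ∃ z₀ : Plane, ∃ r > 0, Metric.ball z₀ r ⊆ Ω ∩ N ∧
        ∀ x ∈ Ω ∩ N, ∀ z ∈ Metric.ball z₀ r, segment ℝ x z ⊆ Ω ∩ N := by
  obtain ⟨R, hR, e, L, γ, hγ, hloc⟩ := hΩ.boundary q hq
  have hec : ∀ i, Continuous fun x => e x i := fun i => by fun_prop
  have hγc := hγ.continuous
  have hmem : ∀ x ∈ Metric.ball q R, (x ∈ Ω ↔ γ (e x 0) < e x 1) := by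
    intro x hx
    have := Set.ext_iff.1 hloc x
    simp only [mem_inter_iff, hx, and_true, mem_ofPred_eq] at this
    exact this
  set a := e q 0 with ha
  set b := e q 1 with hb
  have hγa : γ a = b := by
    rw [hΩ.isOpen.frontier_eq] at hq
    refine le_antisymm ?_ ?_
    · by_contra! hlt
      have hopen : IsOpen ({x | e x 1 < γ (e x 0)} ∩ Metric.ball q R) :=
        (isOpen_lt (hec 1) (hγc.comp (hec 0))).inter Metric.isOpen_ball
      obtain ⟨y, ⟨hy1, hy2⟩, hyΩ⟩ := mem_closure_iff.1 hq.1 _ hopen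
        ⟨hlt, Metric.mem_ball_self hR⟩
      exact lt_asymm hy1 ((hmem y hy2).1 hyΩ)
    · exact not_lt.1 fun h => hq.2 ((hmem q (Metric.mem_ball_self hR)).2 h)
  have hL : (0 : ℝ) ≤ L := L.2
  have hlip : ∀ s t : ℝ, γ s ≤ γ t + L * |s - t| := by
    intro s t
    have := hγ.dist_le_mul s t
    rw [Real.dist_eq, Real.dist_eq] at this
    linarith [le_abs_self (γ s - γ t)]
  -- The box `N` has half-width `δ` and half-height `(3 * L + 4) * δ`; their sum is `R`, so `N` lies
  -- in the ball where the graph describes `Ω`. The centre `z₀` sits `(3 * L + 2) * δ` above `q`,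
  -- high enough for segments to it to climb more steeply than the graph.
  set δ := R / (3 * L + 5) with hδ
  have hδ0 : 0 < δ := by positivity
  have hδR : (3 * L + 5) * δ = R := by rw [hδ]; field_simp
  set N : Set Plane := {x | |e x 0 - a| < δ ∧ |e x 1 - b| < (3 * L + 4) * δ} with hN
  have hNball : N ⊆ Metric.ball q R := by
    rintro x ⟨h1, h2⟩
    rw [mem_ball_iff_norm, ← e.norm_map, map_sub]
    have := plane_norm_le (e x - e q)
    simp only [PiLp.sub_apply, ← ha, ← hb] at this
    linarith
  have hNo : IsOpen N :=
    (isOpen_lt ((hec 0).sub continuous_const).abs continuous_const).inter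
      (isOpen_lt ((hec 1).sub continuous_const).abs continuous_const)
  have hLδ : 0 ≤ L * δ := by positivity
  have hqN : q ∈ N := by
    simp only [hN, mem_ofPred_eq, ← ha, ← hb, sub_self, abs_zero]
    exact ⟨hδ0, by positivity⟩
  set z₀ : Plane := e.symm !₂[a, b + (3 * L + 2) * δ] with hz₀
  have hz : ∀ z ∈ Metric.ball z₀ δ, |e z 0 - a| < δ ∧ b + (3 * L + 1) * δ < e z 1 ∧
      e z 1 < b + (3 * L + 3) * δ := by
    intro z hz
    rw [mem_ball_iff_norm, ← e.norm_map, map_sub] at hz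
    have h0 := (PiLp.norm_apply_le (e z - e z₀) 0).trans_lt hz
    have h1 := (PiLp.norm_apply_le (e z - e z₀) 1).trans_lt hz
    simp only [PiLp.sub_apply, hz₀, LinearIsometryEquiv.apply_symm_apply, Real.norm_eq_abs] at h0 h1
    have h0' : |e z 0 - a| < δ := by simpa using h0
    have h1' : |e z 1 - (b + (3 * L + 2) * δ)| < δ := by simpa using h1
    rw [abs_lt] at h1'
    exact ⟨h0', by linarith, by linarith⟩
  have hγb : ∀ s, |s - a| < δ → γ s ≤ b + L * δ := by
    intro s hs
    have := hlip s a
    rw [hγa] at this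
    nlinarith
  have hzN : ∀ z ∈ Metric.ball z₀ δ, z ∈ N := by
    intro z hz'
    obtain ⟨h0, h1, h2⟩ := hz z hz'
    refine ⟨h0, abs_lt.2 ⟨?_, ?_⟩⟩ <;> linarith
  refine ⟨N, hNo, hqN, z₀, δ, hδ0, fun z hz' => ⟨?_, hzN z hz'⟩, ?_⟩
  · rw [hmem z (hNball (hzN z hz'))]
    obtain ⟨h0, h1, h2⟩ := hz z hz'
    have := hγb _ h0
    linarith
  · rintro x ⟨hxΩ, hxN⟩ z hz' _ ⟨s, t, hs, ht, hst, rfl⟩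
    rw [hmem x (hNball hxN)] at hxΩ
    obtain ⟨hx0, hx1⟩ := hxN
    obtain ⟨h0, h1, h2⟩ := hz z hz'
    obtain rfl : s = 1 - t := by linarith
    have e0 : e ((1 - t) • x + t • z) 0 = (1 - t) * e x 0 + t * e z 0 := by simp
    have e1 : e ((1 - t) • x + t • z) 1 = (1 - t) * e x 1 + t * e z 1 := by simp
    have hconv : ∀ {X Z c d : ℝ}, |X - c| < d → |Z - c| < d → |(1 - t) * X + t * Z - c| < d := by
      intro X Z c d hX hZ
      have := convex_ball c d (show X ∈ Metric.ball c d from hX) (show Z ∈ Metric.ball c d from hZ)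
        hs ht (by ring)
      exact this
    have hyN : (1 - t) • x + t • z ∈ N := by
      simp only [hN, mem_ofPred_eq, e0, e1]
      exact ⟨hconv hx0 h0, hconv hx1 (hzN z hz').2⟩
    rw [abs_lt] at hx0 hx1 h0
    refine ⟨(hmem _ (hNball hyN)).2 ?_, hyN⟩
    have hy0 := hyN.1
    -- Above height `b + L * δ` both endpoints lie over the whole graph in the strip. Below it the
    -- segment rises by more than `(2 * L + 1) * δ` over a horizontal distance below `2 * δ`, so its
    -- slope beats the Lipschitz constant.
    rcases lt_or_ge (b + L * δ) (e x 1) with hcase | hcase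
    · refine (hγb _ hy0).trans_lt ?_
      rw [e1]
      exact convex_Ioi (b + L * δ) (show e x 1 ∈ Ioi _ from hcase)
        (show e z 1 ∈ Ioi _ from by simp only [mem_Ioi]; linarith) hs ht (by ring)
    · rw [e0, e1]
      have h3 := hlip ((1 - t) * e x 0 + t * e z 0) (e x 0)
      have h4 : |(1 - t) * e x 0 + t * e z 0 - e x 0| ≤ t * (2 * δ) := by
        rw [show (1 - t) * e x 0 + t * e z 0 - e x 0 = t * (e z 0 - e x 0) by ring, abs_mul,
          abs_of_nonneg ht]
        exact mul_le_mul_of_nonneg_left (abs_le.2 ⟨by linarith, by linarith⟩) ht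
      have h5 : L * |(1 - t) * e x 0 + t * e z 0 - e x 0| ≤ L * (t * (2 * δ)) :=
        mul_le_mul_of_nonneg_left h4 hL
      have h6 : t * (L * (2 * δ)) ≤ t * (e z 1 - e x 1) :=
        mul_le_mul_of_nonneg_left (by linarith) ht
      linarith

theorem exists_nhd_sobolevPoincare {p : ℝ} (hp : 2 ≤ p) {Ω : Set Plane}
    (hΩ : IsBoundedLipschitzDomain Ω) {q : Plane} (hq : q ∈ closure Ω) :
    ∃ N : Set Plane, IsOpen N ∧ q ∈ N ∧ SobolevPoincare Ω p (Ω ∩ N) := by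
  by_cases hqΩ : q ∈ Ω
  · obtain ⟨r, hr, hball⟩ := Metric.isOpen_iff.1 hΩ.isOpen q hqΩ
    refine ⟨Metric.ball q r, Metric.isOpen_ball, Metric.mem_ball_self hr, ?_⟩
    rw [inter_eq_self_of_subset_right hball]
    exact sobolevPoincare_of_starShaped hp hΩ.isOpen hΩ.isBounded Metric.isOpen_ball hball hr
      subset_rfl fun x hx z hz => (convex_ball q r).segment_subset hx hz
  · have hqf : q ∈ frontier Ω := by
      rw [hΩ.isOpen.frontier_eq]
      exact ⟨hq, hqΩ⟩
    obtain ⟨N, hN, hqN, z₀, r, hr, hball, hstar⟩ := exists_starShaped_of_mem_frontier hΩ hqf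
    exact ⟨N, hN, hqN, sobolevPoincare_of_starShaped hp hΩ.isOpen hΩ.isBounded
      (hΩ.isOpen.inter hN) inter_subset_left hr hball hstar⟩

/-- **Sobolev–Poincaré inequality** on bounded Lipschitz domains. -/
theorem IsBoundedLipschitzDomain.sobolevPoincare {p : ℝ} (hp : 2 ≤ p) {Ω : Set Plane}
    (hΩ : IsBoundedLipschitzDomain Ω) : SobolevPoincare Ω p Ω := by
  classical
  have hfin : volume Ω ≠ ⊤ := hΩ.isBounded.measure_lt_top.ne
  choose! N hNo hqN hSP using fun q (hq : q ∈ closure Ω) => exists_nhd_sobolevPoincare hp hΩ hq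
  obtain ⟨t, htΩ, hcov⟩ := hΩ.isBounded.isCompact_closure.elim_nhds_subcover N
    fun q hq => (hNo q hq).mem_nhds (hqN q hq)
  set A : Finset Plane → Set Plane := fun I => ⋃ q ∈ I, Ω ∩ N q with hA
  have hAo : ∀ I ⊆ t, IsOpen (A I) := fun I hI =>
    isOpen_biUnion fun q hq => hΩ.isOpen.inter (hNo q (htΩ q (hI hq)))
  have hAΩ : ∀ I, A I ⊆ Ω := fun I => iUnion₂_subset fun q _ => inter_subset_left
  have hAt : A t = Ω := (hAΩ t).antisymm fun x hx => by
    obtain ⟨q, hq, hxq⟩ := mem_iUnion₂.1 (hcov (subset_closure hx))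
    exact mem_iUnion₂.2 ⟨q, hq, hx, hxq⟩
  -- A largest subfamily of the cover on whose union the inequality holds must be the whole cover:
  -- otherwise connectedness of `Ω` gives a further piece meeting the union in a nonempty open set,
  -- and `SobolevPoincare.union` enlarges the family.
  set F := t.powerset.filter fun I => I.Nonempty ∧ SobolevPoincare Ω p (A I) with hF
  have hne : ∀ q ∈ t, (Ω ∩ N q).Nonempty := fun q hq => by
    rw [inter_comm]
    exact mem_closure_iff.1 (htΩ q hq) _ (hNo q (htΩ q hq)) (hqN q (htΩ q hq))
  have hFne : F.Nonempty := by
    obtain ⟨x, hx⟩ := hΩ.isConnected.nonempty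
    rw [← hAt] at hx
    obtain ⟨q, hq, -⟩ := mem_iUnion₂.1 hx
    refine ⟨{q}, ?_⟩
    simp only [hF, Finset.mem_filter, Finset.mem_powerset, Finset.singleton_subset_iff, hq,
      Finset.singleton_nonempty, true_and, hA, Finset.mem_singleton, iUnion_iUnion_eq_left]
    exact hSP q (htΩ q hq)
  obtain ⟨I, hIF, hmax⟩ := F.exists_max_image Finset.card hFne
  simp only [hF, Finset.mem_filter, Finset.mem_powerset] at hIF
  obtain ⟨hIt, ⟨q₀, hq₀⟩, hI⟩ := hIF
  by_cases hIeq : I = t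
  · rwa [hIeq, hAt] at hI
  exfalso
  obtain ⟨q₁, hq₁t, hq₁I⟩ : ∃ q ∈ t, q ∉ I := by
    by_contra! hcon
    exact hIeq (hIt.antisymm hcon)
  obtain ⟨x, -, hxI, hxJ⟩ := hΩ.isConnected.isPreconnected (A I) (A (t \ I)) (hAo I hIt)
    (hAo _ Finset.sdiff_subset)
    (by
      intro x hx
      rw [← hAt] at hx
      obtain ⟨q, hq, hxq⟩ := mem_iUnion₂.1 hx
      by_cases hqI : q ∈ I
      · exact Or.inl (mem_iUnion₂.2 ⟨q, hqI, hxq⟩)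
      · exact Or.inr (mem_iUnion₂.2 ⟨q, Finset.mem_sdiff.2 ⟨hq, hqI⟩, hxq⟩))
    (by
      obtain ⟨y, hy⟩ := hne q₀ (hIt hq₀)
      exact ⟨y, hy.1, mem_iUnion₂.2 ⟨q₀, hq₀, hy⟩⟩)
    (by
      obtain ⟨y, hy⟩ := hne q₁ hq₁t
      exact ⟨y, hy.1, mem_iUnion₂.2 ⟨q₁, Finset.mem_sdiff.2 ⟨hq₁t, hq₁I⟩, hy⟩⟩)
  obtain ⟨q, hq, hxq⟩ := mem_iUnion₂.1 hxJ
  obtain ⟨hqt, hqI⟩ := Finset.mem_sdiff.1 hq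
  have hins : SobolevPoincare Ω p (A (insert q I)) := by
    have : A (insert q I) = A I ∪ Ω ∩ N q := by
      simp only [hA, Finset.set_biUnion_insert, union_comm]
    rw [this]
    refine hI.union (by linarith) (hSP q (htΩ q hqt)) (hAΩ I) inter_subset_left
      (ne_top_of_le_ne_top hfin (measure_mono inter_subset_left)) ?_
    exact (((hAo I hIt).inter (hΩ.isOpen.inter (hNo q (htΩ q hqt)))).measure_pos volume
      ⟨x, hxI, hxq⟩).ne'
  have := hmax (insert q I) (by
    simp only [hF, Finset.mem_filter, Finset.mem_powerset]
    exact ⟨Finset.insert_subset hqt hIt, Finset.insert_nonempty _ _, hins⟩)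
  rw [Finset.card_insert_of_notMem hqI] at this
  omega

/-! ### The space `W^{1,2}(Ω)`: completeness, embedding, Poincaré's inequality -/

section SobolevSpace

variable {Ω : Set Plane}

theorem continuous_setIntegral_fst_mul {ψ : Plane → ℝ} (hψ : MemLp ψ 2 (volume.restrict Ω)) :
    Continuous fun q : L2Pair Ω => ∫ x in Ω, q.fst x * ψ x := by
  have h : (fun q : L2Pair Ω => ∫ x in Ω, q.fst x * ψ x) =
      fun q => inner ℝ (hψ.toLp ψ) (WithLp.fstL 2 ℝ _ _ q) := by
    ext q
    rw [L2.inner_def]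
    refine integral_congr_ae ?_
    filter_upwards [hψ.coeFn_toLp] with x hx
    rw [hx]
    simp
  rw [h]
  fun_prop

theorem continuous_setIntegral_snd_mul {ψ : Plane → ℝ} (hψ : MemLp ψ 2 (volume.restrict Ω))
    (i : Fin 2) : Continuous fun q : L2Pair Ω => ∫ x in Ω, q.snd x i * ψ x := by
  have hψ' : MemLp (fun x => ψ x • (EuclideanSpace.single i (1 : ℝ) : Plane)) 2
      (volume.restrict Ω) :=
    ((ContinuousLinearMap.id ℝ ℝ).smulRight (EuclideanSpace.single i (1 : ℝ) : Plane)).comp_memLp'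
      hψ
  have h : (fun q : L2Pair Ω => ∫ x in Ω, q.snd x i * ψ x) =
      fun q => inner ℝ (hψ'.toLp _) (WithLp.sndL 2 ℝ _ _ q) := by
    ext q
    rw [L2.inner_def]
    refine integral_congr_ae ?_
    filter_upwards [hψ'.coeFn_toLp] with x hx
    rw [hx, real_inner_smul_left, EuclideanSpace.inner_single_left]
    simp [mul_comm]
  rw [h]
  fun_prop

/-- Each defining identity equates two continuous functionals on `L² × L²`. -/
theorem isClosed_W12 (Ω : Set Plane) : IsClosed (W12 Ω : Set (L2Pair Ω)) := by
  have h : (W12 Ω : Set (L2Pair Ω)) = ⋂ (φ : Plane → ℝ) (_ : ContDiff ℝ ∞ φ)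
      (_ : HasCompactSupport φ) (_ : tsupport φ ⊆ Ω) (i : Fin 2), {q : L2Pair Ω |
        ∫ x in Ω, q.fst x * fderiv ℝ φ x (EuclideanSpace.single i 1)
          = - ∫ x in Ω, q.snd x i * φ x} := by
    ext q
    simp only [mem_iInter]
    rfl
  rw [h]
  refine isClosed_iInter fun φ => isClosed_iInter fun hφ => isClosed_iInter fun hc =>
    isClosed_iInter fun _ => isClosed_iInter fun i => ?_
  obtain ⟨m1, m2⟩ := memLp_test Ω hφ hc
  exact isClosed_eq (continuous_setIntegral_fst_mul (m2 _))
    (continuous_setIntegral_snd_mul m1 i).neg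

instance : CompleteSpace (W12 Ω) := (isClosed_W12 Ω).completeSpace_coe

/-- The weak gradient as a bounded operator. -/
noncomputable def gradL (Ω : Set Plane) : W12 Ω →L[ℝ] Lp Plane 2 (volume.restrict Ω) :=
  (WithLp.sndL 2 ℝ _ _).comp (W12 Ω).subtypeL

theorem gradL_apply (u : W12 Ω) : (gradL Ω u : Plane → Plane) = W12grad u := rfl

theorem W12_norm_sq (u : W12 Ω) : ‖u‖ ^ 2 =
    (eLpNorm (W12fn u) 2 (volume.restrict Ω)).toReal ^ 2 + ‖gradL Ω u‖ ^ 2 :=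
  WithLp.prod_norm_sq_eq_of_L2 (u : L2Pair Ω)

theorem norm_gradL_le (u : W12 Ω) : ‖gradL Ω u‖ ≤ ‖u‖ := by
  refine abs_le_of_sq_le_sq' ?_ (norm_nonneg u) |>.2
  rw [W12_norm_sq u]
  exact le_add_of_nonneg_left (sq_nonneg _)

theorem W12fn_add (u v : W12 Ω) :
    W12fn (u + v) =ᵐ[volume.restrict Ω] fun x => W12fn u x + W12fn v x :=
  Lp.coeFn_add (u : L2Pair Ω).fst (v : L2Pair Ω).fst

theorem W12fn_sub (u v : W12 Ω) :
    W12fn (u - v) =ᵐ[volume.restrict Ω] fun x => W12fn u x - W12fn v x :=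
  Lp.coeFn_sub (u : L2Pair Ω).fst (v : L2Pair Ω).fst

theorem W12fn_smul (c : ℝ) (u : W12 Ω) :
    W12fn (c • u) =ᵐ[volume.restrict Ω] fun x => c * W12fn u x :=
  Lp.coeFn_smul c (u : L2Pair Ω).fst

theorem exists_embedding_of_eLpNorm_le {K : Set Plane} (hK : K ⊆ Ω) {q : ℝ≥0∞} [Fact (1 ≤ q)]
    {C : ℝ} (hC : 0 ≤ C)
    (h : ∀ u : W12 Ω, eLpNorm (W12fn u) q (volume.restrict Ω) ≤ ENNReal.ofReal (C * ‖u‖)) :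
    ∃ ι : W12 Ω →L[ℝ] Lp ℝ q (volume.restrict K),
      ∀ u, (ι u : Plane → ℝ) =ᵐ[volume.restrict K] W12fn u := by
  have hle : volume.restrict K ≤ volume.restrict Ω := Measure.restrict_mono hK le_rfl
  have hbound : ∀ u : W12 Ω, eLpNorm (W12fn u) q (volume.restrict K) ≤ ENNReal.ofReal (C * ‖u‖) :=
    fun u => (eLpNorm_mono_measure _ hle).trans (h u)
  have hmem : ∀ u : W12 Ω, MemLp (W12fn u) q (volume.restrict K) := fun u =>
    ⟨(memLp_W12fn u).aestronglyMeasurable.mono_measure hle,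
      (hbound u).trans_lt ENNReal.ofReal_lt_top⟩
  have hac : volume.restrict K ≪ volume.restrict Ω := hle.absolutelyContinuous
  let f : W12 Ω →ₗ[ℝ] Lp ℝ q (volume.restrict K) :=
    { toFun := fun u => (hmem u).toLp _
      map_add' := fun u v => by
        rw [← MemLp.toLp_add, MemLp.toLp_eq_toLp_iff]
        exact hac.ae_le (W12fn_add u v)
      map_smul' := fun a u => by
        rw [RingHom.id_apply, ← MemLp.toLp_const_smul, MemLp.toLp_eq_toLp_iff]
        exact hac.ae_le (W12fn_smul a u) }
  refine ⟨f.mkContinuous C fun u => ?_, fun u => (hmem u).coeFn_toLp⟩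
  change ‖(hmem u).toLp _‖ ≤ _
  rw [Lp.norm_toLp]
  exact ENNReal.toReal_le_of_le_ofReal (by positivity) (hbound u)

variable [IsFiniteMeasure (volume.restrict Ω)]

variable (Ω) in
/-- The constant function `1` as an element of `W^{1,2}(Ω)`. -/
noncomputable def W12one : W12 Ω :=
  ⟨WithLp.toLp 2 ((memLp_const (1 : ℝ)).toLp (fun _ => (1 : ℝ)), 0), by
    intro φ hφ hc hs i
    have h1 : ∫ x in Ω, ((memLp_const (1 : ℝ) (p := 2) (μ := volume.restrict Ω)).toLp
        (fun _ => (1 : ℝ)) : Plane → ℝ) x * fderiv ℝ φ x (EuclideanSpace.single i 1) = 0 := by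
      have h2 : ∫ x in Ω, ((memLp_const (1 : ℝ) (p := 2) (μ := volume.restrict Ω)).toLp
          (fun _ => (1 : ℝ)) : Plane → ℝ) x * fderiv ℝ φ x (EuclideanSpace.single i 1) =
          ∫ x in Ω, fderiv ℝ φ x (EuclideanSpace.single i 1) := by
        refine integral_congr_ae ?_
        filter_upwards [(memLp_const (1 : ℝ) (p := 2) (μ := volume.restrict Ω)).coeFn_toLp]
          with x hx
        rw [hx, one_mul]
      rw [h2, setIntegral_eq_integral_of_forall_compl_eq_zero]
      · have hci : Continuous fun x => fderiv ℝ φ x (EuclideanSpace.single i (1 : ℝ)) :=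
          (hφ.continuous_fderiv (by simp)).clm_apply continuous_const
        have := integral_mul_fderiv_eq_neg_fderiv_mul_of_integrable (μ := (volume : Measure Plane))
          (f := fun _ => (1 : ℝ)) (g := φ) (v := EuclideanSpace.single i (1 : ℝ))
          (by simp) (by
            simpa using hci.integrable_of_hasCompactSupport (hc.fderiv_apply (𝕜 := ℝ) _))
          (by simpa using hφ.continuous.integrable_of_hasCompactSupport hc)
          (fun x _ => by fun_prop) (fun x _ => hφ.differentiable (by simp) x)
        simpa using this
      · intro x hx
        have : x ∉ tsupport (fderiv ℝ φ) := fun h => hx (hs (tsupport_fderiv_subset ℝ h))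
        rw [image_eq_zero_of_notMem_tsupport this]
        rfl
    refine h1.trans ?_
    rw [eq_comm, neg_eq_zero]
    refine integral_eq_zero_of_ae ?_
    have h2 : ∀ᵐ x ∂(volume.restrict Ω), ((0 : Lp Plane 2 (volume.restrict Ω)) : Plane → Plane) x
        = 0 := Lp.coeFn_zero _ _ _
    filter_upwards [h2] with x hx
    change ((0 : Lp Plane 2 (volume.restrict Ω)) : Plane → Plane) x i * φ x = 0
    rw [hx]
    simp⟩

theorem W12fn_one : W12fn (W12one Ω) =ᵐ[volume.restrict Ω] fun _ => 1 :=
  (memLp_const (1 : ℝ)).coeFn_toLp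

@[simp]
theorem gradL_one : gradL Ω (W12one Ω) = 0 := rfl

theorem W12fn_sub_const (u : W12 Ω) (c : ℝ) :
    W12fn (u - c • W12one Ω) =ᵐ[volume.restrict Ω] fun x => W12fn u x - c := by
  filter_upwards [W12fn_sub u (c • W12one Ω), W12fn_smul c (W12one Ω), W12fn_one (Ω := Ω)]
    with x h1 h2 h3
  rw [h1, h2, h3, mul_one]

theorem gradL_sub_const (u : W12 Ω) (c : ℝ) : gradL Ω (u - c • W12one Ω) = gradL Ω u := by
  rw [(gradL Ω).map_sub, (gradL Ω).map_smul, gradL_one, smul_zero, sub_zero]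

theorem W12_norm_sub_const_sq (u : W12 Ω) (c : ℝ) : ‖u - c • W12one Ω‖ ^ 2 =
    (eLpNorm (fun x => W12fn u x - c) 2 (volume.restrict Ω)).toReal ^ 2 + ‖gradL Ω u‖ ^ 2 := by
  rw [W12_norm_sq, eLpNorm_congr_ae (W12fn_sub_const u c), gradL_sub_const]

theorem W12_norm_sub_const_le {u : W12 Ω} {c C : ℝ} (hC : 0 ≤ C)
    (h : eLpNorm (fun x => W12fn u x - c) 2 (volume.restrict Ω) ≤
      ENNReal.ofReal (C * ‖gradL Ω u‖)) : ‖u - c • W12one Ω‖ ≤ (C + 1) * ‖gradL Ω u‖ := by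
  have h1 := W12_norm_sub_const_sq u c
  have h2 : (eLpNorm (fun x => W12fn u x - c) 2 (volume.restrict Ω)).toReal ≤
      C * ‖gradL Ω u‖ := ENNReal.toReal_le_of_le_ofReal (by positivity) h
  refine abs_le_of_sq_le_sq' ?_ (by positivity) |>.2
  have h3 : 0 ≤ C * ‖gradL Ω u‖ ^ 2 := by positivity
  have h4 := pow_le_pow_left₀ ENNReal.toReal_nonneg h2 2
  rw [h1]
  linarith [mul_pow C ‖gradL Ω u‖ 2, mul_pow (C + 1) ‖gradL Ω u‖ 2,
    show (C + 1) ^ 2 * ‖gradL Ω u‖ ^ 2 =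
      C ^ 2 * ‖gradL Ω u‖ ^ 2 + 2 * (C * ‖gradL Ω u‖ ^ 2) + ‖gradL Ω u‖ ^ 2 by ring]

theorem W12one_ne_zero (hΩ : volume Ω ≠ 0) : W12one Ω ≠ 0 := by
  intro h
  have h1 : (fun _ => (1 : ℝ)) =ᵐ[volume.restrict Ω] fun _ => 0 := by
    have h0 : W12fn (0 : W12 Ω) =ᵐ[volume.restrict Ω] fun _ => 0 := Lp.coeFn_zero _ _ _
    have h2 := W12fn_one (Ω := Ω)
    rw [h] at h2
    exact h2.symm.trans h0
  have h3 : ∀ᵐ x ∂(volume.restrict Ω), False := by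
    filter_upwards [h1] with x hx
    exact one_ne_zero hx
  rw [Filter.eventually_false_iff_eq_bot, ae_eq_bot, Measure.restrict_eq_zero] at h3
  exact hΩ h3

/-- On a finite measure space the exponent can be lowered. The same `c` has to serve both exponents,
so that its size can be bounded through the `W^{1,2}` norm. -/
theorem SobolevPoincare.exists_eLpNorm_le {p : ℝ} (h : SobolevPoincare Ω p Ω) {q : ℝ≥0∞}
    (hq : q ≤ ENNReal.ofReal p) (hq0 : q ≠ 0) (h2 : 2 ≤ ENNReal.ofReal p) :
    ∃ C : ℝ≥0, ∀ u : W12 Ω, ∃ c : ℝ,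
      eLpNorm (fun x => W12fn u x - c) 2 (volume.restrict Ω) ≤ ENNReal.ofReal (C * ‖gradL Ω u‖) ∧
      eLpNorm (fun x => W12fn u x - c) q (volume.restrict Ω) ≤
        ENNReal.ofReal (C * ‖gradL Ω u‖) := by
  obtain ⟨C₀, hC₀, h⟩ := h
  set F : ℝ≥0∞ → ℝ≥0∞ := fun r =>
    volume.restrict Ω univ ^ (1 / r.toReal - 1 / (ENNReal.ofReal p).toReal) with hF
  have hFt : ∀ r ≤ ENNReal.ofReal p, r ≠ 0 → F r ≠ ⊤ := by
    intro r hr hr0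
    refine ENNReal.rpow_ne_top_of_nonneg ?_ (measure_ne_top _ _)
    rw [sub_nonneg]
    exact one_div_le_one_div_of_le (ENNReal.toReal_pos hr0 (ne_top_of_le_ne_top
      ENNReal.ofReal_ne_top hr)) (ENNReal.toReal_mono ENNReal.ofReal_ne_top hr)
  have hCt : C₀ * F 2 + C₀ * F q ≠ ⊤ := ENNReal.add_ne_top.2
    ⟨ENNReal.mul_ne_top hC₀ (hFt 2 h2 (by norm_num)), ENNReal.mul_ne_top hC₀ (hFt q hq hq0)⟩
  refine ⟨(C₀ * F 2 + C₀ * F q).toNNReal, fun u => ?_⟩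
  obtain ⟨c, hc⟩ := h u
  have hG : ENNReal.ofReal ((C₀ * F 2 + C₀ * F q).toNNReal * ‖gradL Ω u‖) =
      (C₀ * F 2 + C₀ * F q) * eLpNorm (W12grad u) 2 (volume.restrict Ω) := by
    rw [ENNReal.ofReal_mul NNReal.zero_le_coe, Lp.norm_def,
      ENNReal.ofReal_toReal (Lp.eLpNorm_ne_top _), ENNReal.ofReal_coe_nnreal,
      ENNReal.coe_toNNReal hCt, gradL_apply]
  have hm : AEStronglyMeasurable (fun x => W12fn u x - c) (volume.restrict Ω) :=
    (memLp_W12fn u).aestronglyMeasurable.sub aestronglyMeasurable_const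
  have key : ∀ r ≤ ENNReal.ofReal p, eLpNorm (fun x => W12fn u x - c) r (volume.restrict Ω) ≤
      C₀ * F r * eLpNorm (W12grad u) 2 (volume.restrict Ω) := by
    intro r hr
    refine (eLpNorm_le_eLpNorm_mul_rpow_measure_univ hr hm).trans ?_
    rw [mul_right_comm]
    gcongr
  refine ⟨c, ?_, ?_⟩ <;> rw [hG]
  · refine (key 2 h2).trans ?_
    gcongr
    exact le_self_add
  · refine (key q hq).trans ?_
    gcongr
    exact le_add_self

theorem abs_mul_norm_one_le {u : W12 Ω} {c C : ℝ} (hC : 0 ≤ C)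
    (h : ‖u - c • W12one Ω‖ ≤ C * ‖gradL Ω u‖) : |c| * ‖W12one Ω‖ ≤ (1 + C) * ‖u‖ := by
  have h1 : ‖c • W12one Ω‖ ≤ ‖u‖ + ‖u - c • W12one Ω‖ := by
    have := norm_sub_le u (u - c • W12one Ω)
    rwa [sub_sub_cancel] at this
  rw [norm_smul, Real.norm_eq_abs] at h1
  have h3 := mul_le_mul_of_nonneg_left (norm_gradL_le u) hC
  linarith

/-- Split `u = (u - c) + c`. The first part is controlled by the gradient, and the `L²` estimate
bounds `|c|` by a multiple of `‖u‖`. -/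
theorem eLpNorm_W12fn_le (hΩ0 : volume Ω ≠ 0) {q : ℝ≥0∞} (hq1 : 1 ≤ q) {u : W12 Ω} {c : ℝ}
    {C : ℝ≥0} (hc2 : eLpNorm (fun x => W12fn u x - c) 2 (volume.restrict Ω) ≤
      ENNReal.ofReal (C * ‖gradL Ω u‖))
    (hcq : eLpNorm (fun x => W12fn u x - c) q (volume.restrict Ω) ≤
      ENNReal.ofReal (C * ‖gradL Ω u‖)) :
    eLpNorm (W12fn u) q (volume.restrict Ω) ≤
      ENNReal.ofReal ((C + (C + 2) / ‖W12one Ω‖ *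
        (volume.restrict Ω univ ^ (1 / q.toReal)).toReal) * ‖u‖) := by
  set A : ℝ≥0∞ := volume.restrict Ω univ ^ (1 / q.toReal) with hA
  have hAt : A ≠ ⊤ := ENNReal.rpow_ne_top_of_nonneg (by positivity) (measure_ne_top _ _)
  have hone : 0 < ‖W12one Ω‖ := norm_pos_iff.2 (W12one_ne_zero hΩ0)
  have hcu : |c| ≤ (C + 2) / ‖W12one Ω‖ * ‖u‖ := by
    rw [div_mul_eq_mul_div, le_div_iff₀ hone]
    have := abs_mul_norm_one_le (add_nonneg C.coe_nonneg zero_le_one)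
      (W12_norm_sub_const_le C.coe_nonneg hc2)
    rwa [show 1 + ((C : ℝ) + 1) = C + 2 by ring] at this
  have h1 : W12fn u = (fun x => W12fn u x - c) + fun _ => c := by
    ext x
    simp
  have hm : AEStronglyMeasurable (fun x => W12fn u x - c) (volume.restrict Ω) :=
    (memLp_W12fn u).aestronglyMeasurable.sub aestronglyMeasurable_const
  calc eLpNorm (W12fn u) q (volume.restrict Ω)
      ≤ ENNReal.ofReal (C * ‖gradL Ω u‖) + ‖c‖ₑ * A := by
        rw [h1]
        refine (eLpNorm_add_le hm aestronglyMeasurable_const hq1).trans (add_le_add hcq ?_)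
        rw [eLpNorm_const _ (zero_lt_one.trans_le hq1).ne' (by rwa [Ne, Measure.restrict_eq_zero])]
    _ ≤ ENNReal.ofReal (C * ‖u‖) + ENNReal.ofReal ((C + 2) / ‖W12one Ω‖ * ‖u‖) *
          ENNReal.ofReal A.toReal := by
        rw [ENNReal.ofReal_toReal hAt, Real.enorm_eq_ofReal_abs]
        gcongr
        exact norm_gradL_le u
    _ = _ := by
        rw [← ENNReal.ofReal_mul (by positivity), ← ENNReal.ofReal_add (by positivity)
          (by positivity)]
        congr 1
        ring

/-- The embedding of `W^{1,2}(Ω)` in `L^t(K)`, and Poincaré's inequality. -/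
theorem IsBoundedLipschitzDomain.exists_embedding (hΩ : IsBoundedLipschitzDomain Ω) {K : Set Plane}
    (hK : K ⊆ Ω) {t : ℝ} [Fact (1 ≤ ENNReal.ofReal t)] :
    (∃ ι : W12 Ω →L[ℝ] Lp ℝ (ENNReal.ofReal t) (volume.restrict K),
      ∀ u, (ι u : Plane → ℝ) =ᵐ[volume.restrict K] W12fn u) ∧
    ∃ C : ℝ, ∀ u : W12 Ω, ∃ c : ℝ, ‖u - c • W12one Ω‖ ≤ C * ‖gradL Ω u‖ := by
  have hq1 : 1 ≤ ENNReal.ofReal t := Fact.out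
  have hΩ0 : volume Ω ≠ 0 := (hΩ.isOpen.measure_pos volume hΩ.isConnected.nonempty).ne'
  -- The exponent `max 2 t` lies above both the `2` of the Sobolev norm and the `t` of the data
  -- term.
  obtain ⟨C, hC⟩ := (hΩ.sobolevPoincare (le_max_left 2 t)).exists_eLpNorm_le
    (q := ENNReal.ofReal t) (ENNReal.ofReal_le_ofReal (le_max_right _ _))
    (zero_lt_one.trans_le hq1).ne' (by simp)
  choose c hc2 hcq using hC
  refine ⟨exists_embedding_of_eLpNorm_le hK ?_ fun u =>
    eLpNorm_W12fn_le hΩ0 hq1 (hc2 u) (hcq u), C + 1, fun u => ⟨c u, ?_⟩⟩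
  · positivity
  · exact W12_norm_sub_const_le C.coe_nonneg (hc2 u)

end SobolevSpace

/-! ### Minimisation of convex energies without weak compactness -/

section Minimisation

open Filter Topology

variable {H E L : Type*} [NormedAddCommGroup H] [NormedSpace ℝ H] [NormedAddCommGroup E]
  [NormedSpace ℝ E] [NormedAddCommGroup L] [NormedSpace ℝ L]

/-- If `H` is controlled by `G` up to multiples of `e` and `N e ≠ 0`, then `H` is controlled by
`G` and `N`. -/
theorem exists_norm_le_of_poincare {G : H →L[ℝ] E} {e : H} {C : ℝ}
    (hP : ∀ u, ∃ c : ℝ, ‖u - c • e‖ ≤ C * ‖G u‖) {N : H →L[ℝ] L} (hN : N e ≠ 0) :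
    ∃ C' : ℝ, 0 ≤ C' ∧ ∀ u, ‖u‖ ≤ C' * (‖G u‖ + ‖N u‖) := by
  have hNe : 0 < ‖N e‖ := norm_pos_iff.2 hN
  set B := |C| * (1 + ‖N‖ * (‖e‖ / ‖N e‖)) + ‖e‖ / ‖N e‖ with hB
  refine ⟨B, by positivity, fun u => ?_⟩
  obtain ⟨c, hc⟩ := hP u
  have hc' : ‖u - c • e‖ ≤ |C| * ‖G u‖ :=
    hc.trans (mul_le_mul_of_nonneg_right (le_abs_self C) (norm_nonneg _))
  have h1 : |c| * ‖N e‖ ≤ ‖N u‖ + ‖N‖ * (|C| * ‖G u‖) := by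
    have h2 : c • N e = N u - N (u - c • e) := by
      rw [map_sub, map_smul, sub_sub_cancel]
    rw [← Real.norm_eq_abs, ← norm_smul, h2]
    refine (norm_sub_le _ _).trans (add_le_add_right ((N.le_opNorm _).trans ?_) _)
    exact mul_le_mul_of_nonneg_left hc' (norm_nonneg _)
  have h3 : ‖u‖ ≤ |C| * ‖G u‖ + |c| * ‖e‖ := by
    have h4 : u = (u - c • e) + c • e := by simp
    calc ‖u‖ = ‖(u - c • e) + c • e‖ := by rw [← h4]
      _ ≤ _ := (norm_add_le _ _).trans (add_le_add hc' (by rw [norm_smul, Real.norm_eq_abs]))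
  have h5 : |c| * ‖e‖ ≤ (‖N u‖ + ‖N‖ * (|C| * ‖G u‖)) * (‖e‖ / ‖N e‖) := by
    calc |c| * ‖e‖ = |c| * ‖N e‖ * (‖e‖ / ‖N e‖) := by field_simp
      _ ≤ _ := by gcongr
  have h6 : 0 ≤ |C| * (1 + ‖N‖ * (‖e‖ / ‖N e‖)) * ‖N u‖ := by positivity
  have h7 : 0 ≤ ‖e‖ / ‖N e‖ * ‖G u‖ := by positivity
  calc ‖u‖ ≤ |C| * ‖G u‖ + (‖N u‖ + ‖N‖ * (|C| * ‖G u‖)) * (‖e‖ / ‖N e‖) := by linarith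
    _ ≤ |C| * ‖G u‖ + (‖N u‖ + ‖N‖ * (|C| * ‖G u‖)) * (‖e‖ / ‖N e‖) +
        (|C| * (1 + ‖N‖ * (‖e‖ / ‖N e‖)) * ‖N u‖ + ‖e‖ / ‖N e‖ * ‖G u‖) := by linarith
    _ = B * (‖G u‖ + ‖N u‖) := by rw [hB]; ring

/-- Sequences that are bounded in `L` and whose images under `G` are Cauchy have convergent
subsequences. -/
theorem exists_tendsto_subseq_of_cauchySeq [CompleteSpace H] {G : H →L[ℝ] E} {e : H} {C : ℝ}
    (hP : ∀ u, ∃ c : ℝ, ‖u - c • e‖ ≤ C * ‖G u‖) {ι : H →L[ℝ] L} (hι : ι e ≠ 0) {u : ℕ → H}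
    (hG : CauchySeq fun n => G (u n)) {R : ℝ} (hR : ∀ n, ‖ι (u n)‖ ≤ R) :
    ∃ w, ∃ φ : ℕ → ℕ, StrictMono φ ∧ Tendsto (fun n => u (φ n)) atTop (𝓝 w) := by
  have he : ‖e‖ ≠ 0 := fun h => hι (by rw [norm_eq_zero.1 h, map_zero])
  -- Boundedness in `L` gives no convergent subsequence, but the only freedom left by `G` is the
  -- direction `e`. The scalar functional `m` detects it, and bounded real sequences have convergent
  -- subsequences.
  obtain ⟨m, -, hm⟩ := exists_dual_vector ℝ e he
  have hme : m e ≠ 0 := by rw [hm]; simpa using he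
  obtain ⟨C₁, hC₁, h₁⟩ := exists_norm_le_of_poincare hP hι
  obtain ⟨C₂, hC₂, h₂⟩ := exists_norm_le_of_poincare hP hme
  obtain ⟨R', hR'⟩ := hG.norm_bddAbove
  have hGb : ∀ n, ‖G (u n)‖ ≤ R' := fun n => hR' ⟨n, rfl⟩
  have hmb : ∀ n, m (u n) ∈ Metric.closedBall (0 : ℝ) (‖m‖ * (C₁ * (R' + R))) := by
    intro n
    rw [mem_closedBall_zero_iff]
    refine (m.le_opNorm _).trans (mul_le_mul_of_nonneg_left ((h₁ _).trans ?_) (norm_nonneg _))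
    exact mul_le_mul_of_nonneg_left (add_le_add (hGb n) (hR n)) hC₁
  obtain ⟨a, -, φ, hφ, ha⟩ := tendsto_subseq_of_bounded Metric.isBounded_closedBall hmb
  have hc : CauchySeq fun n => u (φ n) := by
    have hGφ : CauchySeq fun n => G (u (φ n)) := hG.comp_tendsto hφ.tendsto_atTop
    have hmφ := ha.cauchySeq
    rw [Metric.cauchySeq_iff] at hGφ hmφ ⊢
    intro ε hε
    have hε' : 0 < ε / (2 * (C₂ + 1)) := by positivity
    obtain ⟨N₁, hN₁⟩ := hGφ _ hε'
    obtain ⟨N₂, hN₂⟩ := hmφ _ hε'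
    refine ⟨max N₁ N₂, fun i hi j hj => ?_⟩
    have e1 := hN₁ i (le_of_max_le_left hi) j (le_of_max_le_left hj)
    have e2 := hN₂ i (le_of_max_le_right hi) j (le_of_max_le_right hj)
    rw [dist_eq_norm, ← map_sub] at e1
    have e2' : ‖m (u (φ i) - u (φ j))‖ < ε / (2 * (C₂ + 1)) := by
      rw [map_sub, ← dist_eq_norm]
      exact e2
    rw [dist_eq_norm]
    calc ‖u (φ i) - u (φ j)‖ ≤ C₂ * (‖G (u (φ i) - u (φ j))‖ + ‖m (u (φ i) - u (φ j))‖) := h₂ _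
      _ ≤ C₂ * (ε / (2 * (C₂ + 1)) + ε / (2 * (C₂ + 1))) := by gcongr
      _ = ε * (C₂ / (C₂ + 1)) := by field_simp; ring
      _ < ε * 1 := by
          gcongr
          rw [div_lt_one (by positivity)]
          linarith
      _ = ε := mul_one ε
  obtain ⟨w, hw⟩ := cauchySeq_tendsto_of_complete hc
  exact ⟨w, φ, hφ, hw⟩

/-- The energy `½ B(Gu, Gu) + Ψ(ιu)`. -/
noncomputable def energy (G : H →L[ℝ] E) (ι : H →L[ℝ] L) (Ψ : L → ℝ) (B : E →L[ℝ] E →L[ℝ] ℝ)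
    (u : H) : ℝ :=
  B (G u) (G u) / 2 + Ψ (ι u)

variable {G : H →L[ℝ] E} {ι : H →L[ℝ] L} {Ψ : L → ℝ} {B : E →L[ℝ] E →L[ℝ] ℝ}

theorem continuous_energy (hΨc : Continuous Ψ) : Continuous (energy G ι Ψ B) := by
  unfold energy
  have h1 : Continuous fun u => B (G u) (G u) :=
    (B.continuous.comp G.continuous).clm_apply G.continuous
  fun_prop

/-- The parallelogram identity for the quadratic part. It gives the exact convexity deficit at the
midpoint, the source of both the Cauchy property and uniqueness. -/
theorem energy_midpoint (u v : H) : B (G (u - v)) (G (u - v)) / 8 +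
      (Ψ (ι u) / 2 + Ψ (ι v) / 2 - Ψ ((1 / 2 : ℝ) • (ι u + ι v))) +
      energy G ι Ψ B ((1 / 2 : ℝ) • (u + v)) =
    energy G ι Ψ B u / 2 + energy G ι Ψ B v / 2 := by
  simp only [energy, map_sub, map_add, map_smul, sub_apply,
    add_apply, smul_apply, smul_eq_mul]
  ring

/-- Well-posedness of the minimisation of the energy: there is a minimiser, and almost minimisers
are close to it. -/
theorem exists_wellPosed_minimizer [CompleteSpace H] {e : H} {C : ℝ}
    (hP : ∀ u, ∃ c : ℝ, ‖u - c • e‖ ≤ C * ‖G u‖) (hι : ι e ≠ 0) (hΨc : Continuous Ψ)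
    (hΨ0 : ∀ y, 0 ≤ Ψ y)
    (hΨb : ∀ M, ∃ R, ∀ y, Ψ y ≤ M → ‖y‖ ≤ R)
    (hΨs : ∀ y z, y ≠ z → Ψ ((1 / 2 : ℝ) • (y + z)) < Ψ y / 2 + Ψ z / 2)
    {a : ℝ} (ha : 0 < a) (hB : ∀ x, a * ‖x‖ ^ 2 ≤ B x x) :
    ∃ w, (∀ u, energy G ι Ψ B w ≤ energy G ι Ψ B u) ∧
      ∀ ε > 0, ∃ δ > 0, ∀ u, energy G ι Ψ B u ≤ energy G ι Ψ B w + δ → ‖u - w‖ < ε := by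
  set J := energy G ι Ψ B with hJ
  have hJc : Continuous J := continuous_energy hΨc
  have hB0 : ∀ x, 0 ≤ B x x := fun x => le_trans (by positivity) (hB x)
  have hΨJ : ∀ u, Ψ (ι u) ≤ J u := fun u => by
    have := hB0 (G u)
    simp only [hJ, energy]
    linarith
  have hΨm : ∀ y z, Ψ ((1 / 2 : ℝ) • (y + z)) ≤ Ψ y / 2 + Ψ z / 2 := by
    intro y z
    by_cases h : y = z
    · subst h
      rw [← two_smul ℝ y, smul_smul]
      norm_num
    · exact (hΨs y z h).le
  have hbdd : BddBelow (range J) := ⟨0, by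
    rintro _ ⟨u, rfl⟩
    exact (hΨ0 _).trans (hΨJ u)⟩
  set m := sInf (range J) with hm
  have hmle : ∀ u, m ≤ J u := fun u => csInf_le hbdd ⟨u, rfl⟩
  have hgap : ∀ u v, a / 8 * ‖G (u - v)‖ ^ 2 ≤ (J u - m) / 2 + (J v - m) / 2 := by
    intro u v
    have h1 := energy_midpoint (G := G) (ι := ι) (Ψ := Ψ) (B := B) u v
    have h2 := hB (G (u - v))
    have h3 := hΨm (ι u) (ι v)
    have h4 := hmle ((1 / 2 : ℝ) • (u + v))
    simp only [← hJ] at h1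
    linarith
  -- Minimising sequences converge strongly along a subsequence: `hgap` makes their gradients
  -- Cauchy, and the bound on `Ψ` bounds their images in `L`.
  have hsub : ∀ u : ℕ → H, Tendsto (fun n => J (u n)) atTop (𝓝 m) →
      ∃ w, ∃ φ : ℕ → ℕ, StrictMono φ ∧ Tendsto (fun n => u (φ n)) atTop (𝓝 w) ∧ J w = m := by
    intro u hu
    have hcau : CauchySeq fun n => G (u n) := by
      rw [Metric.cauchySeq_iff]
      intro ε hε
      have hε' : 0 < a / 8 * ε ^ 2 := by positivity
      have hev := hu.eventually (gt_mem_nhds (show m < m + a / 8 * ε ^ 2 by linarith))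
      obtain ⟨N, hN⟩ := eventually_atTop.1 hev
      refine ⟨N, fun i hi j hj => ?_⟩
      have h1 := hN i hi
      have h2 := hN j hj
      have h3 := hgap (u i) (u j)
      rw [dist_eq_norm, ← map_sub]
      refine lt_of_pow_lt_pow_left₀ 2 hε.le ?_
      have h4 : a / 8 * ‖G (u i - u j)‖ ^ 2 < a / 8 * ε ^ 2 := by linarith
      exact lt_of_mul_lt_mul_left h4 (by positivity)
    obtain ⟨M, hM⟩ := hu.bddAbove_range
    obtain ⟨R, hR⟩ := hΨb M
    obtain ⟨w, φ, hφ, hw⟩ := exists_tendsto_subseq_of_cauchySeq hP hι hcau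
      fun n => hR _ ((hΨJ _).trans (hM ⟨n, rfl⟩))
    exact ⟨w, φ, hφ, hw, tendsto_nhds_unique ((hJc.tendsto w).comp hw)
      (hu.comp hφ.tendsto_atTop)⟩
  obtain ⟨v, hv, hvlim, hvmem⟩ := exists_seq_tendsto_sInf (range_nonempty J) hbdd
  choose u hu using hvmem
  have hulim : Tendsto (fun n => J (u n)) atTop (𝓝 m) := by
    simp only [hu]
    exact hvlim
  obtain ⟨w, -, -, -, hw⟩ := hsub u hulim
  -- Two minimisers have the same `G` by the gap and the same `ι` by strict convexity of `Ψ`;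
  -- together these determine the point.
  have huniq : ∀ w', J w' = m → w' = w := by
    intro w' hw'
    have h1 := hgap w' w
    rw [hw, hw', sub_self, zero_div, add_zero] at h1
    have h2 : ‖G (w' - w)‖ = 0 := by
      have : ‖G (w' - w)‖ ^ 2 ≤ 0 := by
        by_contra! hcon
        have : 0 < a / 8 * ‖G (w' - w)‖ ^ 2 := by positivity
        linarith
      exact pow_eq_zero_iff two_ne_zero |>.1 (le_antisymm this (sq_nonneg _))
    have h3 : ι w' = ι w := by
      by_contra hne
      have h4 := hΨs _ _ hne
      have h5 := energy_midpoint (G := G) (ι := ι) (Ψ := Ψ) (B := B) w' w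
      have h6 := hmle ((1 / 2 : ℝ) • (w' + w))
      simp only [← hJ, hw, hw'] at h5
      have h7 := hB0 (G (w' - w))
      linarith
    obtain ⟨C', -, hC'⟩ := exists_norm_le_of_poincare hP hι
    have h4 := hC' (w' - w)
    rw [h2, map_sub ι, h3, sub_self, norm_zero, add_zero, mul_zero] at h4
    exact sub_eq_zero.1 (norm_le_zero_iff.1 h4)
  refine ⟨w, fun u => hw ▸ hmle u, fun ε hε => ?_⟩
  -- A counterexample would be a minimising sequence staying `ε` away from `w`, whereas a
  -- subsequence converges to the unique minimiser.
  by_contra! hcon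
  choose x hxJ hx using fun n : ℕ => hcon (1 / (n + 1 : ℝ)) (by positivity)
  have hxlim : Tendsto (fun n => J (x n)) atTop (𝓝 m) := by
    refine tendsto_of_tendsto_of_tendsto_of_le_of_le tendsto_const_nhds ?_
      (fun n => hmle (x n)) hxJ
    rw [hw]
    simpa using tendsto_one_div_add_atTop_nhds_zero_nat.const_add m
  obtain ⟨w', φ, -, hlim, hw'⟩ := hsub x hxlim
  rw [huniq w' hw'] at hlim
  have h1 : Tendsto (fun n => ‖x (φ n) - w‖) atTop (𝓝 0) := by
    simpa using (hlim.sub_const w).norm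
  exact absurd (ge_of_tendsto' h1 fun n => hx (φ n)) (not_le.2 hε)

/-- The minimiser of the energy depends continuously on the quadratic part. -/
theorem exists_continuous_minimizer [CompleteSpace H] {e : H} {C : ℝ}
    (hP : ∀ u, ∃ c : ℝ, ‖u - c • e‖ ≤ C * ‖G u‖) (hι : ι e ≠ 0) (hΨc : Continuous Ψ)
    (hΨ0 : ∀ y, 0 ≤ Ψ y)
    (hΨb : ∀ M, ∃ R, ∀ y, Ψ y ≤ M → ‖y‖ ≤ R)
    (hΨs : ∀ y z, y ≠ z → Ψ ((1 / 2 : ℝ) • (y + z)) < Ψ y / 2 + Ψ z / 2)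
    {X : Type*} [TopologicalSpace X] {B : X → E →L[ℝ] E →L[ℝ] ℝ}
    (hBc : ∀ x, ∀ η > 0, ∀ᶠ y in 𝓝 x, ∀ v, |B y v v - B x v v| ≤ η * ‖v‖ ^ 2)
    (hB : ∀ x, ∃ a > 0, ∀ y, a * ‖y‖ ^ 2 ≤ B x y y) :
    ∃ S : X → H, Continuous S ∧ ∀ x u, energy G ι Ψ (B x) (S x) ≤ energy G ι Ψ (B x) u := by
  choose a ha hBa using hB
  choose S hS hwp using fun x => exists_wellPosed_minimizer hP hι hΨc hΨ0 hΨb hΨs (ha x) (hBa x)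
  refine ⟨S, continuous_iff_continuousAt.2 fun x => ?_, hS⟩
  rw [Metric.continuousAt_iff']
  intro ε hε
  obtain ⟨δ, hδ, h⟩ := hwp x ε hε
  set M : ℝ := ‖G (S x)‖ ^ 2 + 4 / a x * Ψ 0 with hM
  have hM0 : 0 ≤ M := by
    have := ha x
    have := hΨ0 0
    positivity
  -- The first bound keeps `B y` elliptic with constant `a x / 2`, so comparison with `0` bounds `G
  -- (S y)` independently of `y`. The second makes the change of the energies at `S x` and `S y` at
  -- most `δ`, so that `S y` is an almost minimiser for `B x`.
  have hη : 0 < min (a x / 2) (δ / (M + 1)) := by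
    have := ha x
    positivity
  filter_upwards [hBc x _ hη] with y hdiff
  rw [dist_eq_norm]
  refine h _ ?_
  have hGy : ‖G (S y)‖ ^ 2 ≤ 4 / a x * Ψ 0 := by
    have h1 := hS y 0
    simp only [energy, map_zero, zero_div, zero_add] at h1
    have h2 := hΨ0 (ι (S y))
    have h3 := (abs_le.1 (hdiff (G (S y)))).1
    have h4 := hBa x (G (S y))
    have h5 : min (a x / 2) (δ / (M + 1)) * ‖G (S y)‖ ^ 2 ≤ a x / 2 * ‖G (S y)‖ ^ 2 := by
      gcongr
      exact min_le_left _ _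
    rw [div_mul_eq_mul_div, le_div_iff₀ (ha x)]
    linarith
  have h1 := hS y (S x)
  have h2 := (abs_le.1 (hdiff (G (S y)))).1
  have h3 := (abs_le.1 (hdiff (G (S x)))).2
  have h4 : min (a x / 2) (δ / (M + 1)) * (‖G (S y)‖ ^ 2 + ‖G (S x)‖ ^ 2) ≤ δ := by
    calc min (a x / 2) (δ / (M + 1)) * (‖G (S y)‖ ^ 2 + ‖G (S x)‖ ^ 2) ≤ δ / (M + 1) * M := by
          gcongr
          · exact min_le_right _ _
          · rw [hM]
            linarith
      _ = δ * (M / (M + 1)) := by ring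
      _ ≤ δ * 1 := by
          gcongr
          rw [div_le_one (by positivity)]
          linarith
      _ = δ := mul_one δ
  simp only [energy] at h1 ⊢
  have h5 : 0 ≤ min (a x / 2) (δ / (M + 1)) * (‖G (S y)‖ ^ 2 + ‖G (S x)‖ ^ 2) := by positivity
  linarith

end Minimisation

/-! ### Quadratic forms of tensor fields -/

section TensorForm

open Filter Topology

variable {Ω : Set Plane}

theorem abs_mulVec_dotProduct_le {T : Matrix (Fin 2) (Fin 2) ℝ} {M : ℝ}
    (hT : ∀ i j, |T i j| ≤ M) (v w : Plane) :
    |(T *ᵥ v.ofLp) ⬝ᵥ w.ofLp| ≤ 4 * M * (‖v‖ * ‖w‖) := by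
  have hv : ∀ i, |v i| ≤ ‖v‖ := fun i => PiLp.norm_apply_le v i
  have hw : ∀ i, |w i| ≤ ‖w‖ := fun i => PiLp.norm_apply_le w i
  have hM : 0 ≤ M := (abs_nonneg _).trans (hT 0 0)
  have key : ∀ i j, |T i j * v j * w i| ≤ M * (‖v‖ * ‖w‖) := by
    intro i j
    rw [abs_mul, abs_mul, ← mul_assoc]
    gcongr
    · exact hT i j
    · exact hv j
    · exact hw i
  have hsum : (T *ᵥ v.ofLp) ⬝ᵥ w.ofLp = ∑ i, ∑ j, T i j * v j * w i := by
    simp only [dotProduct, Matrix.mulVec, Finset.sum_mul]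
  rw [hsum]
  calc |∑ i, ∑ j, T i j * v j * w i| ≤ ∑ i : Fin 2, ∑ j : Fin 2, M * (‖v‖ * ‖w‖) :=
        (Finset.abs_sum_le_sum_abs _ _).trans (Finset.sum_le_sum fun i _ =>
          (Finset.abs_sum_le_sum_abs _ _).trans (Finset.sum_le_sum fun j _ => key i j))
    _ = _ := by
        simp only [Fin.sum_univ_two]
        ring

theorem integral_norm_mul_norm_le {X F : Type*} [MeasurableSpace X] {μ : Measure X}
    [NormedAddCommGroup F] (g h : Lp F 2 μ) :
    Integrable (fun x => ‖g x‖ * ‖h x‖) μ ∧ ∫ x, ‖g x‖ * ‖h x‖ ∂μ ≤ ‖g‖ * ‖h‖ := by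
  have hg := (Lp.memLp g).norm
  have hh := (Lp.memLp h).norm
  refine ⟨hg.integrable_mul hh, ?_⟩
  have h1 : ∫ x, ‖g x‖ * ‖h x‖ ∂μ = inner ℝ (hh.toLp _) (hg.toLp _) := by
    rw [L2.inner_def]
    refine integral_congr_ae ?_
    filter_upwards [hg.coeFn_toLp, hh.coeFn_toLp] with x h1 h2
    rw [h1, h2]
    simp
  rw [h1]
  refine (real_inner_le_norm _ _).trans (le_of_eq ?_)
  rw [Lp.norm_toLp, Lp.norm_toLp, eLpNorm_norm, eLpNorm_norm, mul_comm]
  rfl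

variable {T : Plane → Matrix (Fin 2) (Fin 2) ℝ} {M : ℝ}

theorem integrable_mulVec_dotProduct
    (hTm : ∀ i j, AEStronglyMeasurable (fun x => T x i j) (volume.restrict Ω))
    (hTb : ∀ᵐ x ∂(volume.restrict Ω), ∀ i j, |T x i j| ≤ M)
    (g h : Lp Plane 2 (volume.restrict Ω)) :
    Integrable (fun x => (T x *ᵥ (g x).ofLp) ⬝ᵥ (h x).ofLp) (volume.restrict Ω) := by
  have hm : AEStronglyMeasurable (fun x => (T x *ᵥ (g x).ofLp) ⬝ᵥ (h x).ofLp)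
      (volume.restrict Ω) := by
    have hsum : (fun x => (T x *ᵥ (g x).ofLp) ⬝ᵥ (h x).ofLp) =
        fun x => ∑ i, ∑ j, T x i j * g x j * h x i := by
      ext x
      simp only [dotProduct, Matrix.mulVec, Finset.sum_mul]
    rw [hsum]
    refine Finset.aestronglyMeasurable_fun_sum _ fun i _ =>
      Finset.aestronglyMeasurable_fun_sum _ fun j _ => ?_
    exact ((hTm i j).mul (memLp_component g j).aestronglyMeasurable).mul
      (memLp_component h i).aestronglyMeasurable
  refine ((integral_norm_mul_norm_le g h).1.const_mul (4 * M)).mono' hm ?_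
  filter_upwards [hTb] with x hx
  exact abs_mulVec_dotProduct_le hx _ _

theorem abs_integral_mulVec_dotProduct_le (hTb : ∀ᵐ x ∂(volume.restrict Ω), ∀ i j, |T x i j| ≤ M)
    (hM : 0 ≤ M) (g h : Lp Plane 2 (volume.restrict Ω)) :
    |∫ x in Ω, (T x *ᵥ (g x).ofLp) ⬝ᵥ (h x).ofLp| ≤ 4 * M * ‖g‖ * ‖h‖ := by
  obtain ⟨hi, hle⟩ := integral_norm_mul_norm_le g h
  rw [← Real.norm_eq_abs]
  refine (norm_integral_le_of_norm_le (hi.const_mul (4 * M)) ?_).trans ?_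
  · filter_upwards [hTb] with x hx
    exact abs_mulVec_dotProduct_le hx _ _
  · rw [integral_const_mul, mul_assoc (4 * M)]
    exact mul_le_mul_of_nonneg_left hle (by positivity)

theorem exists_tensorForm
    (hTm : ∀ i j, AEStronglyMeasurable (fun x => T x i j) (volume.restrict Ω))
    (hTb : ∀ᵐ x ∂(volume.restrict Ω), ∀ i j, |T x i j| ≤ M) (hM : 0 ≤ M) :
    ∃ B : Lp Plane 2 (volume.restrict Ω) →L[ℝ] Lp Plane 2 (volume.restrict Ω) →L[ℝ] ℝ,
      ∀ g h, B g h = ∫ x in Ω, (T x *ᵥ (g x).ofLp) ⬝ᵥ (h x).ofLp := by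
  have hint := integrable_mulVec_dotProduct hTm hTb
  let f : Lp Plane 2 (volume.restrict Ω) →ₗ[ℝ] Lp Plane 2 (volume.restrict Ω) →ₗ[ℝ] ℝ :=
    LinearMap.mk₂ ℝ (fun g h => ∫ x in Ω, (T x *ᵥ (g x).ofLp) ⬝ᵥ (h x).ofLp)
      (fun g g' h => by
        rw [← integral_add (hint g h) (hint g' h)]
        refine integral_congr_ae ?_
        filter_upwards [Lp.coeFn_add g g'] with x hx
        rw [hx, Pi.add_apply, WithLp.ofLp_add, Matrix.mulVec_add, add_dotProduct])
      (fun c g h => by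
        rw [smul_eq_mul, ← integral_const_mul]
        refine integral_congr_ae ?_
        filter_upwards [Lp.coeFn_smul c g] with x hx
        rw [hx, Pi.smul_apply, WithLp.ofLp_smul, Matrix.mulVec_smul, smul_dotProduct, smul_eq_mul])
      (fun g h h' => by
        rw [← integral_add (hint g h) (hint g h')]
        refine integral_congr_ae ?_
        filter_upwards [Lp.coeFn_add h h'] with x hx
        rw [hx, Pi.add_apply, WithLp.ofLp_add, dotProduct_add])
      (fun c g h => by
        rw [smul_eq_mul, ← integral_const_mul]
        refine integral_congr_ae ?_
        filter_upwards [Lp.coeFn_smul c h] with x hx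
        rw [hx, Pi.smul_apply, WithLp.ofLp_smul, dotProduct_smul, smul_eq_mul])
  exact ⟨f.mkContinuous₂ (4 * M) fun g h => abs_integral_mulVec_dotProduct_le hTb hM g h,
    fun g h => rfl⟩

theorem tensorAt_of_mem (A : C(closure Ω, SPD)) {x : Plane} (hx : x ∈ closure Ω) :
    tensorAt A x = (A ⟨x, hx⟩).1 := by
  simp [tensorAt, hx]

theorem continuous_SPD_entry (i j : Fin 2) : Continuous fun P : SPD => P.1 i j :=
  continuous_subtype_val.matrix_elem i j

theorem aestronglyMeasurable_tensorAt (hΩ : MeasurableSet Ω) (A : C(closure Ω, SPD))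
    (i j : Fin 2) : AEStronglyMeasurable (fun x => tensorAt A x i j) (volume.restrict Ω) := by
  have hc : ContinuousOn (fun x => tensorAt A x i j) (closure Ω) := by
    have h : Continuous fun x : closure Ω => (A x).1 i j := (continuous_SPD_entry i j).comp A.2
    refine continuousOn_iff_continuous_domRestrict.2 (h.congr fun x => ?_)
    rw [← tensorAt_of_mem A x.2]
    rfl
  exact (hc.mono subset_closure).aestronglyMeasurable hΩ

/-- Composition with a matrix entry is continuous into `C(closure Ω, ℝ)`, whose topology is given by
the supremum distance. -/
theorem eventually_abs_tensorAt_sub_le [CompactSpace (closure Ω)] (A₀ : C(closure Ω, SPD)) {η : ℝ}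
    (hη : 0 < η) : ∀ᶠ A in 𝓝 A₀, ∀ x ∈ Ω, ∀ i j,
      |(tensorAt A x - tensorAt A₀ x) i j| ≤ η := by
  have hent : ∀ i j : Fin 2, ∀ᶠ A in 𝓝 A₀, ∀ x ∈ Ω, |(tensorAt A x - tensorAt A₀ x) i j| ≤ η := by
    intro i j
    let c : C(SPD, ℝ) := ⟨fun P => P.1 i j, continuous_SPD_entry i j⟩
    have hc := (ContinuousMap.continuous_postcomp (X := closure Ω) c).tendsto A₀
    filter_upwards [hc.eventually (Metric.ball_mem_nhds _ hη)] with A hA x hx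
    have h1 := (ContinuousMap.dist_apply_le_dist (f := c.comp A) (g := c.comp A₀)
      ⟨x, subset_closure hx⟩).trans (le_of_lt hA)
    rw [tensorAt_of_mem A (subset_closure hx), tensorAt_of_mem A₀ (subset_closure hx)]
    exact h1
  have h2 := eventually_all.2 fun i => eventually_all.2 fun j => hent i j
  filter_upwards [h2] with A hA x hx i j
  exact hA i j x hx

theorem exists_abs_tensorAt_le [CompactSpace (closure Ω)] (A : C(closure Ω, SPD)) :
    ∃ M, 0 ≤ M ∧ ∀ x ∈ Ω, ∀ i j, |tensorAt A x i j| ≤ M := by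
  have hent : ∀ i j : Fin 2, ∃ M, ∀ x ∈ Ω, |tensorAt A x i j| ≤ M := by
    intro i j
    let c : C(SPD, ℝ) := ⟨fun P => P.1 i j, continuous_SPD_entry i j⟩
    refine ⟨‖c.comp A‖, fun x hx => ?_⟩
    rw [tensorAt_of_mem A (subset_closure hx)]
    exact (c.comp A).norm_coe_le_norm ⟨x, subset_closure hx⟩
  choose M hM using hent
  refine ⟨∑ i, ∑ j, |M i j|, by positivity, fun x hx i j => (hM i j x hx).trans ?_⟩
  refine (le_abs_self _).trans ?_
  refine (Finset.single_le_sum (f := fun j => |M i j|) (fun _ _ => abs_nonneg _)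
    (Finset.mem_univ j)).trans ?_
  exact Finset.single_le_sum (f := fun i => ∑ j, |M i j|)
    (fun _ _ => Finset.sum_nonneg fun _ _ => abs_nonneg _) (Finset.mem_univ i)

/-- The constant is the minimum of the quadratic form over the compact set `closure Ω` times the
unit circle, where it is positive. -/
theorem exists_elliptic [CompactSpace (closure Ω)] (A : C(closure Ω, SPD)) :
    ∃ a > 0, ∀ x ∈ Ω, ∀ v : Plane, a * ‖v‖ ^ 2 ≤ (tensorAt A x *ᵥ v.ofLp) ⬝ᵥ v.ofLp := by
  rcases isEmpty_or_nonempty (closure Ω) with hempty | hne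
  · exact ⟨1, one_pos, fun x hx => (hempty.false ⟨x, subset_closure hx⟩).elim⟩
  let Q : closure Ω × Plane → ℝ := fun p => ((A p.1).1 *ᵥ p.2.ofLp) ⬝ᵥ p.2.ofLp
  have hQ : Continuous Q := by
    have hsum : Q = fun p => ∑ i, ∑ j, (A p.1).1 i j * p.2 j * p.2 i := by
      ext p
      simp only [Q, dotProduct, Matrix.mulVec, Finset.sum_mul]
    rw [hsum]
    refine continuous_finsetSum _ fun i _ => continuous_finsetSum _ fun j _ => ?_
    have h1 : Continuous fun p : closure Ω × Plane => (A p.1).1 i j :=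
      (continuous_SPD_entry i j).comp (A.continuous.comp continuous_fst)
    have h2 : ∀ i : Fin 2, Continuous fun p : closure Ω × Plane => p.2 i := fun i =>
      (EuclideanSpace.proj (𝕜 := ℝ) i : Plane →L[ℝ] ℝ).continuous.comp continuous_snd
    exact (h1.mul (h2 j)).mul (h2 i)
  have hK : IsCompact ((univ : Set (closure Ω)) ×ˢ Metric.sphere (0 : Plane) 1) :=
    isCompact_univ.prod (isCompact_sphere _ _)
  obtain ⟨x₀⟩ := hne
  obtain ⟨p, hp, hmin⟩ := hK.exists_isMinOn
    ⟨(x₀, EuclideanSpace.single 0 1), mem_univ _, by simp⟩ hQ.continuousOn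
  refine ⟨Q p, ?_, fun x hx v => ?_⟩
  · have hne0 : p.2.ofLp ≠ 0 := by
      intro h
      have h1 : p.2 = 0 := by
        ext i
        exact congrFun h i
      have h2 : ‖p.2‖ = 1 := by simpa using hp.2
      rw [h1, norm_zero] at h2
      exact zero_ne_one h2
    have := (A p.1).2.dotProduct_mulVec_pos hne0
    rwa [dotProduct_comm, star_trivial] at this
  · rw [tensorAt_of_mem A (subset_closure hx)]
    by_cases hv : v = 0
    · simp [hv]
    have hv' : 0 < ‖v‖ := norm_pos_iff.2 hv
    have h1 : Q p ≤ Q (⟨x, subset_closure hx⟩, ‖v‖⁻¹ • v) :=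
      hmin ⟨mem_univ _, by simp [norm_smul, hv'.ne']⟩
    have h2 : Q (⟨x, subset_closure hx⟩, ‖v‖⁻¹ • v) * ‖v‖ ^ 2 =
        ((A ⟨x, subset_closure hx⟩).1 *ᵥ v.ofLp) ⬝ᵥ v.ofLp := by
      simp only [Q, WithLp.ofLp_smul, Matrix.mulVec_smul, smul_dotProduct, dotProduct_smul,
        smul_eq_mul]
      field_simp
    rw [← h2]
    gcongr

theorem mulVec_dotProduct_comm (A : SPD) (v w : Fin 2 → ℝ) :
    (A.1 *ᵥ v) ⬝ᵥ w = (A.1 *ᵥ w) ⬝ᵥ v := by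
  have hs : A.1ᵀ = A.1 := by
    have := A.2.isHermitian.eq
    rwa [Matrix.conjTranspose_eq_transpose_of_trivial] at this
  rw [dotProduct_comm, Matrix.dotProduct_mulVec, ← Matrix.mulVec_transpose, hs]

/-- The quadratic forms of a continuous family of positive definite tensor fields. -/
theorem exists_tensorForms (hΩ : IsBoundedLipschitzDomain Ω) :
    ∃ B : C(closure Ω, SPD) →
        Lp Plane 2 (volume.restrict Ω) →L[ℝ] Lp Plane 2 (volume.restrict Ω) →L[ℝ] ℝ,
      (∀ A (g h : Lp Plane 2 (volume.restrict Ω)), B A g h =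
        ∫ x in Ω, (tensorAt A x *ᵥ (g x).ofLp) ⬝ᵥ (h x).ofLp) ∧
      (∀ (A : C(closure Ω, SPD)) (g h : Lp Plane 2 (volume.restrict Ω)),
        Integrable (fun x => (tensorAt A x *ᵥ (g x).ofLp) ⬝ᵥ (h x).ofLp)
          (volume.restrict Ω)) ∧
      (∀ A g h, B A g h = B A h g) ∧
      (∀ A, ∃ a > 0, ∀ g, a * ‖g‖ ^ 2 ≤ B A g g) ∧
      ∀ A₀, ∀ η > 0, ∀ᶠ A in 𝓝 A₀, ∀ g, |B A g g - B A₀ g g| ≤ η * ‖g‖ ^ 2 := by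
  have : CompactSpace (closure Ω) := isCompact_iff_compactSpace.1 hΩ.isBounded.isCompact_closure
  have hm := hΩ.isOpen.measurableSet
  choose M hM0 hM using exists_abs_tensorAt_le (Ω := Ω)
  have hMae : ∀ A : C(closure Ω, SPD), ∀ᵐ x ∂(volume.restrict Ω), ∀ i j, |tensorAt A x i j| ≤ M A :=
    fun A => (ae_restrict_iff' hm).2 (Eventually.of_forall (hM A))
  choose B hB using fun A : C(closure Ω, SPD) => exists_tensorForm
    (aestronglyMeasurable_tensorAt hm A) (hMae A) (hM0 A)
  have hint := fun A : C(closure Ω, SPD) => integrable_mulVec_dotProduct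
    (aestronglyMeasurable_tensorAt hm A) (hMae A)
  refine ⟨B, hB, hint, fun A g h => ?_, fun A => ?_, fun A₀ η hη => ?_⟩
  · rw [hB, hB]
    refine setIntegral_congr_fun hm fun x hx => ?_
    simp only [tensorAt_of_mem A (subset_closure hx)]
    exact mulVec_dotProduct_comm _ _ _
  · obtain ⟨a, ha, hell⟩ := exists_elliptic A
    refine ⟨a, ha, fun g => ?_⟩
    have h1 : ‖g‖ ^ 2 = ∫ x in Ω, ‖g x‖ ^ 2 := by
      rw [← real_inner_self_eq_norm_sq, L2.inner_def]
      simp only [real_inner_self_eq_norm_sq]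
    have h2 : Integrable (fun x => ‖g x‖ ^ 2) (volume.restrict Ω) := by
      simpa only [pow_two] using (integral_norm_mul_norm_le g g).1
    rw [hB, h1, ← integral_const_mul]
    refine integral_mono_ae (h2.const_mul a) (hint A g g) ?_
    exact (ae_restrict_iff' hm).2 (Eventually.of_forall fun x hx => hell x hx (g x))
  -- The `4` offsets the number of matrix entries in `abs_integral_mulVec_dotProduct_le`.
  · filter_upwards [eventually_abs_tensorAt_sub_le A₀ (show 0 < η / 4 by positivity)] with A hA g
    have h1 : B A g g - B A₀ g g =
        ∫ x in Ω, ((tensorAt A x - tensorAt A₀ x) *ᵥ (g x).ofLp) ⬝ᵥ (g x).ofLp := by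
      rw [hB, hB, ← integral_sub (hint A g g) (hint A₀ g g)]
      simp only [Matrix.sub_mulVec, sub_dotProduct]
    rw [h1]
    refine (abs_integral_mulVec_dotProduct_le
      (T := fun x => tensorAt A x - tensorAt A₀ x)
      ((ae_restrict_iff' hm).2 (Eventually.of_forall hA)) (by positivity) g g).trans
      (le_of_eq ?_)
    ring

end TensorForm

/-! ### The fidelity term: strict convexity, coercivity, derivative -/

section PowerTerm

open Filter Topology

/-- For `|a| ≠ |b|` this is strict convexity of the power on the half-line. For `|a| = |b|` one has
`a = -b ≠ 0`, and the left side vanishes. -/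
theorem abs_rpow_midpoint_lt {t : ℝ} (ht : 1 < t) {a b : ℝ} (hab : a ≠ b) :
    |(1 / 2 : ℝ) * (a + b)| ^ t < |a| ^ t / 2 + |b| ^ t / 2 := by
  have ht0 : 0 < t := by linarith
  by_cases h : |a| = |b|
  · rcases abs_eq_abs.1 h with h' | h'
    · exact absurd h' hab
    · have hb : b ≠ 0 := by
        rintro rfl
        exact hab (by simpa using h')
      rw [h', neg_add_cancel, mul_zero, abs_zero, Real.zero_rpow ht0.ne', abs_neg]
      have : 0 < |b| ^ t := Real.rpow_pos_of_pos (abs_pos.2 hb) t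
      linarith
  · have h1 := (strictConvexOn_rpow ht).2 (mem_Ici.2 (abs_nonneg a)) (mem_Ici.2 (abs_nonneg b)) h
      (show (0 : ℝ) < 1 / 2 by norm_num) (show (0 : ℝ) < 1 / 2 by norm_num) (by norm_num)
    simp only [smul_eq_mul] at h1
    refine lt_of_le_of_lt (Real.rpow_le_rpow (abs_nonneg _) ?_ ht0.le) (h1.trans_eq (by ring))
    rw [abs_mul, abs_of_pos (show (0 : ℝ) < 1 / 2 by norm_num), ← mul_add]
    gcongr
    exact abs_add_le a b

variable {X : Type*} [MeasurableSpace X] {μ : Measure X} {t : ℝ}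

theorem MeasureTheory.MemLp.integrable_abs_rpow (ht : 1 < t) {v : X → ℝ}
    (hv : MemLp v (ENNReal.ofReal t) μ) : Integrable (fun x => |v x| ^ t) μ := by
  have ht0 : 0 < t := by linarith
  have := hv.integrable_norm_rpow (by simpa using ht0) ENNReal.ofReal_ne_top
  simpa [ENNReal.toReal_ofReal ht0.le] using this

/-- At `a = 0` both sides vanish whatever value `0 ^ (t - 2)` takes, because `t > 1`. -/
theorem abs_rpow_sub_two_mul_self (ht : 1 < t) (a : ℝ) : |a| ^ (t - 2) * |a| = |a| ^ (t - 1) := by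
  rcases eq_or_ne a 0 with rfl | ha
  · rw [abs_zero, mul_zero, Real.zero_rpow (by linarith)]
  · rw [← Real.rpow_add_one (abs_pos.2 ha).ne']
    congr 1
    ring

/-- Differentiation under the integral: for `|s| < 1` the derivative of the integrand is dominated
by the integrable `t * (|U| + |Φ|) ^ t`. -/
theorem hasDerivAt_integral_abs_rpow (ht : 1 < t) {U Φ : X → ℝ}
    (hU : MemLp U (ENNReal.ofReal t) μ) (hΦ : MemLp Φ (ENNReal.ofReal t) μ) :
    Integrable (fun x => t * |U x| ^ (t - 2) * U x * Φ x) μ ∧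
      HasDerivAt (fun s : ℝ => ∫ x, |U x + s * Φ x| ^ t ∂μ)
        (∫ x, t * |U x| ^ (t - 2) * U x * Φ x ∂μ) 0 := by
  have ht0 : 0 < t := by linarith
  have hmem : ∀ s : ℝ, MemLp (fun x => U x + s * Φ x) (ENNReal.ofReal t) μ := fun s =>
    hU.add (hΦ.const_mul s)
  have hW : MemLp (fun x => |U x| + |Φ x|) (ENNReal.ofReal t) μ := hU.abs.add hΦ.abs
  have hbi : Integrable (fun x => t * (|U x| + |Φ x|) ^ t) μ := by
    have := (hW.integrable_abs_rpow ht).const_mul t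
    refine this.congr (Eventually.of_forall fun x => ?_)
    simp only
    rw [abs_of_nonneg (by positivity)]
  have hmeas : AEStronglyMeasurable
      (fun x => t * |U x + 0 * Φ x| ^ (t - 2) * (U x + 0 * Φ x) * Φ x) μ := by
    have h1 := (hmem 0).aestronglyMeasurable.aemeasurable
    have h2 := hΦ.aestronglyMeasurable.aemeasurable
    exact (((((continuous_abs.measurable.comp_aemeasurable h1).pow_const (t - 2)).const_mul t).mul
      h1).mul h2).aestronglyMeasurable
  have key := hasDerivAt_integral_of_dominated_loc_of_deriv_le (μ := μ) (𝕜 := ℝ)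
    (F := fun s x => |U x + s * Φ x| ^ t)
    (F' := fun s x => t * |U x + s * Φ x| ^ (t - 2) * (U x + s * Φ x) * Φ x)
    (x₀ := 0) (s := Metric.ball 0 1) (bound := fun x => t * (|U x| + |Φ x|) ^ t)
    (Metric.ball_mem_nhds _ one_pos)
    (Eventually.of_forall fun s => ((hmem s).integrable_abs_rpow ht).aestronglyMeasurable)
    ((hmem 0).integrable_abs_rpow ht) hmeas
    (Eventually.of_forall fun x s hs => by
      have hs1 : |s| ≤ 1 := by
        have : |s| < 1 := by simpa using hs
        exact this.le
      have hle : |U x + s * Φ x| ≤ |U x| + |Φ x| := by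
        refine (abs_add_le _ _).trans ?_
        rw [abs_mul]
        gcongr
        exact mul_le_of_le_one_left (abs_nonneg _) hs1
      have hW0 : 0 ≤ |U x| + |Φ x| := by positivity
      rw [Real.norm_eq_abs, abs_mul, abs_mul, abs_mul, abs_of_pos ht0,
        abs_of_nonneg (Real.rpow_nonneg (abs_nonneg (U x + s * Φ x)) _), mul_assoc t,
        abs_rpow_sub_two_mul_self ht, mul_assoc]
      refine mul_le_mul_of_nonneg_left ?_ ht0.le
      calc |U x + s * Φ x| ^ (t - 1) * |Φ x|
          ≤ (|U x| + |Φ x|) ^ (t - 1) * (|U x| + |Φ x|) := by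
            gcongr
            exact le_add_of_nonneg_left (abs_nonneg _)
        _ = (|U x| + |Φ x|) ^ t := by
            have h1 := Real.rpow_add_of_nonneg hW0 (show 0 ≤ t - 1 by linarith) zero_le_one
            rw [sub_add_cancel, Real.rpow_one] at h1
            exact h1.symm)
    hbi
    (Eventually.of_forall fun x s _ => by
      have h1 : HasDerivAt (fun s : ℝ => U x + s * Φ x) (Φ x) s := by
        simpa using ((hasDerivAt_id s).mul_const (Φ x)).const_add (U x)
      exact (hasDerivAt_abs_rpow (U x + s * Φ x) ht).comp s h1)
  simpa using key

theorem norm_rpow_eq_integral (ht : 1 < t) (y : Lp ℝ (ENNReal.ofReal t) μ) :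
    ‖y‖ ^ t = ∫ x, |y x| ^ t ∂μ := by
  have ht0 : 0 < t := by linarith
  have h0 : 0 ≤ ∫ x, |y x| ^ t ∂μ := integral_nonneg fun x => by positivity
  rw [Lp.norm_def, (Lp.memLp y).eLpNorm_eq_integral_rpow_norm (by simpa using ht0)
    ENNReal.ofReal_ne_top, ENNReal.toReal_ofReal ht0.le]
  simp only [Real.norm_eq_abs]
  rw [ENNReal.toReal_ofReal (by positivity), ← Real.rpow_mul h0, inv_mul_cancel₀ ht0.ne',
    Real.rpow_one]

theorem norm_add_smul_sub_rpow (ht : 1 < t) {y z g : Lp ℝ (ENNReal.ofReal t) μ} {U V f : X → ℝ}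
    (hy : y =ᵐ[μ] U) (hz : z =ᵐ[μ] V) (hg : g =ᵐ[μ] f) (s : ℝ) :
    ‖y + s • z - g‖ ^ t = ∫ x, |(U - f) x + s * V x| ^ t ∂μ := by
  rw [norm_rpow_eq_integral ht]
  refine integral_congr_ae ?_
  filter_upwards [Lp.coeFn_sub (y + s • z) g, Lp.coeFn_add y (s • z), Lp.coeFn_smul s z, hy, hz, hg]
    with x h1 h2 h3 h4 h5 h6
  rw [h1, Pi.sub_apply, h2, Pi.add_apply, h3, Pi.smul_apply, h4, h5, h6, smul_eq_mul,
    Pi.sub_apply, add_sub_right_comm]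

/-- The pointwise convexity deficit is nonnegative; were its integral not positive, it would vanish
almost everywhere, forcing `y = z`. -/
theorem norm_rpow_midpoint_lt (ht : 1 < t) {y z : Lp ℝ (ENNReal.ofReal t) μ} (hyz : y ≠ z) :
    ‖(1 / 2 : ℝ) • (y + z)‖ ^ t < ‖y‖ ^ t / 2 + ‖z‖ ^ t / 2 := by
  have hae : (((1 / 2 : ℝ) • (y + z) : Lp ℝ (ENNReal.ofReal t) μ) : X → ℝ) =ᵐ[μ]
      fun x => (1 / 2 : ℝ) * (y x + z x) := by
    filter_upwards [Lp.coeFn_smul (1 / 2 : ℝ) (y + z), Lp.coeFn_add y z] with x h1 h2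
    rw [h1, Pi.smul_apply, h2, Pi.add_apply, smul_eq_mul]
  have hm : ∫ x, |((1 / 2 : ℝ) • (y + z) : Lp ℝ (ENNReal.ofReal t) μ) x| ^ t ∂μ =
      ∫ x, |(1 / 2 : ℝ) * (y x + z x)| ^ t ∂μ := by
    refine integral_congr_ae ?_
    filter_upwards [hae] with x hx
    rw [hx]
  have i1 := (Lp.memLp y).integrable_abs_rpow ht
  have i2 := (Lp.memLp z).integrable_abs_rpow ht
  have i3 : Integrable (fun x => |(1 / 2 : ℝ) * (y x + z x)| ^ t) μ := by
    refine ((Lp.memLp ((1 / 2 : ℝ) • (y + z))).integrable_abs_rpow ht).congr ?_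
    filter_upwards [hae] with x hx
    rw [hx]
  have i12 : Integrable (fun x => |y x| ^ t / 2 + |z x| ^ t / 2) μ :=
    (i1.div_const 2).add (i2.div_const 2)
  rw [norm_rpow_eq_integral ht, norm_rpow_eq_integral ht, norm_rpow_eq_integral ht, hm]
  by_contra! hcon
  have hnn : 0 ≤ fun x => |y x| ^ t / 2 + |z x| ^ t / 2 - |(1 / 2 : ℝ) * (y x + z x)| ^ t := by
    intro x
    rw [Pi.zero_apply, sub_nonneg]
    by_cases h : y x = z x
    · rw [h, show (1 / 2 : ℝ) * (z x + z x) = z x by ring]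
      linarith
    · exact (abs_rpow_midpoint_lt ht h).le
  have hzero : ∫ x, (|y x| ^ t / 2 + |z x| ^ t / 2 - |(1 / 2 : ℝ) * (y x + z x)| ^ t) ∂μ = 0 := by
    refine le_antisymm ?_ (integral_nonneg hnn)
    rw [integral_sub i12 i3,
      integral_add (i1.div_const 2) (i2.div_const 2), integral_div, integral_div]
    linarith
  rw [integral_eq_zero_iff_of_nonneg hnn (i12.sub i3)] at hzero
  refine hyz (Lp.ext ?_)
  filter_upwards [hzero] with x hx
  by_contra hne
  have := abs_rpow_midpoint_lt ht hne
  simp only [Pi.zero_apply] at hx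
  linarith

/-- The fidelity term `lam ‖y - f‖^t`. -/
noncomputable def fidelity (lam : ℝ) (f y : Lp ℝ (ENNReal.ofReal t) μ) : ℝ := lam * ‖y - f‖ ^ t

variable {lam : ℝ} {f : Lp ℝ (ENNReal.ofReal t) μ}

theorem continuous_fidelity [Fact (1 ≤ ENNReal.ofReal t)] (ht : 1 < t) :
    Continuous (fidelity lam f) :=
  continuous_const.mul ((continuous_id.sub continuous_const).norm.rpow_const
    fun _ => Or.inr (by linarith))

theorem fidelity_nonneg [Fact (1 ≤ ENNReal.ofReal t)] (hlam : 0 < lam)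
    (y : Lp ℝ (ENNReal.ofReal t) μ) : 0 ≤ fidelity lam f y := by
  unfold fidelity
  positivity

theorem fidelity_midpoint_lt (ht : 1 < t) (hlam : 0 < lam) {y z : Lp ℝ (ENNReal.ofReal t) μ}
    (hyz : y ≠ z) :
    fidelity lam f ((1 / 2 : ℝ) • (y + z)) < fidelity lam f y / 2 + fidelity lam f z / 2 := by
  have h1 : (1 / 2 : ℝ) • (y + z) - f = (1 / 2 : ℝ) • ((y - f) + (z - f)) := by
    have : f = (1 / 2 : ℝ) • (f + f) := by
      rw [← two_smul ℝ f, smul_smul]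
      norm_num
    conv_lhs => rw [this]
    rw [← smul_sub]
    congr 1
    abel
  have h2 := norm_rpow_midpoint_lt ht (y := y - f) (z := z - f) fun h => hyz (sub_left_injective h)
  unfold fidelity
  rw [h1]
  have := mul_lt_mul_of_pos_left h2 hlam
  linarith

theorem exists_norm_le_of_fidelity_le [Fact (1 ≤ ENNReal.ofReal t)] (ht : 1 < t)
    (hlam : 0 < lam) (M : ℝ) :
    ∃ R, ∀ y, fidelity lam f y ≤ M → ‖y‖ ≤ R := by
  refine ⟨‖f‖ + (1 + M / lam), fun y hy => ?_⟩
  have h1 : ‖y - f‖ ^ t ≤ M / lam := by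
    rw [le_div_iff₀ hlam, mul_comm]
    exact hy
  have h0 : 0 ≤ ‖y - f‖ ^ t := by positivity
  have h2 : ‖y - f‖ ≤ 1 + M / lam := by
    rcases le_total ‖y - f‖ 1 with h | h
    · linarith
    · have := Real.self_le_rpow_of_one_le h ht.le
      linarith
  have h3 : ‖y‖ ≤ ‖f‖ + ‖y - f‖ := by
    have := norm_add_le f (y - f)
    rwa [add_sub_cancel] at this
  linarith

end PowerTerm

/-! ### The Euler–Lagrange equation, the a priori bound and the fixed point -/

section WeakSolution

open Filter Topology

theorem hasDerivAt_quadraticForm {E : Type*} [NormedAddCommGroup E] [NormedSpace ℝ E]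
    {B : E →L[ℝ] E →L[ℝ] ℝ} (hB : ∀ g h, B g h = B h g) (g h : E) :
    HasDerivAt (fun s : ℝ => B (g + s • h) (g + s • h) / 2) (B g h) 0 := by
  have h1 : (fun s : ℝ => B (g + s • h) (g + s • h) / 2) =
      fun s => B g g / 2 + s * B g h + s ^ 2 * (B h h / 2) := by
    funext s
    simp only [map_add, map_smul, add_apply, smul_apply,
      smul_eq_mul, hB h g]
    ring
  rw [h1]
  have h2 := (((hasDerivAt_id (0 : ℝ)).mul_const (B g h)).const_add (B g g / 2)).add
    (((hasDerivAt_id (0 : ℝ)).pow 2).mul_const (B h h / 2))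
  exact h2.congr_deriv (by simp)

/-- Along the line `u + s • φ` the energy is differentiable and minimal at `s = 0`. Symmetry of `B`
merges its two cross terms, and the factor `1 / 2` then leaves exactly `B (G u) (G φ)`. -/
theorem eulerLagrange {H E X : Type*} [NormedAddCommGroup H] [NormedSpace ℝ H]
    [NormedAddCommGroup E] [NormedSpace ℝ E] [MeasurableSpace X] {μ : Measure X} {t lam : ℝ}
    [Fact (1 ≤ ENNReal.ofReal t)] (ht : 1 < t) {G : H →L[ℝ] E}
    {ι : H →L[ℝ] Lp ℝ (ENNReal.ofReal t) μ} {g : Lp ℝ (ENNReal.ofReal t) μ}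
    {B : E →L[ℝ] E →L[ℝ] ℝ} (hB : ∀ x y, B x y = B y x) {u : H}
    (hu : ∀ v, energy G ι (fidelity lam g) B u ≤ energy G ι (fidelity lam g) B v) {φ : H}
    {U V f : X → ℝ} (hU : ι u =ᵐ[μ] U) (hV : ι φ =ᵐ[μ] V) (hf : g =ᵐ[μ] f) :
    Integrable (fun x => t * |U x - f x| ^ (t - 2) * (U x - f x) * V x) μ ∧
      B (G u) (G φ) + lam * ∫ x, t * |U x - f x| ^ (t - 2) * (U x - f x) * V x ∂μ = 0 := by
  obtain ⟨hint, hder⟩ := hasDerivAt_integral_abs_rpow ht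
    (((memLp_congr_ae hU).1 (Lp.memLp _)).sub ((memLp_congr_ae hf).1 (Lp.memLp _)))
    ((memLp_congr_ae hV).1 (Lp.memLp _))
  refine ⟨hint, ?_⟩
  have hE : (fun s : ℝ => energy G ι (fidelity lam g) B (u + s • φ)) = fun s =>
      B (G u + s • G φ) (G u + s • G φ) / 2 + lam * ∫ x, |(U - f) x + s * V x| ^ t ∂μ := by
    funext s
    simp only [energy, fidelity, map_add, map_smul, norm_add_smul_sub_rpow ht hU hV hf]
  have hmin : IsLocalMin (fun s : ℝ => energy G ι (fidelity lam g) B (u + s • φ)) 0 := by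
    refine Eventually.of_forall fun s => ?_
    simpa using hu (u + s • φ)
  rw [hE] at hmin
  exact hmin.hasDerivAt_eq_zero
    ((hasDerivAt_quadraticForm hB (G u) (G φ)).add (hder.const_mul lam))

/-- The bound does not involve `B`, so one data ball contains the minimisers for all tensor fields.
-/
theorem norm_le_of_energy_le_zero {H E X : Type*} [NormedAddCommGroup H] [NormedSpace ℝ H]
    [NormedAddCommGroup E] [NormedSpace ℝ E] [MeasurableSpace X] {μ : Measure X} {t lam : ℝ}
    [Fact (1 ≤ ENNReal.ofReal t)] (ht : 1 < t) (hlam : 0 < lam) {G : H →L[ℝ] E}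
    {ι : H →L[ℝ] Lp ℝ (ENNReal.ofReal t) μ} {f : Lp ℝ (ENNReal.ofReal t) μ}
    {B : E →L[ℝ] E →L[ℝ] ℝ} (hB : ∀ g, 0 ≤ B g g) {u : H}
    (hu : energy G ι (fidelity lam f) B u ≤ energy G ι (fidelity lam f) B 0) :
    ‖ι u‖ ≤ 2 * ‖f‖ := by
  have h0 := hB (G u)
  simp only [energy, fidelity, map_zero, zero_div, zero_add, zero_sub, norm_neg] at hu
  have h1 : ‖ι u - f‖ ^ t ≤ ‖f‖ ^ t := by
    refine le_of_mul_le_mul_left ?_ hlam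
    linarith
  have h2 : ‖ι u - f‖ ≤ ‖f‖ :=
    (Real.rpow_le_rpow_iff (norm_nonneg _) (norm_nonneg _) (by linarith)).1 h1
  have h3 := norm_add_le (ι u - f) f
  rw [sub_add_cancel] at h3
  linarith

variable {Ω K : Set Plane} {t : ℝ} [Fact (1 ≤ ENNReal.ofReal t)]
  {ι : W12 Ω →L[ℝ] Lp ℝ (ENNReal.ofReal t) (volume.restrict K)}

theorem mem_dataBall_iff (hι : ∀ u, (ι u : Plane → ℝ) =ᵐ[volume.restrict K] W12fn u) {R : ℝ}
    (hR : 0 ≤ R) {w : W12 Ω} : w ∈ dataBall Ω K t R ↔ ‖ι w‖ ≤ R := by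
  rw [Lp.norm_def, eLpNorm_congr_ae (hι w)]
  exact (ENNReal.le_ofReal_iff_toReal_le
    ((memLp_congr_ae (hι w)).1 (Lp.memLp (ι w))).eLpNorm_ne_top hR)

theorem convex_dataBall (hι : ∀ u, (ι u : Plane → ℝ) =ᵐ[volume.restrict K] W12fn u) {R : ℝ}
    (hR : 0 ≤ R) : Convex ℝ (dataBall Ω K t R) := by
  have : dataBall Ω K t R = ι.toLinearMap ⁻¹' Metric.closedBall 0 R := by
    ext w
    rw [mem_dataBall_iff hι hR, mem_preimage, mem_closedBall_zero_iff]
    rfl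
  rw [this]
  exact (convex_closedBall 0 R).linear_preimage _

end WeakSolution

theorem theorem1p1 (Ω K : Set Plane) (hΩ : IsBoundedLipschitzDomain Ω)
    (hK : NullMeasurableSet K volume) (hKΩ : K ⊆ Ω) (hKpos : 0 < volume K)
    (t : ℝ) (ht : 1 < t) (lam : ℝ) (hlam : 0 < lam)
    (f : Plane → ℝ) (hf : MemLp f (ENNReal.ofReal t) (volume.restrict K))
    (D : W12 Ω → C(closure Ω, SPD)) (hD : Continuous D)
    (hDcompact : ∀ R : ℝ, 0 < R → IsCompact (closure (D '' dataBall Ω K t R))) :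
    ∃ u : W12 Ω, IsWeakNeumannSolution Ω K t lam f D u := by
  have hfact : Fact (1 ≤ ENNReal.ofReal t) := ⟨by
    rw [← ENNReal.ofReal_one]
    exact ENNReal.ofReal_le_ofReal ht.le⟩
  have hfin : IsFiniteMeasure (volume.restrict Ω) :=
    isFiniteMeasure_restrict.2 hΩ.isBounded.measure_lt_top.ne
  obtain ⟨⟨ι, hι⟩, C, hP⟩ := hΩ.exists_embedding hKΩ (t := t)
  obtain ⟨B, hBint, hBi, hBs, hBe, hBc⟩ := exists_tensorForms hΩ
  -- Here the positive measure of `K` enters: the data term sees the constants, which the gradient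
  -- does not.
  have hone : ι (W12one Ω) ≠ 0 := by
    intro h0
    have h1 := hι (W12one Ω)
    rw [h0] at h1
    have h2 : ∀ᵐ x ∂(volume.restrict K), False := by
      filter_upwards [h1, Lp.coeFn_zero ℝ (ENNReal.ofReal t) (volume.restrict K),
        ae_restrict_of_ae_restrict_of_subset hKΩ (W12fn_one (Ω := Ω))] with x h3 h4 h5
      rw [h4, h5] at h3
      simp at h3
    have h3 : volume.restrict K = 0 := by simpa using h2
    exact hKpos.ne' (Measure.restrict_eq_zero.1 h3)
  set F := hf.toLp f
  obtain ⟨S, hS, hSmin⟩ := exists_continuous_minimizer (ι := ι) (G := gradL Ω)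
    (Ψ := fidelity lam F) (B := B) hP hone (continuous_fidelity ht) (fidelity_nonneg hlam)
    (exists_norm_le_of_fidelity_le ht hlam) (fun y z => fidelity_midpoint_lt ht hlam) hBc hBe
  -- The extra `1` keeps the radius positive, as `hDcompact` requires, even when the data vanish.
  have hR : 0 < 2 * ‖F‖ + 1 := by positivity
  have hball : ∀ A, S A ∈ dataBall Ω K t (2 * ‖F‖ + 1) := by
    intro A
    rw [mem_dataBall_iff hι hR.le]
    obtain ⟨a, ha, hBa⟩ := hBe A
    have := norm_le_of_energy_le_zero ht hlam
      (fun g => (by positivity : (0 : ℝ) ≤ a * ‖g‖ ^ 2).trans (hBa g)) (hSmin A 0)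
    linarith
  -- The compact set is the image under `S` of the closure of `D` of the ball. It lies in the ball
  -- because every `S A` does.
  obtain ⟨u, -, hu⟩ := exists_fixedPoint_of_compact_range (convex_dataBall hι hR.le)
    ((hDcompact _ hR).image hS) (image_subset_iff.2 fun A _ => hball A)
    ⟨0, (mem_dataBall_iff hι hR.le).2 (by simpa using hR.le)⟩ (T := S ∘ D)
    (hS.comp hD).continuousOn
    fun w hw => mem_image_of_mem S (subset_closure (mem_image_of_mem D hw))
  refine ⟨u, fun φ => ?_⟩
  have hmin := hSmin (D u)
  rw [show S (D u) = u from hu] at hmin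
  obtain ⟨h1, h2⟩ := eulerLagrange ht (hBs (D u)) hmin (hι u) (hι φ) hf.coeFn_toLp
  rw [hBint] at h2
  exact ⟨hBi (D u) (gradL Ω u) (gradL Ω φ), h1, h2⟩
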